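/- Let $\Lambda$ be a regular local ring and $R\supseteq\Lambda$ a commutative ring that is free of finite rank over $\Lambda$ and such that $\mathrm{Hom}_\Lambda(R,\Lambda)\simeq R$ as $R$-modules. **Conventions.** An $R$-module $M$ is *pseudo-null* if $M_{\mathfrak Q}=0$ for every prime $\mathfrak Q$ of $R$ of height $\le 1$; $M_{\mathrm{tor}}$ is the submodule of elements killed by a non-zero-divisor of $R$; $E^i(M)=\mathrm{Ext}^i_R(M,R)$; $\mathrm{Fitt}$ denotes the initial Fitting ideal; for a prime $\mathfrak q$ of $\Lambda$, $(-)_{\mathfrak q}$ is localization at $\Lambda\setminus\mathfrak q$. For a commutative noetherian ring $A$, $D^{[m,n]}(A)$ is the class of complexes quasi-isomorphic to a complex of finitely generated projective $A$-modules concentrated in degrees $m,\dots,n$. For a finitely generated projective module $F$ put $\det F=\bigwedge^{\mathrm{rank} F}F$, with rank a locally constant function on $\mathrm{Spec}$; exterior powers of locally constant degree are taken piecewise. Let $C$ be a perfect complex over $R$, i.e. one that admits a quasi-isomorphism $f:P\to C$ from a complex $P=[P^a\to\dots\to P^b]$ of finitely generated projective $R$-modules (we may take $a\le 1\le b$). Put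 $$l=\chi_R(C)=\sum_i(-1)^{i-1}\mathrm{rank}_R(P^i),\qquad \mathrm{Det}_R(C)=\bigotimes_i\big(\det P^i\big)^{\otimes(-1)^i},\qquad \mathrm{Det}_R^{-1}(C)=\mathrm{Det}_R(C)^*,$$ where $(-)^*$ is the linear dual, $(\det F)^{\otimes -1}=(\det F)^*$, and the degrees (signs) of determinant modules are ignored. **Proposition.** Assume that $H^i(C)$ is pseudo-null for every $i\ne1$. Then $l\ge0$, and there is a natural homomorphism $$\Psi_C:\bigwedge\nolimits_R^l H^1(C)\to\mathrm{Det}_R^{-1}(C),$$ namely the unique one with the following property. Let $\beta_i$ be the locally constant functions with $\mathrm{rank}\,P^i=\beta_i+\beta_{i+1}$ for $i\neq1$ and $\mathrm{rank}\,P^1=\beta_1+l+\beta_2$. Let $X_i\in\bigwedge^{\beta_{i+1}}P^i$ for all $i$, with $X_i=1$ if $i<a$ or $i\ge b$, and let $Y\in\bigwedge^l\ker(P^1\to P^2)$ with class $[Y]\in\bigwedge^lH^1(C)$. Put $\omega_i=d(X_{i-1})\wedge X_i$ for $i\ne1$ and $\omega_1=d(X_0)\wedge Y\wedge X_1$. Then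 for all $\varphi_i\in(\det P^i)^*$ ($i$ odd) $$\Psi_C([Y])\Big(\bigotimes_{i\ \mathrm{even}}\omega_i\otimes\bigotimes_{i\ \mathrm{odd}}\varphi_i\Big)=\prod_{i\ \mathrm{odd}}\varphi_i(\omega_i).$$ Up to isomorphism of the target, $\Psi_C$ does not depend on the choice of $P$ and $f$: for another choice $(P',f')$, with map $\Psi'_C$ to the corresponding determinant module, there is an isomorphism $\theta$ between the two modules $\mathrm{Det}^{-1}$ with $\Psi_C'=\theta\circ\Psi_C$. Moreover: 1. $\mathrm{Ker}(\Psi_C)=\big(\bigwedge_R^lH^1(C)\big)_{\mathrm{tor}}$. 2. If $\mathfrak q$ is a prime ideal of $\Lambda$ with $R_{\mathfrak q}\otimes^{\mathbb L}_RC\in D^{[0,1]}(R_{\mathfrak q})$ and $H^0(C)_{\mathfrak q}=0$, then $$\mathrm{Coker}(\Psi_C)_{\mathfrak q}\simeq R_{\mathfrak q}/\mathrm{Fitt}_{R_{\mathfrak q}}\big(E^1(H^1(C))_{\mathfrak q}\big)$$ as $R_{\mathfrak q}$-modules. In particular, if $C\in D^{[0,1]}(R)$ and $H^0(C)=0$,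 then $\mathrm{Coker}(\Psi_C)\simeq R/\mathrm{Fitt}_R(E^1(H^1(C)))$. 3. If $\mathfrak q$ is a prime ideal of $\Lambda$ with $R_{\mathfrak q}\otimes^{\mathbb L}_RC\in D^{[1,2]}(R_{\mathfrak q})$ and $\mathrm{pd}_{R_{\mathfrak q}}(H^2(C)_{\mathfrak q})\le2$, then $(\Psi_C)_{\mathfrak q}$ is bijective. -/

import Mathlib

open CategoryTheory
open scoped TensorProduct

universe u v

noncomputable section

namespace PerfDet

/-- Exterior power whose degree `l` is a locally constant function on the spectrum: on the open and
closed piece `{l = n}`, cut out by an idempotent `e`, it is the usual `n`-th exterior power. It is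
realised inside the exterior algebra; for constant `l = n` it is the Mathlib submodule `⋀[R]^n M`. -/
def extPow (R : Type*) [CommRing R] (l : PrimeSpectrum R → ℕ)
    (M : Type*) [AddCommGroup M] [Module R M] : Submodule R (ExteriorAlgebra R M) where
  carrier := {x | ∀ (n : ℕ) (e : R), IsIdempotentElem e →
    (∀ p : PrimeSpectrum R, e ∉ p.asIdeal → l p = n) → e • x ∈ ⋀[R]^n M}
  zero_mem' := fun n e _ _ => by rw [smul_zero]; exact Submodule.zero_mem _
  add_mem' := fun {x y} hx hy n e he h => by
    rw [smul_add]; exact Submodule.add_mem _ (hx n e he h) (hy n e he h)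
  smul_mem' := fun c x hx n e he h => by
    rw [smul_comm]; exact Submodule.smul_mem _ c (hx n e he h)

/-- For a constant degree this is the usual exterior power. -/
theorem extPow_const (R : Type*) [CommRing R] (n : ℕ)
    (M : Type*) [AddCommGroup M] [Module R M] : extPow R (fun _ => n) M = ⋀[R]^n M := by
  apply le_antisymm
  · intro x hx
    have h := hx n 1 IsIdempotentElem.one (fun _ _ => rfl)
    rwa [one_smul] at h
  · intro x hx m e _ h
    by_cases hmn : n = m
    · subst hmn
      exact Submodule.smul_mem _ e hx
    · have h0 : IsNilpotent e := by
        rw [nilpotent_iff_mem_prime]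
        intro J hJ
        by_contra he
        exact hmn (h ⟨J, hJ⟩ he)
      obtain ⟨k, hk⟩ := h0
      have he0 : e = 0 := by
        rcases k with _ | k
        · rw [pow_zero] at hk
          calc e = e * 1 := (mul_one e).symm
            _ = 0 := by rw [hk, mul_zero]
        · have hidem : IsIdempotentElem e := by assumption
          rwa [hidem.pow_succ_eq k] at hk
      rw [he0, zero_smul]
      exact Submodule.zero_mem _

/-- `det(F) = ⋀^{rank F} F`, where `rank F` is the (locally constant) rank of a finitely generated
projective module. -/
abbrev topPow (R : Type*) [CommRing R] (F : Type*) [AddCommGroup F] [Module R F] :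
    Submodule R (ExteriorAlgebra R F) :=
  extPow R (Module.rankAtStalk (R := R) F) F

/-- The even integers of the interval `[a, b]`. -/
abbrev evenDeg (a b : ℤ) : Finset ℤ := (Finset.Icc a b).filter (fun i => Even i)

/-- The odd integers of the interval `[a, b]`. -/
abbrev oddDeg (a b : ℤ) : Finset ℤ := (Finset.Icc a b).filter (fun i => Odd i)

section Complexes

variable {R : Type u} [CommRing R]

/-- A complex of finitely generated projective modules concentrated in degrees `a, …, b`. -/
structure IsStrictlyPerfect (a b : ℤ) (P : CochainComplex (ModuleCat.{u} R) ℤ) : Prop where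
  finite : ∀ i, Module.Finite R (P.X i)
  projective : ∀ i, Module.Projective R (P.X i)
  zero_outside : ∀ i, i < a ∨ b < i → Subsingleton (P.X i)

/-- The complex `K` belongs to `D^{[a,b]}(R)`: it is quasi-isomorphic to a complex of finitely
generated projective modules in degrees `a, …, b`. (As bounded complexes of projectives are
K-projective, an isomorphism in the derived category is given by a morphism of complexes.) -/
def InPerf (a b : ℤ) (K : CochainComplex (ModuleCat.{u} R) ℤ) : Prop :=
  ∃ (L : CochainComplex (ModuleCat.{u} R) ℤ) (g : L ⟶ K), IsStrictlyPerfect a b L ∧ QuasiIso g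

/-- The Euler characteristic `∑ᵢ (-1)^(i-1) rank(P^i)`, a function on the spectrum. -/
def eulerChar (a b : ℤ) (P : CochainComplex (ModuleCat.{u} R) ℤ) (p : PrimeSpectrum R) : ℤ :=
  ∑ i ∈ Finset.Icc a b, ((i - 1).negOnePow : ℤ) * (Module.rankAtStalk (R := R) (P.X i) p : ℤ)

/-- The determinant module `⨂ᵢ det(P^i)^{(-1)^i}` of a strictly perfect complex in degrees
`a, …, b`, where `det(F)^{-1}` is the linear dual of `det(F)`. The factors of even and of odd degree
are grouped together (degrees, i.e. signs, of determinant modules are ignored). -/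
abbrev Det (a b : ℤ) (P : CochainComplex (ModuleCat.{u} R) ℤ) : Type u :=
  (PiTensorProduct R fun i : evenDeg a b => topPow R (P.X i)) ⊗[R]
    (PiTensorProduct R fun i : oddDeg a b => Module.Dual R (topPow R (P.X i)))

/-- `Det^{-1}`, the linear dual of the determinant module. -/
abbrev DetInv (a b : ℤ) (P : CochainComplex (ModuleCat.{u} R) ℤ) : Type u :=
  Module.Dual R (Det a b P)

/-- The map from the `i`-cocycles of `P` to the cohomology `H^i(K)` induced by `f : P ⟶ K`. -/
def cocycleClass {P K : CochainComplex (ModuleCat.{u} R) ℤ} (f : P ⟶ K) (i : ℤ) :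
    P.cycles i →ₗ[R] K.homology i :=
  (P.homologyπ i ≫ HomologicalComplex.homologyMap f i).hom

/-- The formula that pins the natural map `⋀^l H^1(K) → Det^{-1}(P)` for a quasi-isomorphism
`f : P ⟶ K` with `P` strictly perfect in degrees `a ≤ 1 ≤ b`. After inverting the non-zero-divisors,
the cohomology outside degree `1` is to vanish, and `β i` is the rank of the coboundaries of
degree `i`. For `X i` in the `β (i+1)`-th exterior power of `P^i` and `Y` in the `l`-th exterior
power of the `1`-cocycles, the elements
`ω i = d(X (i-1)) ∧ X i` for `i ≠ 1` and `ω 1 = d(X 0) ∧ Y ∧ X 1`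
lie in `det(P^i)`. The class of `Y` is sent to the functional on `Det(P)` whose
value at `(⨂_{i even} ω i) ⊗ (⨂_{i odd} φ i)` is `∏_{i odd} φ i (ω i)`; in other words to
`⨂ᵢ (ω i)^{(-1)^(i+1)}`. This is the canonical isomorphism of the determinant of a complex
with the determinant of its cohomology. For a complex `[P^0 → P^1]` with differential `α` it reads
`Y ↦ (X ↦ α(X) ∧ Y)`. -/
def IsNaturalMap (a b : ℤ) {P K : CochainComplex (ModuleCat.{u} R) ℤ} (f : P ⟶ K)
    (l : PrimeSpectrum R → ℕ)
    (Ψ : extPow R l (K.homology 1) →ₗ[R] DetInv a b P) : Prop :=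
  ∀ β : ℤ → PrimeSpectrum R → ℕ,
    (∀ i p, Module.rankAtStalk (R := R) (P.X i) p
      = β i p + β (i + 1) p + (if i = 1 then l p else 0)) →
  ∀ X : (i : ℤ) → ExteriorAlgebra R (P.X i),
    (∀ i, X i ∈ extPow R (β (i + 1)) (P.X i)) →
    (∀ i, i < a ∨ b ≤ i → X i = 1) →
  ∀ Y : (i : ℤ) → ExteriorAlgebra R (P.cycles i),
    Y 1 ∈ extPow R l (P.cycles 1) → (∀ i, i ≠ 1 → Y i = 1) →
  ∀ z : extPow R l (K.homology 1),
    (z : ExteriorAlgebra R (K.homology 1)) = ExteriorAlgebra.map (cocycleClass f 1) (Y 1) →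
  ∀ ω : (i : ℤ) → topPow R (P.X i),
    (∀ i, (ω i : ExteriorAlgebra R (P.X i))
      = ExteriorAlgebra.map (P.d (i - 1) i).hom (X (i - 1))
        * ExteriorAlgebra.map (P.iCycles i).hom (Y i) * X i) →
  ∀ φ : (i : ℤ) → Module.Dual R (topPow R (P.X i)),
    Ψ z ((PiTensorProduct.tprod R fun i : evenDeg a b => ω i) ⊗ₜ[R]
        (PiTensorProduct.tprod R fun i : oddDeg a b => φ i))
      = ∏ i ∈ oddDeg a b, φ i (ω i)

/-- The module `E^i(M) = Ext^i_R(M, R)`. -/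
abbrev E (i : ℕ) (M : ModuleCat.{u} R) : Type u :=
  Abelian.Ext.{u} M (ModuleCat.of R R) i

end Complexes

/-- A module is pseudo-null if its localizations at all primes of height at most one vanish. -/
def IsPseudoNull (R : Type*) [CommRing R] (M : Type*) [AddCommGroup M] [Module R M] : Prop :=
  ∀ Q : PrimeSpectrum R, Q.asIdeal.height ≤ 1 →
    Subsingleton (LocalizedModule Q.asIdeal.primeCompl M)

/-- The (initial) Fitting ideal of a finitely presented module `M`: for a presentation
`A^m → A^n → M → 0` with matrix `H`, it is generated by the `n × n` minors of `H`. It does not depend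
on the presentation; to avoid a choice, all finite presentations are used. -/
def fitting (A : Type*) [CommRing A] (M : Type*) [AddCommGroup M] [Module A M] : Ideal A :=
  Ideal.span {δ : A | ∃ (m n : ℕ) (H : Matrix (Fin n) (Fin m) A) (π : (Fin n → A) →ₗ[A] M),
    Function.Surjective π ∧ LinearMap.range H.mulVecLin = LinearMap.ker π ∧
    ∃ s : Fin n → Fin m, δ = (H.submatrix id s).det}

/-- The multiplicative set `Λ \ q`, mapped to the `Λ`-algebra `R`; localizing `R`-modules at it is
the localization `(-)_q`. -/
abbrev mulSet {Λ : Type*} [CommRing Λ] (R : Type u) [CommRing R] [Algebra Λ R]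
    (q : Ideal Λ) [q.IsPrime] : Submonoid R :=
  Algebra.algebraMapSubmonoid R q.primeCompl

/-- The ring `R_q`. -/
abbrev LocRing {Λ : Type*} [CommRing Λ] (R : Type u) [CommRing R] [Algebra Λ R]
    (q : Ideal Λ) [q.IsPrime] : Type u :=
  Localization (mulSet R q)

/-- The module `M_q` over `R_q`. -/
abbrev LocMod {Λ : Type*} [CommRing Λ] (R : Type u) [CommRing R] [Algebra Λ R]
    (q : Ideal Λ) [q.IsPrime] (M : Type*) [AddCommGroup M] [Module R M] :=
  LocalizedModule (mulSet R q) M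

/-- The complex `R_q ⊗_R P`, which for a bounded complex `P` of projectives is the derived tensor
product. -/
abbrev locComplex {Λ : Type*} [CommRing Λ] {R : Type u} [CommRing R] [Algebra Λ R]
    (q : Ideal Λ) [q.IsPrime] (P : CochainComplex (ModuleCat.{u} R) ℤ) :
    CochainComplex (ModuleCat.{u} (LocRing R q)) ℤ :=
  ((ModuleCat.extendScalars.{u} (algebraMap R (LocRing R q))).mapHomologicalComplex
    (ComplexShape.up ℤ)).obj P

end PerfDet

end

/-! Two properties of `R` carry the proof. It is semilocal, so the determinant of every finitely
generated projective module is free of rank one, and `Det⁻¹` can be identified with `R`. It also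
satisfies a form of Serre's condition `S₂`: equalities can be tested at primes of height 0, and
divisibility by a non-zero-divisor at primes of height at most 1 (`SerreSTwo.of_finite_free`). The
second property descends from `Λ`, where a nonzero principal ideal has only associated primes of
height at most 1, because `R` is finite and free over `Λ`.

After trivializing the determinants, the test data `X`, `Y` produce a numerator (the product of the
coordinates of the odd `ω i`) and a denominator (the product of the even ones). The natural map
becomes a scalar-valued `ψ` with `num = ψ([Y]) * den`.

At a prime `p` of height at most 1 the complex is exact off degree 1, by pseudo-nullity. Depth at
most 1 forces all coboundary modules at `p` to be free (`free_range_dLoc_zero_one`). Each `ω i` then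
factors through bases of coboundaries. Every such factor occurs once in the numerator and once in
the denominator, and what survives is, up to a unit, the determinant of `c ∧ Y`, with `c` a basis of
the degree-one coboundaries inside the free module `Z` of cocycles (`exists_local_formula`).
Moreover `X` can be chosen so that the denominator is a unit at `p`. At a minimal prime the
cohomology is itself free of rank `l`, and the determinant depends only on `[Y]`. Hence all
fractions with a given class agree, and `S₂` glues them to one element of `R`
(`SerreSTwo.exists_eq_mul`). Uniqueness, linearity and the kernel are also read off at minimal
primes.

Changing `P` changes the free presentation of the same module `H¹` at each prime of height at most
1. The determinant of relations and a form is independent of the presentation up to a unit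
(`exists_detOn_presentation`), and these local units glue to a global one.

Wherever the degree-one coboundaries are free, the image of `ψ` is generated by the maximal minors
of `c` in `Z`. As `Ext¹(H¹, R)` is there the cokernel of `Z* → B*`, for `B` the coboundaries, those
minors generate its Fitting ideal (`IsScalar.map_range_eq`). This gives the cokernel, since
amplitude `[0,1]` with `H⁰ = 0` bounds the projective dimension of `H¹` by 1.

In amplitude `[1,2]` with `pd H² ≤ 2`, dimension shifting makes `H¹` projective. The wedge of a
local basis of `H¹` then has unit image: otherwise, by Krull's principal ideal theorem, its image
would lie in a prime of height at most 1, where the local formula makes it a unit. -/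

/-- In a noetherian ring the elements that multiply `c ∉ J` into `J` lie in a prime ideal that is itself
of the form `(J : c')`. -/
theorem Ideal.exists_isPrime_colon {A : Type*} [CommRing A] [IsNoetherianRing A] (J : Ideal A) {c : A}
    (hc : c ∉ J) : ∃ (P : Ideal A) (c' : A), P.IsPrime ∧ c' ∉ J ∧ (∀ y, y ∈ P ↔ y * c' ∈ J) ∧
      ∀ y, y * c ∈ J → y ∈ P := by
  have h0 : (Ideal.Quotient.mk J c) ≠ 0 := by rwa [Ne, Ideal.Quotient.eq_zero_iff_mem]
  obtain ⟨P, hP, hle⟩ := exists_le_isAssociatedPrime_of_isNoetherianRing A (Ideal.Quotient.mk J c) h0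
  obtain ⟨hp, x, hx⟩ := isAssociatedPrime_iff.1 hP
  obtain ⟨c', rfl⟩ := Ideal.Quotient.mk_surjective x
  have key : ∀ y, y ∈ P ↔ y * c' ∈ J := by
    intro y
    rw [hx, Submodule.mem_colon_singleton]
    rw [Submodule.mem_bot, Algebra.smul_def, ← Ideal.Quotient.eq_zero_iff_mem, map_mul]; rfl
  refine ⟨P, c', hp, fun h => hp.ne_top ?_, key, fun y hy => hle ?_⟩
  · rw [Ideal.eq_top_iff_one, key, one_mul]; exact h
  · rw [Submodule.mem_colon_singleton, Submodule.mem_bot, Algebra.smul_def]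
    have := Ideal.Quotient.eq_zero_iff_mem.2 hy
    rwa [map_mul] at this

/-! ### Regular local rings: they are domains, and principal ideals are unmixed. -/

namespace IsRegularLocalRing

open IsLocalRing

theorem exists_generators {A : Type*} [CommRing A] [IsRegularLocalRing A] :
    ∃ s : Finset A, s.card = (maximalIdeal A).spanFinrank ∧
      Ideal.span (s : Set A) = maximalIdeal A :=
  Submodule.FG.exists_span_finset_card_eq_spanFinrank (IsNoetherian.noetherian _)

/-- When `t` is written in minimal generators of the maximal ideal, some coefficient is a unit
because `t` lies outside the square. Modulo `t` that generator is redundant. -/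
theorem spanFinrank_quotient_add_one_le {A : Type*} [CommRing A] [IsRegularLocalRing A] {t : A}
    (ht : t ∈ maximalIdeal A) (ht2 : t ∉ maximalIdeal A ^ 2) :
    ((maximalIdeal A).map (Ideal.Quotient.mk (Ideal.span {t}))).spanFinrank + 1
      ≤ (maximalIdeal A).spanFinrank := by
  classical
  obtain ⟨s, hs, hsm⟩ := exists_generators (A := A)
  have hmem : t ∈ Ideal.span (s : Set A) := hsm ▸ ht
  obtain ⟨c, -, hc⟩ := Submodule.mem_span_finset.1 hmem
  obtain ⟨x, hxs, hcx⟩ : ∃ x ∈ s, c x ∉ maximalIdeal A := by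
    by_contra! h
    refine ht2 (hc ▸ Ideal.sum_mem _ fun x hx => ?_)
    rw [pow_two]
    exact Ideal.mul_mem_mul (h x hx) (hsm ▸ Ideal.subset_span hx)
  have hcu : IsUnit (c x) := by simpa using hcx
  have hle : (maximalIdeal A).map (Ideal.Quotient.mk (Ideal.span {t}))
      = Ideal.span (((s.erase x).image (Ideal.Quotient.mk (Ideal.span {t})) : Finset _) : Set _) := by
    rw [← hsm, Ideal.map_span]
    apply le_antisymm
    · rw [Ideal.span_le]
      rintro _ ⟨y, hy, rfl⟩
      by_cases hyx : y = x
      · subst hyx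
        have h1 : Ideal.Quotient.mk (Ideal.span {t}) (c y)
            * Ideal.Quotient.mk (Ideal.span {t}) y
            = - ∑ z ∈ s.erase y, Ideal.Quotient.mk (Ideal.span {t}) (c z)
              * Ideal.Quotient.mk (Ideal.span {t}) z := by
          rw [eq_neg_iff_add_eq_zero]
          simp only [← map_mul, ← map_sum, ← map_add]
          rw [Ideal.Quotient.eq_zero_iff_mem, Ideal.mem_span_singleton]
          rw [Finset.add_sum_erase s (fun z => c z * z) hxs]
          exact ⟨1, by rw [mul_one]; exact hc⟩
        have hu := hcu.map (Ideal.Quotient.mk (Ideal.span {t}))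
        refine (Ideal.unit_mul_mem_iff_mem _ hu).1 ?_
        rw [h1]
        refine Submodule.neg_mem _ (Ideal.sum_mem _ fun z hz => Ideal.mul_mem_left _ _ ?_)
        exact Ideal.subset_span (Finset.mem_coe.2 (Finset.mem_image_of_mem _ hz))
      · exact Ideal.subset_span (Finset.mem_coe.2 (Finset.mem_image_of_mem _
          (Finset.mem_erase.2 ⟨hyx, hy⟩)))
    · refine Ideal.span_mono ?_
      intro y hy
      simp only [Finset.coe_image, Finset.coe_erase, Set.mem_image] at hy ⊢
      obtain ⟨z, hz, rfl⟩ := hy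
      exact ⟨z, hz.1, rfl⟩
  rw [hle]
  have h1 : (Ideal.span (((s.erase x).image (Ideal.Quotient.mk (Ideal.span {t})) : Finset _)
      : Set (A ⧸ Ideal.span {t}))).spanFinrank ≤ (s.erase x).card :=
    (Submodule.spanFinrank_span_le_ncard_of_finite (Finset.finite_toSet _)).trans
      (by rw [Set.ncard_coe_finset]; exact Finset.card_image_le)
  have h2 := Finset.card_erase_add_one hxs
  omega

/-- Killing `t` lowers the dimension by at most one and the embedding dimension by at least one, so
the two numbers remain equal. -/
theorem quotient {A : Type*} [CommRing A] [IsRegularLocalRing A] {t : A}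
    (ht : t ∈ maximalIdeal A) (ht2 : t ∉ maximalIdeal A ^ 2) :
    IsRegularLocalRing (A ⧸ Ideal.span {t}) ∧
      ∀ [IsLocalRing (A ⧸ Ideal.span {t})],
        (maximalIdeal (A ⧸ Ideal.span {t})).spanFinrank < (maximalIdeal A).spanFinrank := by
  have hne : Ideal.span {t} ≠ ⊤ := fun h => by
    have : Ideal.span {t} ≤ maximalIdeal A := by rwa [Ideal.span_singleton_le_iff_mem]
    rw [h] at this
    exact (IsLocalRing.maximalIdeal.isMaximal A).ne_top (top_le_iff.1 this)
  have : Nontrivial (A ⧸ Ideal.span {t}) := Ideal.Quotient.nontrivial_iff.2 hne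
  have : IsLocalRing (A ⧸ Ideal.span {t}) :=
    IsLocalRing.of_surjective' _ Ideal.Quotient.mk_surjective
  have hmap : (maximalIdeal A).map (Ideal.Quotient.mk (Ideal.span {t}))
      = maximalIdeal (A ⧸ Ideal.span {t}) :=
    IsLocalRing.map_maximalIdeal_of_surjective _ Ideal.Quotient.mk_surjective
  have h1 := spanFinrank_quotient_add_one_le ht ht2
  rw [hmap] at h1
  have h2 : ((maximalIdeal A).height : WithBot ℕ∞) ≤ ringKrullDim (A ⧸ Ideal.span {t}) + 1 :=
    Ideal.height_le_ringKrullDim_quotient_add_one ht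
  rw [IsLocalRing.maximalIdeal_height_eq_ringKrullDim,
    ← IsRegularLocalRing.spanFinrank_maximalIdeal] at h2
  refine ⟨IsRegularLocalRing.of_spanFinrank_maximalIdeal_le _ ?_, fun {_} => h1⟩
  rw [← IsLocalRing.maximalIdeal_height_eq_ringKrullDim] at h2 ⊢
  generalize (maximalIdeal (A ⧸ Ideal.span {t})).height = h at h2 ⊢
  induction h with
  | top => exact le_top
  | coe k =>
    have h3 : (maximalIdeal A).spanFinrank ≤ k + 1 := by exact_mod_cast h2
    have h4 : (maximalIdeal (A ⧸ Ideal.span {t})).spanFinrank ≤ k := by omega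
    exact_mod_cast h4

theorem exists_notMem_sq {A : Type*} [CommRing A] [IsRegularLocalRing A]
    (h : maximalIdeal A ≠ ⊥) : ¬ maximalIdeal A ≤ maximalIdeal A ^ 2 := by
  intro hle
  refine h (Submodule.eq_bot_of_le_smul_of_le_jacobson_bot (maximalIdeal A) _
    (IsNoetherian.noetherian _) ?_ (IsLocalRing.maximalIdeal_le_jacobson _))
  rwa [smul_eq_mul, ← pow_two]

/-- Induction on the embedding dimension: cut by some `t` outside the square of the maximal ideal
and outside all minimal primes. By induction `t` generates a prime ideal, and a minimal prime inside
it is zero by Nakayama. -/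
theorem isDomain_aux (n : ℕ) : ∀ (A : Type v) [CommRing A] [IsRegularLocalRing A],
    (maximalIdeal A).spanFinrank = n → IsDomain A := by
  induction n using Nat.strong_induction_on with
  | _ n ih =>
  intro A _ _ hn
  by_cases h0 : maximalIdeal A = ⊥
  · exact (IsLocalRing.isField_iff_maximalIdeal_eq.2 h0).isDomain
  classical
  have hfin := minimalPrimes.finite_of_isNoetherianRing A
  obtain ⟨t, ht, htn⟩ : ∃ t ∈ maximalIdeal A, t ∉ maximalIdeal A ^ 2 ∧ ∀ p ∈ minimalPrimes A, t ∉ p := by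
    by_contra! hcon
    have hsub : ((maximalIdeal A : Ideal A) : Set A) ⊆
        ⋃ i ∈ ((insert (maximalIdeal A ^ 2) hfin.toFinset : Finset (Ideal A)) : Set (Ideal A)),
          ((id i : Ideal A) : Set A) := by
      intro t ht
      by_cases h2 : t ∈ maximalIdeal A ^ 2
      · exact Set.mem_biUnion (by simp) h2
      · obtain ⟨p, hp, htp⟩ := hcon t ht h2
        exact Set.mem_biUnion (by simp [hp]) htp
    -- Prime avoidance tolerates two ideals that are not prime; the square of the maximal ideal
    -- fills both places.
    rw [Ideal.subset_union_prime (maximalIdeal A ^ 2) (maximalIdeal A ^ 2)] at hsub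
    · obtain ⟨i, hi, hle⟩ := hsub
      rw [Finset.mem_insert] at hi
      rcases hi with rfl | hi
      · exact exists_notMem_sq h0 hle
      · have hp : i ∈ minimalPrimes A := by simpa using hi
        have hpp : i.IsPrime := hp.1.1
        have hi' : i = maximalIdeal A := le_antisymm (IsLocalRing.le_maximalIdeal hpp.ne_top) hle
        have hh : (maximalIdeal A).height = 0 := by
          rw [← hi', Ideal.height_eq_zero_iff]; exact hp
        have := IsRegularLocalRing.spanFinrank_maximalIdeal (R := A)
        rw [← IsLocalRing.maximalIdeal_height_eq_ringKrullDim, hh] at this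
        have h3 : (maximalIdeal A).spanFinrank = 0 := by exact_mod_cast this
        exact h0 ((Submodule.spanFinrank_eq_zero_iff_eq_bot (IsNoetherian.noetherian _)).1 h3)
    · intro i hi hi2 _
      rw [Finset.mem_insert] at hi
      have hp : i ∈ minimalPrimes A := by simpa using hi.resolve_left hi2
      exact hp.1.1
  obtain ⟨hreg, hlt⟩ := quotient ht htn.1
  have hdom : IsDomain (A ⧸ Ideal.span {t}) := ih _ (hn ▸ hlt) _ rfl
  have hprime : (Ideal.span {t}).IsPrime := (Ideal.Quotient.isDomain_iff_prime _).1 hdom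
  obtain ⟨p, hp, hle⟩ := Ideal.exists_minimalPrimes_le (I := ⊥) (J := Ideal.span {t}) bot_le
  have hpp : p.IsPrime := hp.1.1
  -- An element of `p` is a multiple `t * c`, and `t ∉ p` forces `c ∈ p`. Hence `p = t p`.
  have hbot : p = ⊥ := by
    refine Submodule.eq_bot_of_le_smul_of_le_jacobson_bot (maximalIdeal A) _
      (IsNoetherian.noetherian _) ?_ (IsLocalRing.maximalIdeal_le_jacobson _)
    intro y hy
    obtain ⟨c, rfl⟩ := Ideal.mem_span_singleton.1 (hle hy)
    exact Ideal.mul_mem_mul ht ((hpp.mem_or_mem hy).resolve_left (htn.2 p hp))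
  subst hbot
  exact IsDomain.of_bot_isPrime A

theorem isDomain (A : Type v) [CommRing A] [IsRegularLocalRing A] : IsDomain A :=
  isDomain_aux _ A rfl

/-- This is the unmixedness of principal ideals in a Cohen–Macaulay ring, by induction on the
embedding dimension. One cuts by a regular parameter `t`, a prime element. If `t ∉ p`, a larger
prime containing both `t` and `p` is associated to a principal ideal of `A/t`; by induction it has
height at most 2 in `A`, which leaves at most 1 for `p`. -/
theorem height_le_one_aux (n : ℕ) : ∀ (A : Type v) [CommRing A] [IsRegularLocalRing A],
    (maximalIdeal A).spanFinrank = n → ∀ (x a : A) (p : Ideal A) [p.IsPrime], x ≠ 0 → ¬ x ∣ a →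
    (∀ y ∈ p, x ∣ y * a) → p.height ≤ 1 := by
  induction n using Nat.strong_induction_on with
  | _ n ih =>
  intro A _ _ hn x a p hp hx hxa hpa
  have hdomA := isDomain A
  by_contra hht
  have hpm : p ≤ maximalIdeal A := IsLocalRing.le_maximalIdeal hp.ne_top
  by_cases h0 : maximalIdeal A = ⊥
  · rw [h0, le_bot_iff] at hpm
    subst hpm
    exact hht (by simp)
  obtain ⟨t, ht, ht2⟩ := SetLike.not_le_iff_exists.1 (exists_notMem_sq h0)
  have ht0 : t ≠ 0 := by rintro rfl; exact ht2 (Ideal.zero_mem _)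
  obtain ⟨hreg, hlt⟩ := quotient ht ht2
  have hdom : IsDomain (A ⧸ Ideal.span {t}) := isDomain _
  have htp : Prime t :=
    (Ideal.span_singleton_prime ht0).1 ((Ideal.Quotient.isDomain_iff_prime _).1 hdom)
  have hnle : ¬ p ≤ Ideal.span {t} := fun hle => hht (by
    have h1 : (Ideal.span {t}).height ≤ 1 := by
      have := (Ideal.span_singleton_prime ht0).2 htp
      refine Ideal.height_le_one_of_isPrincipal_of_mem_minimalPrimes (Ideal.span {t}) _ ?_
      rw [Ideal.minimalPrimes_eq_subsingleton_self]; rfl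
    exact (Ideal.height_mono hle).trans h1)
  -- the annihilation property does not depend on the element of `p`
  have indep : ∀ x' ∈ p, x' ≠ 0 → ∃ a', ¬ x' ∣ a' ∧ ∀ y ∈ p, x' ∣ y * a' := by
    intro x' hx' hx0
    obtain ⟨c, hc⟩ := hpa x' hx'
    refine ⟨c, ?_, ?_⟩
    · rintro ⟨e, rfl⟩
      exact hxa ⟨e, mul_left_cancel₀ hx0 (by rw [hc]; ring)⟩
    · intro y hy
      obtain ⟨b, hb⟩ := hpa y hy
      refine ⟨b, mul_left_cancel₀ hx ?_⟩
      calc x * (y * c) = y * (x * c) := by ring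
        _ = x' * (y * a) := by rw [← hc]; ring
        _ = x * (x' * b) := by rw [hb]; ring
  -- If `t ∈ p`, take `t` itself as the element: `A/t` is a domain, so an ideal killing a nonzero
  -- class is zero modulo `t`.
  by_cases htmem : t ∈ p
  · obtain ⟨c, hc, hcy⟩ := indep t htmem ht0
    exact hnle fun y hy => Ideal.mem_span_singleton.2 ((htp.dvd_or_dvd (hcy y hy)).resolve_right hc)
  obtain ⟨x', hx'p, hx't⟩ := SetLike.not_le_iff_exists.1 hnle
  rw [Ideal.mem_span_singleton] at hx't
  have hx'0 : x' ≠ 0 := by rintro rfl; exact hx't (dvd_zero t)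
  obtain ⟨a', ha', hpa'⟩ := indep x' hx'p hx'0
  -- `N / (x')` is the part of `A / x'` killed by `p`.
  let N : Ideal A :=
    { carrier := {c | ∀ y ∈ p, x' ∣ y * c}
      zero_mem' := fun y _ => by simp
      add_mem' := fun {c e} hc he y hy => by rw [mul_add]; exact dvd_add (hc y hy) (he y hy)
      smul_mem' := fun r c hc y hy => by
        rw [smul_eq_mul, mul_left_comm]; exact Dvd.dvd.mul_left (hc y hy) r }
  -- The prime `t` does not divide `x'`, so it is regular modulo `x'`. If `N` were contained in
  -- `(x', t)`, this would give `N ⊆ (x') + t N`, and Nakayama would put `N` inside `(x')`, against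
  -- the choice of `a'`.
  have hN : ¬ N ≤ Ideal.span {x'} ⊔ Ideal.span {t} := by
    intro hle
    have : N ≤ Ideal.span {x'} := by
      refine Submodule.le_of_le_smul_of_le_jacobson_bot (I := maximalIdeal A)
        (IsNoetherian.noetherian _) (IsLocalRing.maximalIdeal_le_jacobson _) ?_
      intro c hc
      obtain ⟨u, hu, w, hw, rfl⟩ := Submodule.mem_sup.1 (hle hc)
      obtain ⟨f, rfl⟩ := Ideal.mem_span_singleton.1 hu
      obtain ⟨e, rfl⟩ := Ideal.mem_span_singleton.1 hw
      refine Submodule.add_mem_sup hu (Ideal.mul_mem_mul ht ?_)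
      intro y hy
      have h1 : x' ∣ y * (t * e) := by
        have h2 := hc y hy
        rw [mul_add] at h2
        exact (dvd_add_right ((dvd_mul_right x' f).mul_left y)).1 h2
      obtain ⟨g, hg⟩ := h1
      have h3 : t ∣ x' * g := ⟨y * e, by rw [← hg]; ring⟩
      obtain ⟨g', rfl⟩ := (htp.dvd_or_dvd h3).resolve_left hx't
      exact ⟨g', mul_left_cancel₀ ht0 (by linear_combination hg)⟩
    exact ha' (Ideal.mem_span_singleton.1 (this hpa'))
  obtain ⟨c, hcN, hc⟩ := SetLike.not_le_iff_exists.1 hN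
  let π := Ideal.Quotient.mk (Ideal.span {t})
  have hπ : ∀ z, π z = 0 ↔ t ∣ z := fun z => by
    rw [Ideal.Quotient.eq_zero_iff_mem, Ideal.mem_span_singleton]
  have hc' : π c ∉ Ideal.span {π x'} := by
    intro h
    obtain ⟨e, he⟩ := Ideal.mem_span_singleton.1 h
    obtain ⟨e, rfl⟩ := Ideal.Quotient.mk_surjective e
    have : t ∣ c - x' * e := (hπ _).1 (by rw [map_sub, map_mul, he]; exact sub_self _)
    obtain ⟨w, hw⟩ := this
    refine hc ?_
    have : c = x' * e + t * w := by linear_combination hw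
    rw [this]
    exact Submodule.add_mem_sup (Ideal.mem_span_singleton.2 ⟨e, rfl⟩)
      (Ideal.mem_span_singleton.2 ⟨w, rfl⟩)
  obtain ⟨P, c', hP, hc'1, hPc, hPle⟩ := Ideal.exists_isPrime_colon (Ideal.span {π x'}) hc'
  have hP1 : P.height ≤ 1 := ih _ (hn ▸ hlt) (A ⧸ Ideal.span {t}) rfl (π x') c' P
    (fun h => hx't ((hπ _).1 h)) (fun h => hc'1 (Ideal.mem_span_singleton.2 h))
    (fun y hy => Ideal.mem_span_singleton.1 ((hPc y).1 hy))
  -- The preimage of `P` contains `t` while `p` does not, so the inclusion is strict and costs one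
  -- unit of height.
  have hpQ : p < P.comap π := by
    refine lt_of_le_of_ne ?_ ?_
    · intro y hy
      rw [Ideal.mem_comap]
      refine hPle _ ?_
      rw [← map_mul, Ideal.mem_span_singleton]
      exact map_dvd π (hcN y hy)
    · rintro rfl
      exact htmem (by rw [Ideal.mem_comap, (hπ t).2 dvd_rfl]; exact P.zero_mem)
  have hQ : (P.comap π).height ≤ 1 + 1 := by
    have hle : Ideal.span {t} ≤ P.comap π := by
      rw [Ideal.span_singleton_le_iff_mem, Ideal.mem_comap, (hπ t).2 dvd_rfl]; exact P.zero_mem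
    refine (Ideal.height_le_height_add_spanFinrank_of_le hle).trans (add_le_add ?_ ?_)
    · rw [Ideal.map_comap_of_surjective _ Ideal.Quotient.mk_surjective]; exact hP1
    · have := Submodule.spanFinrank_singleton (R := A) ht0
      change ((Submodule.span A {t}).spanFinrank : ℕ∞) ≤ 1
      rw [this]; rfl
  have hlt' := Ideal.height_add_one_le_of_lt_of_isPrime hpQ
  exact hht (ENat.add_le_add_iff_right ENat.one_ne_top |>.1 (hlt'.trans hQ))

/-- The associated primes of a nonzero principal ideal of a regular local ring have height at most
one. -/
theorem height_le_one {A : Type v} [CommRing A] [IsRegularLocalRing A] {x a : A} {p : Ideal A}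
    [p.IsPrime] (hx : x ≠ 0) (hxa : ¬ x ∣ a) (hp : ∀ y ∈ p, x ∣ y * a) : p.height ≤ 1 :=
  height_le_one_aux _ A rfl x a p hx hxa hp

end IsRegularLocalRing

/-! ### Serre's condition `S₂` and the gluing of fractions. -/

/-- The part of Serre's condition `S₂` that is used below: an equation `a = 0` may be checked at
the minimal primes, and divisibility by a non-zero-divisor at the primes of height at most one. -/
structure SerreSTwo (R : Type u) [CommRing R] : Prop where
  eq_zero : ∀ a : R, (∀ p : Ideal R, p.IsPrime → p.height = 0 → ∃ t ∉ p, t * a = 0) → a = 0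
  dvd : ∀ s ∈ nonZeroDivisors R, ∀ a : R,
    (∀ p : Ideal R, p.IsPrime → p.height ≤ 1 → ∃ t ∉ p, s ∣ t * a) → s ∣ a

namespace SerreSTwo

variable {R : Type u} [CommRing R]

/-- If `I` consisted of zero divisors, prime avoidance would put it inside an associated prime, the
annihilator of some `a ≠ 0`. That annihilator lies in no prime of height 0, so `eq_zero` would give
`a = 0`. -/
theorem exists_nonZeroDivisor [IsNoetherianRing R] (hR : SerreSTwo R) {I : Ideal R}
    (hI : ∀ p : Ideal R, p.IsPrime → p.height = 0 → ¬ I ≤ p) : ∃ s ∈ I, s ∈ nonZeroDivisors R := by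
  by_contra! h
  have hsub : (I : Set R) ⊆ ⋃ p ∈ associatedPrimes R R, (p : Set R) := by
    rw [biUnion_associatedPrimes_eq_zero_divisors]
    intro s hs
    have h1 := h s hs
    rw [mem_nonZeroDivisors_iff_right] at h1
    push Not at h1
    obtain ⟨x, hx, hx0⟩ := h1
    exact ⟨x, hx0, by rwa [smul_eq_mul, mul_comm]⟩
  have hfin := associatedPrimes.finite R R
  have hsub' : (I : Set R) ⊆ ⋃ p ∈ ((hfin.toFinset : Finset (Ideal R)) : Set (Ideal R)),
      ((id p : Ideal R) : Set R) := by simpa using hsub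
  rw [Ideal.subset_union_prime ⊥ ⊥ (fun p hp _ _ => by
    have : p ∈ associatedPrimes R R := by simpa using hp
    exact this.isPrime)] at hsub'
  obtain ⟨p, hp, hle⟩ := hsub'
  have hp' : p ∈ associatedPrimes R R := by simpa using hp
  obtain ⟨hpp, a, ha⟩ := isAssociatedPrime_iff.1 hp'
  have ha0 : a ≠ 0 := by
    rintro rfl
    refine hpp.ne_top ?_
    rw [ha, Ideal.eq_top_iff_one, Submodule.mem_colon_singleton, smul_zero]
    exact Submodule.zero_mem _
  refine ha0 (hR.eq_zero a fun q hq hq0 => ?_)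
  have hnle : ¬ p ≤ q := fun hpq => hI q hq hq0 (hle.trans hpq)
  obtain ⟨t, ht, htq⟩ := SetLike.not_le_iff_exists.1 hnle
  refine ⟨t, htq, ?_⟩
  rw [ha, Submodule.mem_colon_singleton] at ht
  simpa using ht

theorem eq_of_minimal (hR : SerreSTwo R) {a b : R}
    (h : ∀ p : Ideal R, p.IsPrime → p.height = 0 → ∃ t ∉ p, t * a = t * b) : a = b := by
  rw [← sub_eq_zero]
  refine hR.eq_zero _ fun p hp h0 => ?_
  obtain ⟨t, ht, h1⟩ := h p hp h0
  exact ⟨t, ht, by rw [mul_sub, h1, sub_self]⟩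

/-- A compatible family of fractions whose denominators generate an ideal that lies in no prime of
height at most one is a ring element. -/
theorem exists_eq_mul [IsNoetherianRing R] (hR : SerreSTwo R) {J : Type*} (D N : J → R)
    (hND : ∀ j k, N j * D k = N k * D j)
    (hD : ∀ p : Ideal R, p.IsPrime → p.height ≤ 1 → ∃ j, D j ∉ p) : ∃ r, ∀ j, N j = r * D j := by
  obtain ⟨s, hs, hs0⟩ := hR.exists_nonZeroDivisor (I := Ideal.span (Set.range D)) (by
    intro p hp h0 hle
    obtain ⟨j, hj⟩ := hD p hp (by rw [h0]; exact zero_le_one)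
    exact hj (hle (Ideal.subset_span ⟨j, rfl⟩)))
  -- The denominators generate an ideal containing a non-zero-divisor `s = ∑ c j * D j`. The common
  -- fraction is then `(∑ c j * N j) / s`, and divisibility by `s` is tested at primes of height at
  -- most one, where some `D j` is available as multiplier.
  obtain ⟨c, hc⟩ := Finsupp.mem_ideal_span_range_iff_exists_finsupp.1 hs
  have key : ∀ k, s * N k = (c.sum fun j r => r * N j) * D k := by
    intro k
    rw [← hc, Finsupp.sum, Finsupp.sum, Finset.sum_mul, Finset.sum_mul]
    refine Finset.sum_congr rfl fun j _ => ?_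
    linear_combination (-c j) * hND j k
  obtain ⟨r, hr⟩ := hR.dvd s hs0 (c.sum fun j r => r * N j) (by
    intro p hp h1
    obtain ⟨j, hj⟩ := hD p hp h1
    exact ⟨D j, hj, N j, by rw [mul_comm, key]⟩)
  refine ⟨r, fun j => ?_⟩
  have h1 := key j
  rw [hr] at h1
  exact (mul_cancel_left_mem_nonZeroDivisors hs0).1 (by rw [h1]; ring)

/-- Krull's principal ideal theorem: a minimal prime over a non-unit has height at most one. -/
theorem isUnit_of_forall_notMem [IsNoetherianRing R] {r : R}
    (h : ∀ p : Ideal R, p.IsPrime → p.height ≤ 1 → r ∉ p) : IsUnit r := by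
  by_contra hr
  obtain ⟨m, hm, hrm⟩ := exists_max_ideal_of_mem_nonunits hr
  obtain ⟨p, hp, -⟩ := Ideal.exists_minimalPrimes_le (I := Ideal.span {r}) (J := m)
    ((Ideal.span_singleton_le_iff_mem _).2 hrm)
  exact h p hp.1.1 (Ideal.height_le_one_of_isPrincipal_of_mem_minimalPrimes _ _ hp)
    (hp.1.2 (Ideal.mem_span_singleton_self r))

end SerreSTwo

/-- By incomparability, contraction along an integral map is strictly monotone on primes, so chains
keep their length. -/
theorem Ideal.height_le_height_comap_of_isIntegral {A : Type v} {R : Type u} [CommRing A] [CommRing R]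
    [Algebra A R] [Algebra.IsIntegral A R] (p : Ideal R) [p.IsPrime] :
    p.height ≤ (p.comap (algebraMap A R)).height := by
  have h := Order.height_le_height_apply_of_strictMono
    (PrimeSpectrum.comap (algebraMap A R)) (fun P Q hPQ => ?_) ⟨p, inferInstance⟩
  · rwa [← PrimeSpectrum.height_eq_orderHeight, ← PrimeSpectrum.height_eq_orderHeight] at h
  · obtain ⟨x, hxQ, hxP⟩ := SetLike.exists_of_lt (show P.asIdeal < Q.asIdeal from hPQ)
    exact Ideal.comap_lt_comap_of_integral_mem_sdiff hPQ.le ⟨hxQ, hxP⟩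
      (Algebra.IsIntegral.isIntegral x)

/-! ### Finite free algebras over a regular local ring are semilocal and satisfy `S₂`. -/

section FiniteFree

variable (A : Type v) (R : Type u) [CommRing A] [CommRing R] [Algebra A R]

/-- Maximal ideals of an integral extension lie over the maximal ideal of the base, and the fibre
over it is finite. -/
theorem Algebra.finite_maximalSpectrum [IsLocalRing A] [Module.Finite A R] :
    Finite (MaximalSpectrum R) := by
  have hfin := Algebra.QuasiFinite.finite_primesOver (S := R) (IsLocalRing.maximalIdeal A)
  refine Finite.of_injective (β := hfin.toFinset) (fun m => ⟨m.asIdeal, ?_⟩) ?_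
  · rw [Set.Finite.mem_toFinset]
    refine ⟨m.isMaximal.isPrime, ⟨?_⟩⟩
    have := m.isMaximal
    exact (IsLocalRing.eq_maximalIdeal
      (Ideal.isMaximal_comap_of_isIntegral_of_isMaximal (R := A) m.asIdeal)).symm
  · intro m n h
    exact MaximalSpectrum.ext (by simpa using h)

/-- The hypothesis says that `y` is regular modulo `x`; it passes to free modules coordinate by
coordinate. -/
theorem Module.Free.smul_dvd {M : Type*} [AddCommGroup M] [Module A M] [Module.Free A M] {x y : A}
    (hxy : ∀ a, x ∣ y * a → x ∣ a) {m n : M} (h : y • m = x • n) : ∃ m', m = x • m' := by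
  let b := Module.Free.chooseBasis A M
  have h1 : ∀ i, x ∣ b.repr m i := fun i => hxy _ ⟨b.repr n i, by
    have := congrArg (fun z => b.repr z i) h
    simpa using this⟩
  choose c hc using h1
  refine ⟨∑ i ∈ (b.repr m).support, c i • b i, ?_⟩
  conv_lhs => rw [← b.linearCombination_repr m, Finsupp.linearCombination_apply, Finsupp.sum]
  rw [Finset.smul_sum]
  exact Finset.sum_congr rfl fun i _ => by rw [hc i, mul_smul]

/-- A failure of either condition produces an associated prime `P` of `R`, respectively of `R / s`,
that avoids the test primes. Its height is bounded by that of its contraction to `A`. For `R` the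
contraction is zero by torsion-freeness. For `R / s` a contraction of height at least two would
contain a regular sequence `x, y` of `A`; this remains regular on the free module `R`, and two
equations modulo `s` then show that the supposedly nonzero class vanishes. -/
theorem SerreSTwo.of_finite_free [IsRegularLocalRing A] [Module.Finite A R] [Module.Free A R] :
    SerreSTwo R := by
  have hdom := IsRegularLocalRing.isDomain A
  have hnoeth : IsNoetherianRing R := IsNoetherianRing.of_finite A R
  have : Module.IsTorsionFree A R := inferInstance
  refine ⟨fun a ha => ?_, fun s hs a ha => ?_⟩
  · by_contra h0
    obtain ⟨P, c, hP, hc, hPc, hle⟩ := Ideal.exists_isPrime_colon (⊥ : Ideal R) (c := a)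
      (by simpa using h0)
    have hbot : P.comap (algebraMap A R) = ⊥ := by
      rw [eq_bot_iff]
      intro x hx
      rw [Ideal.mem_comap, hPc, Submodule.mem_bot, ← Algebra.smul_def] at hx
      exact (smul_eq_zero.1 hx).resolve_right (by simpa using hc)
    have hht : P.height = 0 := by
      have := Ideal.height_le_height_comap_of_isIntegral (A := A) P
      rw [hbot] at this
      simpa using this
    obtain ⟨t, ht, hta⟩ := ha P hP hht
    exact ht (hle t (by simpa using hta))
  · by_contra h0
    obtain ⟨P, c, hP, hc, hPc, hle⟩ := Ideal.exists_isPrime_colon (Ideal.span {s}) (c := a)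
      (by rwa [Ideal.mem_span_singleton])
    simp only [Ideal.mem_span_singleton] at hc hPc hle
    have hht : (P.comap (algebraMap A R)).height ≤ 1 := by
      by_contra hgt
      have hq : (P.comap (algebraMap A R)).IsPrime := inferInstance
      set q := P.comap (algebraMap A R) with hqdef
      have hqbot : q ≠ ⊥ := fun h => hgt (by rw [h]; simp)
      obtain ⟨x, hxq, hx0⟩ := Submodule.exists_mem_ne_zero_of_ne_bot hqbot
      -- an element of `q` that is regular modulo `x`
      obtain ⟨y, hyq, hy⟩ : ∃ y ∈ q, ∀ a, x ∣ y * a → x ∣ a := by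
        by_contra! hcon
        have hfin := associatedPrimes.finite A (A ⧸ Ideal.span {x})
        have hsub : (q : Set A) ⊆ ⋃ p ∈ ((hfin.toFinset : Finset (Ideal A)) : Set (Ideal A)),
            ((id p : Ideal A) : Set A) := by
          have : (q : Set A) ⊆ ⋃ p ∈ associatedPrimes A (A ⧸ Ideal.span {x}), (p : Set A) := by
            rw [biUnion_associatedPrimes_eq_zero_divisors]
            intro y hy
            obtain ⟨a, hya, hxa⟩ := hcon y hy
            refine ⟨Ideal.Quotient.mk _ a, ?_, ?_⟩
            · rwa [Ne, Ideal.Quotient.eq_zero_iff_mem, Ideal.mem_span_singleton]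
            · rw [Algebra.smul_def]
              change Ideal.Quotient.mk _ y * Ideal.Quotient.mk _ a = 0
              rwa [← map_mul, Ideal.Quotient.eq_zero_iff_mem, Ideal.mem_span_singleton]
          simpa using this
        rw [Ideal.subset_union_prime ⊥ ⊥ (fun p hp _ _ => by
          have : p ∈ associatedPrimes A (A ⧸ Ideal.span {x}) := by simpa using hp
          exact this.isPrime)] at hsub
        obtain ⟨p, hp, hqp⟩ := hsub
        have hp' : p ∈ associatedPrimes A (A ⧸ Ideal.span {x}) := by simpa using hp
        obtain ⟨hpp, a, ha⟩ := isAssociatedPrime_iff.1 hp'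
        obtain ⟨a, rfl⟩ := Ideal.Quotient.mk_surjective a
        have hmem : ∀ y, y ∈ p ↔ x ∣ y * a := fun y => by
          rw [ha, Submodule.mem_colon_singleton, Submodule.mem_bot, Algebra.smul_def]
          change Ideal.Quotient.mk _ y * Ideal.Quotient.mk _ a = 0 ↔ _
          rw [← map_mul, Ideal.Quotient.eq_zero_iff_mem, Ideal.mem_span_singleton]
        have hp1 : p.height ≤ 1 := IsRegularLocalRing.height_le_one hx0 (a := a)
          (fun h => hpp.ne_top (by rw [Ideal.eq_top_iff_one, hmem, one_mul]; exact h))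
          (fun y hy => (hmem y).1 hy)
        exact hgt ((Ideal.height_mono hqp).trans hp1)
      have hxR : ∃ e, algebraMap A R x * c = s * e := (hPc _).1 hxq
      have hyR : ∃ e, algebraMap A R y * c = s * e := (hPc _).1 hyq
      obtain ⟨e, he⟩ := hxR
      obtain ⟨g, hg⟩ := hyR
      have h1 : y • e = x • g := by
        rw [Algebra.smul_def, Algebra.smul_def]
        refine (mul_cancel_left_mem_nonZeroDivisors hs).1 ?_
        calc s * (algebraMap A R y * e) = algebraMap A R y * (s * e) := by ring
          _ = algebraMap A R x * (algebraMap A R y * c) := by rw [← he]; ring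
          _ = s * (algebraMap A R x * g) := by rw [hg]; ring
      -- From `x c = s e` and `y c = s g` follows `y e = x g`. Regularity gives `x ∣ e`, and
      -- cancelling `x` gives `s ∣ c`.
      obtain ⟨e', rfl⟩ := Module.Free.smul_dvd A hy h1
      refine hc ⟨e', ?_⟩
      have h2 : x • (c - s * e') = 0 := by
        rw [smul_sub, Algebra.smul_def, he, sub_eq_zero, mul_smul_comm]
      rw [← sub_eq_zero]
      exact (smul_eq_zero.1 h2).resolve_left hx0
    obtain ⟨t, ht, hta⟩ := ha P hP
      ((Ideal.height_le_height_comap_of_isIntegral (A := A) P).trans hht)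
    exact ht (hle t hta)

end FiniteFree

/-! ### Exterior algebras: localization and coordinates of top forms. -/

namespace ExteriorAlgebra

section Localization

variable {R : Type*} [CommRing R] (S : Submonoid R) (M : Type*) [AddCommGroup M] [Module R M]

/-- The localization map of exterior algebras. -/
noncomputable def locMap :
    ExteriorAlgebra R M →ₐ[R] ExteriorAlgebra (Localization S) (LocalizedModule S M) :=
  ExteriorAlgebra.lift R
    ⟨((ExteriorAlgebra.ι (Localization S)).restrictScalars R) ∘ₗ LocalizedModule.mkLinearMap S M,
      fun m => by
        simp only [LinearMap.comp_apply, LinearMap.restrictScalars_apply, ExteriorAlgebra.ι_sq_zero]⟩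

variable {M}

theorem locMap_ι (m : M) : locMap S M (ι R m) = ι (Localization S) (LocalizedModule.mkLinearMap S M m) := by
  simp [locMap]

theorem locMap_ιMulti {n : ℕ} (v : Fin n → M) :
    locMap S M (ιMulti R n v)
      = ιMulti (Localization S) n (fun i => LocalizedModule.mkLinearMap S M (v i)) := by
  rw [ιMulti_apply, ιMulti_apply, map_list_prod, List.map_ofFn]
  congr 2
  funext i
  exact locMap_ι S (v i)

theorem locMap_mem {n : ℕ} {x : ExteriorAlgebra R M} (hx : x ∈ ⋀[R]^n M) :
    locMap S M x ∈ ⋀[Localization S]^n (LocalizedModule S M) := by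
  rw [← ιMulti_span_fixedDegree] at hx
  induction hx using Submodule.span_induction with
  | mem x h => obtain ⟨v, rfl⟩ := h; rw [locMap_ιMulti]; exact ιMulti_range _ _ ⟨_, rfl⟩
  | zero => rw [map_zero]; exact Submodule.zero_mem _
  | add x y _ _ hx hy => rw [map_add]; exact Submodule.add_mem _ hx hy
  | smul a x _ hx =>
    rw [map_smul, ← algebraMap_smul (Localization S) a]; exact Submodule.smul_mem _ _ hx

theorem algebraMap_smul_locMap (r : R) (x : ExteriorAlgebra R M) :
    algebraMap R (Localization S) r • locMap S M x = locMap S M (r • x) := by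
  rw [map_smul, algebraMap_smul]

theorem exists_smul_eq_locMap {n : ℕ} {y : ExteriorAlgebra (Localization S) (LocalizedModule S M)}
    (hy : y ∈ ⋀[Localization S]^n (LocalizedModule S M)) :
    ∃ s ∈ S, ∃ x ∈ ⋀[R]^n M, algebraMap R (Localization S) s • y = locMap S M x := by
  rw [← ιMulti_span_fixedDegree] at hy
  induction hy using Submodule.span_induction with
  | mem y h =>
    obtain ⟨v, rfl⟩ := h
    have h1 : ∀ i, ∃ s : S, ∃ m : M, (s : R) • v i = LocalizedModule.mkLinearMap S M m := fun i => by
      obtain ⟨⟨m, s⟩, h⟩ := IsLocalizedModule.surj S (LocalizedModule.mkLinearMap S M) (v i)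
      exact ⟨s, m, h⟩
    choose s m h1 using h1
    refine ⟨∏ i, (s i : R), Submonoid.prod_mem _ fun i _ => (s i).2, ιMulti R n m,
      ιMulti_range _ _ ⟨_, rfl⟩, ?_⟩
    rw [locMap_ιMulti]
    simp_rw [← h1]
    rw [map_prod, ← AlternatingMap.map_smul_univ]
    congr 1
    funext i
    rw [algebraMap_smul]
  | zero => exact ⟨1, S.one_mem, 0, Submodule.zero_mem _, by simp⟩
  | add y z _ _ hy hz =>
    obtain ⟨s, hs, x, hx, h1⟩ := hy
    obtain ⟨t, ht, w, hw, h2⟩ := hz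
    refine ⟨s * t, S.mul_mem hs ht, t • x + s • w, Submodule.add_mem _ (Submodule.smul_mem _ _ hx)
      (Submodule.smul_mem _ _ hw), ?_⟩
    rw [map_add, ← algebraMap_smul_locMap, ← algebraMap_smul_locMap, ← h1, ← h2, smul_add, map_mul,
      smul_smul, smul_smul, mul_comm (algebraMap R _ t)]
  | smul a y _ hy =>
    obtain ⟨s, hs, x, hx, h1⟩ := hy
    obtain ⟨⟨r, t⟩, h2⟩ := IsLocalization.surj S a
    refine ⟨t * s, S.mul_mem t.2 hs, r • x, Submodule.smul_mem _ _ hx, ?_⟩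
    rw [← algebraMap_smul_locMap, ← h1, ← h2, map_mul, smul_smul, smul_smul]
    congr 1
    ring

theorem locMap_map {N : Type*} [AddCommGroup N] [Module R N] (f : M →ₗ[R] N)
    (x : ExteriorAlgebra R M) :
    locMap S N (map f x) = map (LocalizedModule.map S f) (locMap S M x) := by
  induction x using ExteriorAlgebra.induction with
  | algebraMap r =>
    rw [AlgHom.commutes, AlgHom.commutes, AlgHom.commutes]
    exact (((map (LocalizedModule.map S f)).restrictScalars R).commutes r).symm
  | ι m =>
    rw [map_apply_ι, locMap_ι, locMap_ι, map_apply_ι]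
    congr 1
    exact (IsLocalizedModule.map_apply S (LocalizedModule.mkLinearMap S M)
      (LocalizedModule.mkLinearMap S N) f m).symm
  | mul x y hx hy => simp only [map_mul, hx, hy]
  | add x y hx hy => simp only [map_add, hx, hy]

/-- The localization of the algebra `⋀M` contains the image of the localized module with squares
zero, so the universal property provides a map `F` back to it. As `F ∘ locMap` is the localization
map of the module `⋀M`, whatever dies under `locMap` is killed by an element of `S`. -/
theorem exists_smul_eq_zero_of_locMap_eq_zero {x : ExteriorAlgebra R M} (hx : locMap S M x = 0) :
    ∃ s ∈ S, s • x = 0 := by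
  have hsmul : ∀ (a : Localization S) (x y : LocalizedModule S (ExteriorAlgebra R M)),
      a • x * y = a • (x * y) ∧ x * a • y = a • (x * y) := by
    intro a x y
    obtain ⟨⟨r, t⟩, rfl⟩ := IsLocalization.mk'_surjective S a
    induction x using LocalizedModule.induction_on with
    | h x s =>
    induction y using LocalizedModule.induction_on with
    | h y s' =>
    rw [← Localization.mk_eq_mk']
    simp only [LocalizedModule.mk_smul_mk, LocalizedModule.mk_mul_mk, smul_mul_assoc,
      mul_smul_comm]
    exact ⟨by rw [mul_assoc], by rw [mul_left_comm]⟩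
  let _ : Algebra (Localization S) (LocalizedModule S (ExteriorAlgebra R M)) :=
    Algebra.ofModule (fun a x y => (hsmul a x y).1) (fun a x y => (hsmul a x y).2)
  let j : LocalizedModule S M →ₗ[Localization S] LocalizedModule S (ExteriorAlgebra R M) :=
    LocalizedModule.map S (ι R)
  have hj : ∀ m, j m * j m = 0 := by
    intro m
    induction m using LocalizedModule.induction_on with
    | h m s =>
      change LocalizedModule.map S (ι R) _ * LocalizedModule.map S (ι R) _ = 0
      rw [LocalizedModule.map_mk, LocalizedModule.mk_mul_mk, ι_sq_zero, LocalizedModule.zero_mk]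
  let F : ExteriorAlgebra (Localization S) (LocalizedModule S M) →ₐ[Localization S]
      LocalizedModule S (ExteriorAlgebra R M) := ExteriorAlgebra.lift _ ⟨j, hj⟩
  have hF : ∀ y, F (locMap S M y) = LocalizedModule.mkLinearMap S _ y := by
    intro y
    induction y using ExteriorAlgebra.induction with
    | algebraMap r =>
      rw [AlgHom.commutes,
        IsScalarTower.algebraMap_apply R (Localization S) (ExteriorAlgebra (Localization S) _),
        AlgHom.commutes, ← IsScalarTower.algebraMap_apply]
      rw [LocalizedModule.mkLinearMap_apply]
      rfl
    | ι m =>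
      rw [locMap_ι]
      simp only [F, lift_ι_apply, j]
      exact IsLocalizedModule.map_apply S (LocalizedModule.mkLinearMap S M)
        (LocalizedModule.mkLinearMap S _) (ι R) m
    | mul x y hx hy =>
      rw [map_mul, map_mul, hx, hy]
      simp only [LocalizedModule.mkLinearMap_apply, LocalizedModule.mk_mul_mk, mul_one]
    | add x y hx hy => rw [map_add, map_add, map_add, hx, hy]
  have h0 := hF x
  rw [hx, map_zero] at h0
  obtain ⟨s, hs⟩ := (IsLocalizedModule.eq_zero_iff S (LocalizedModule.mkLinearMap S _)).1 h0.symm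
  exact ⟨s, s.2, hs⟩

end Localization

section

variable {R : Type*} [CommRing R] {M N : Type*} [AddCommGroup M] [Module R M]
  [AddCommGroup N] [Module R N]

theorem map_mem {n : ℕ} (f : M →ₗ[R] N) {x : ExteriorAlgebra R M} (hx : x ∈ ⋀[R]^n M) :
    map f x ∈ ⋀[R]^n N := by
  rw [← ιMulti_span_fixedDegree] at hx
  induction hx using Submodule.span_induction with
  | mem x h => obtain ⟨v, rfl⟩ := h; rw [map_apply_ιMulti]; exact ιMulti_range _ _ ⟨_, rfl⟩
  | zero => rw [map_zero]; exact Submodule.zero_mem _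
  | add x y _ _ hx hy => rw [map_add]; exact Submodule.add_mem _ hx hy
  | smul a x _ hx => rw [map_smul]; exact Submodule.smul_mem _ _ hx

theorem exists_mem_map_eq {n : ℕ} {f : M →ₗ[R] N} (hf : Function.Surjective f)
    {y : ExteriorAlgebra R N} (hy : y ∈ ⋀[R]^n N) : ∃ x ∈ ⋀[R]^n M, map f x = y := by
  rw [← ιMulti_span_fixedDegree] at hy
  induction hy using Submodule.span_induction with
  | mem y h =>
    obtain ⟨v, rfl⟩ := h
    choose w hw using fun i => hf (v i)
    refine ⟨ιMulti R n w, ιMulti_range _ _ ⟨_, rfl⟩, ?_⟩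
    rw [map_apply_ιMulti]
    congr 1
    funext i
    exact hw i
  | zero => exact ⟨0, Submodule.zero_mem _, map_zero _⟩
  | add y z _ _ hy hz =>
    obtain ⟨x, hx, rfl⟩ := hy
    obtain ⟨w, hw, rfl⟩ := hz
    exact ⟨x + w, Submodule.add_mem _ hx hw, map_add _ _ _⟩
  | smul a y _ hy =>
    obtain ⟨x, hx, rfl⟩ := hy
    exact ⟨a • x, Submodule.smul_mem _ _ hx, map_smul _ _ _⟩

/-- If `b` kills the elements `m - g m`, then `b * x` only depends on the image of `x` under `g`. -/
theorem mul_eq_mul_map {b : ExteriorAlgebra R M} {g : M →ₗ[R] M}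
    (hb : ∀ m, b * ι R (m - g m) = 0) (x : ExteriorAlgebra R M) : b * x = b * map g x := by
  induction x using CliffordAlgebra.left_induction generalizing b with
  | algebraMap r => exact congrArg (b * ·) (AlgHom.commutes (map g) r).symm
  | add x y hx hy => rw [map_add, mul_add, mul_add, hx hb, hy hb]
  | ι_mul x m hx =>
    change b * (ι R m * x) = b * map g (ι R m * x)
    have h1 : b * ι R m = b * ι R (g m) := by
      rw [← sub_eq_zero, ← mul_sub, ← map_sub]; exact hb m
    rw [map_mul, map_apply_ι, ← mul_assoc, ← mul_assoc, h1]
    -- The property of killing all `m' - g m'` is inherited by `b * ι (g m)`, because degree-one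
    -- elements anticommute.
    refine hx fun m' => ?_
    have h2 := ι_add_mul_swap (R := R) (g m) (m' - g m')
    rw [mul_assoc, eq_neg_of_add_eq_zero_left h2, mul_neg, ← mul_assoc, hb, zero_mul, neg_zero]

open scoped Classical in
/-- The functional on the exterior algebra that is the determinant in degree `n` and zero in the other
degrees. -/
noncomputable def detOn {n : ℕ} (b : Module.Basis (Fin n) R M) : ExteriorAlgebra R M →ₗ[R] R :=
  liftAlternating (fun i => if h : i = n then h ▸ b.det else 0)

theorem detOn_ιMulti {n : ℕ} (b : Module.Basis (Fin n) R M) (v : Fin n → M) :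
    detOn b (ιMulti R n v) = b.det v := by
  rw [detOn, liftAlternating_apply_ιMulti, dif_pos rfl]

/-- Alternating maps of `n` arguments are determined on injective tuples of basis vectors. These are
permutations of the basis, and both sides change by the same sign. -/
theorem ιMulti_eq_det {n : ℕ} (b : Module.Basis (Fin n) R M) :
    ιMulti R n = (LinearMap.toSpanSingleton R _ (ιMulti R n b)).compAlternatingMap b.det := by
  refine Module.Basis.ext_alternating b fun v hv => ?_
  obtain ⟨σ, rfl⟩ : ∃ σ : Equiv.Perm (Fin n), σ = v :=
    ⟨Equiv.ofBijective v (Finite.injective_iff_bijective.1 hv), rfl⟩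
  have h1 := (ιMulti R n).map_perm b σ
  have h2 := b.det.map_perm b σ
  rw [LinearMap.compAlternatingMap_apply]
  erw [h1, h2]
  simp [Module.Basis.det_self]

theorem eq_detOn_smul {n : ℕ} (b : Module.Basis (Fin n) R M) {x : ExteriorAlgebra R M}
    (hx : x ∈ ⋀[R]^n M) : x = detOn b x • ιMulti R n b := by
  rw [← ιMulti_span_fixedDegree] at hx
  induction hx using Submodule.span_induction with
  | mem x h =>
    obtain ⟨v, rfl⟩ := h
    rw [detOn_ιMulti]
    exact DFunLike.congr_fun (ιMulti_eq_det b) v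
  | zero => rw [map_zero, zero_smul]
  | add x y _ _ hx hy => rw [map_add, add_smul, ← hx, ← hy]
  | smul a x _ hx => rw [map_smul, smul_assoc, ← hx]

end

end ExteriorAlgebra

/-! ### Exterior powers of locally constant degree; determinants over semilocal rings. -/

namespace PerfDet

open ExteriorAlgebra

section

variable {R : Type*} [CommRing R] {M N : Type*} [AddCommGroup M] [Module R M]
  [AddCommGroup N] [Module R N]

theorem exists_idempotent_of_isLocallyConstant {l : PrimeSpectrum R → ℕ} (hl : IsLocallyConstant l)
    (p : PrimeSpectrum R) : ∃ e : R, IsIdempotentElem e ∧ e ∉ p.asIdeal ∧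
      ∀ q : PrimeSpectrum R, e ∉ q.asIdeal → l q = l p := by
  obtain ⟨e, he, h⟩ := PrimeSpectrum.exists_idempotent_basicOpen_eq_of_isClopen
    (hl.isClopen_fiber (l p))
  have h' : ∀ q : PrimeSpectrum R, e ∉ q.asIdeal ↔ l q = l p := fun q => by
    have := Set.ext_iff.1 h q
    exact this.symm
  exact ⟨e, he, (h' p).2 rfl, fun q => (h' q).1⟩

theorem _root_.Submodule.mem_of_forall_isMaximal (N : Submodule R M) {x : M}
    (h : ∀ p : Ideal R, p.IsMaximal → ∃ t ∉ p, t • x ∈ N) : x ∈ N := by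
  have h1 : N.colon {x} = ⊤ := by
    by_contra hne
    obtain ⟨m, hm, hle⟩ := Ideal.exists_le_maximal _ hne
    obtain ⟨t, ht, htx⟩ := h m hm
    exact ht (hle (Submodule.mem_colon_singleton.2 htx))
  have := Submodule.mem_colon_singleton.1 (h1 ▸ Submodule.mem_top : (1 : R) ∈ N.colon {x})
  rwa [one_smul] at this

/-- This pointwise form replaces idempotents by multipliers outside a prime. At a maximal ideal
containing the idempotent `e` the multiplier `1 - e` kills `e • x`, so only the ideals where the
degree is `n` matter. -/
theorem mem_extPow_iff {l : PrimeSpectrum R → ℕ} (hl : IsLocallyConstant l)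
    {x : ExteriorAlgebra R M} :
    x ∈ extPow R l M ↔ ∀ p : PrimeSpectrum R, ∃ t ∉ p.asIdeal, t • x ∈ ⋀[R]^(l p) M := by
  constructor
  · intro hx p
    obtain ⟨e, he, hep, h⟩ := exists_idempotent_of_isLocallyConstant hl p
    exact ⟨e, hep, hx _ e he h⟩
  · intro h n e he hn
    refine Submodule.mem_of_forall_isMaximal _ fun p hp => ?_
    by_cases hep : e ∈ p
    · refine ⟨1 - e, fun h1 => hp.ne_top ((Ideal.eq_top_iff_one _).2 ?_), ?_⟩
      · simpa using p.add_mem h1 hep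
      · rw [smul_smul, sub_mul, one_mul, he, sub_self, zero_smul]; exact Submodule.zero_mem _
    · obtain ⟨t, ht, h1⟩ := h ⟨p, hp.isPrime⟩
      rw [hn ⟨p, hp.isPrime⟩ hep] at h1
      exact ⟨t, ht, by rw [smul_comm]; exact Submodule.smul_mem _ _ h1⟩

theorem mul_mem_extPow {l m : PrimeSpectrum R → ℕ} (hl : IsLocallyConstant l)
    (hm : IsLocallyConstant m) {x y : ExteriorAlgebra R M} (hx : x ∈ extPow R l M)
    (hy : y ∈ extPow R m M) : x * y ∈ extPow R (fun p => l p + m p) M := by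
  refine (mem_extPow_iff (hl.add hm)).2 fun p => ?_
  obtain ⟨s, hs, h1⟩ := (mem_extPow_iff hl).1 hx p
  obtain ⟨t, ht, h2⟩ := (mem_extPow_iff hm).1 hy p
  refine ⟨s * t, fun h => (p.2.mem_or_mem h).elim hs ht, ?_⟩
  rw [← smul_mul_smul_comm]
  change _ ∈ (ι R).range ^ (l p + m p)
  rw [pow_add]
  exact Submodule.mul_mem_mul h1 h2

theorem map_mem_extPow {l : PrimeSpectrum R → ℕ} (f : M →ₗ[R] N) {x : ExteriorAlgebra R M}
    (hx : x ∈ extPow R l M) : ExteriorAlgebra.map f x ∈ extPow R l N := by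
  intro n e he h
  rw [← map_smul]
  exact ExteriorAlgebra.map_mem f (hx n e he h)

theorem one_mem_extPow {l : PrimeSpectrum R → ℕ} (hl : ∀ p, l p = 0) :
    (1 : ExteriorAlgebra R M) ∈ extPow R l M := by
  have : l = fun _ => 0 := funext hl
  rw [this, extPow_const, exteriorPower, pow_zero]
  exact Submodule.one_le.1 le_rfl

/-- An element of the exterior power at `p`, cut down to the piece where the degree is constant. -/
theorem exists_smul_mem_extPow {l : PrimeSpectrum R → ℕ} (hl : IsLocallyConstant l)
    (p : PrimeSpectrum R) {x : ExteriorAlgebra R M} (hx : x ∈ ⋀[R]^(l p) M) :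
    ∃ e : R, IsIdempotentElem e ∧ e ∉ p.asIdeal ∧ e • x ∈ extPow R l M := by
  obtain ⟨e, he, hep, h⟩ := exists_idempotent_of_isLocallyConstant hl p
  refine ⟨e, he, hep, (mem_extPow_iff hl).2 fun q => ?_⟩
  by_cases heq : e ∈ q.asIdeal
  · refine ⟨1 - e, fun h1 => q.2.ne_top ((Ideal.eq_top_iff_one _).2 ?_), ?_⟩
    · simpa using q.asIdeal.add_mem h1 heq
    · rw [smul_smul, sub_mul, one_mul, he, sub_self, zero_smul]; exact Submodule.zero_mem _
  · exact ⟨1, fun h1 => q.2.ne_top ((Ideal.eq_top_iff_one _).2 h1), by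
      rw [one_smul, h q heq]; exact Submodule.smul_mem _ _ hx⟩

/-- The images form a submodule, so lifting is a local question, and near a given maximal ideal the
degree is constant. -/
theorem exists_extPow_map_eq {l : PrimeSpectrum R → ℕ} (hl : IsLocallyConstant l) {f : M →ₗ[R] N}
    (hf : Function.Surjective f) {z : ExteriorAlgebra R N} (hz : z ∈ extPow R l N) :
    ∃ y ∈ extPow R l M, ExteriorAlgebra.map f y = z := by
  change z ∈ (extPow R l M).map (ExteriorAlgebra.map f).toLinearMap
  refine Submodule.mem_of_forall_isMaximal _ fun p hp => ?_
  obtain ⟨t, ht, h1⟩ := (mem_extPow_iff hl).1 hz ⟨p, hp.isPrime⟩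
  obtain ⟨y, hy, h2⟩ := ExteriorAlgebra.exists_mem_map_eq hf h1
  obtain ⟨e, he, hep, h3⟩ := exists_smul_mem_extPow hl ⟨p, hp.isPrime⟩ hy
  refine ⟨e * t, fun h => (hp.isPrime.mem_or_mem h).elim hep ht, e • y, h3, ?_⟩
  rw [AlgHom.toLinearMap_apply, map_smul, h2, smul_smul]

variable (p : PrimeSpectrum R)

theorem isUnit_algebraMap_of_notMem {p : PrimeSpectrum R} {t : R} (ht : t ∉ p.asIdeal) :
    IsUnit (algebraMap R (Localization p.asIdeal.primeCompl) t) :=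
  IsLocalization.map_units _ (⟨t, ht⟩ : p.asIdeal.primeCompl)

theorem notMem_of_isUnit_algebraMap {p : PrimeSpectrum R} {t : R}
    (ht : IsUnit (algebraMap R (Localization p.asIdeal.primeCompl) t)) : t ∉ p.asIdeal := by
  have : IsLocalization.AtPrime (Localization p.asIdeal.primeCompl) p.asIdeal :=
    inferInstanceAs (IsLocalization _ _)
  exact (IsLocalization.AtPrime.isUnit_to_map_iff _ p.asIdeal t).1 ht

theorem locMap_mem_of_mem_extPow {l : PrimeSpectrum R → ℕ} (hl : IsLocallyConstant l)
    {x : ExteriorAlgebra R M} (hx : x ∈ extPow R l M) :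
    locMap p.asIdeal.primeCompl M x ∈ ⋀[Localization p.asIdeal.primeCompl]^(l p)
      (LocalizedModule p.asIdeal.primeCompl M) := by
  obtain ⟨t, ht, h1⟩ := (mem_extPow_iff hl).1 hx p
  have h2 := locMap_mem p.asIdeal.primeCompl h1
  rw [← algebraMap_smul_locMap] at h2
  exact (Submodule.smul_mem_iff_of_isUnit _ (isUnit_algebraMap_of_notMem ht)).1 h2

theorem exists_smul_eq_locMap_extPow {l : PrimeSpectrum R → ℕ} (hl : IsLocallyConstant l)
    {y : ExteriorAlgebra (Localization p.asIdeal.primeCompl) (LocalizedModule p.asIdeal.primeCompl M)}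
    (hy : y ∈ ⋀[Localization p.asIdeal.primeCompl]^(l p)
      (LocalizedModule p.asIdeal.primeCompl M)) :
    ∃ t ∉ p.asIdeal, ∃ x ∈ extPow R l M,
      locMap p.asIdeal.primeCompl M x
        = algebraMap R (Localization p.asIdeal.primeCompl) t • y := by
  obtain ⟨s, hs, x, hx, h⟩ := exists_smul_eq_locMap p.asIdeal.primeCompl hy
  obtain ⟨e, -, hep, h3⟩ := exists_smul_mem_extPow hl p hx
  refine ⟨e * s, fun h => (p.2.mem_or_mem h).elim hep hs, e • x, h3, ?_⟩
  rw [map_mul, mul_smul, h, algebraMap_smul_locMap]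

end

section Top

variable {R : Type u} [CommRing R] {F : Type u} [AddCommGroup F] [Module R F]

theorem exists_basis_fin (A : Type*) [CommRing A] [Nontrivial A] (M : Type*) [AddCommGroup M]
    [Module A M] [Module.Free A M] [Module.Finite A M] {n : ℕ} (hn : Module.finrank A M = n) :
    Nonempty (Module.Basis (Fin n) A M) := by
  subst hn; exact ⟨Module.finBasis A M⟩

theorem isLocallyConstant_rankAtStalk' [Module.Finite R F] [Module.Projective R F] :
    IsLocallyConstant (Module.rankAtStalk (R := R) F) := by
  have : Module.FinitePresentation R F := Module.finitePresentation_of_projective R F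
  exact Module.isLocallyConstant_rankAtStalk

theorem free_localizedModule [Module.Finite R F] [Module.Projective R F] (p : PrimeSpectrum R) :
    Module.Free (Localization p.asIdeal.primeCompl) (LocalizedModule p.asIdeal.primeCompl F) := by
  have : Module.Finite (Localization p.asIdeal.primeCompl) (LocalizedModule p.asIdeal.primeCompl F) :=
    inferInstance
  have : Module.Flat (Localization p.asIdeal.primeCompl) (LocalizedModule p.asIdeal.primeCompl F) :=
    inferInstance
  have : IsLocalRing (Localization p.asIdeal.primeCompl) :=
    inferInstanceAs (IsLocalRing (Localization.AtPrime p.asIdeal))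
  exact Module.free_of_flat_of_isLocalRing

theorem exists_basis_rankAtStalk [Module.Finite R F] [Module.Projective R F] (p : PrimeSpectrum R) :
    Nonempty (Module.Basis (Fin (Module.rankAtStalk (R := R) F p))
        (Localization p.asIdeal.primeCompl) (LocalizedModule p.asIdeal.primeCompl F)) := by
  have := free_localizedModule (F := F) p
  have : Nontrivial (Localization p.asIdeal.primeCompl) :=
    inferInstanceAs (Nontrivial (Localization.AtPrime p.asIdeal))
  exact exists_basis_fin _ _ rfl

/-- Local generators at the finitely many maximal ideals are combined as in the Chinese remainder
theorem. -/
theorem exists_topPow_generator [Finite (MaximalSpectrum R)] [Module.Finite R F]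
    [Module.Projective R F] :
    ∃ g ∈ topPow R F, ∀ m : PrimeSpectrum R, m.asIdeal.IsMaximal →
      ∃ (b : Module.Basis (Fin (Module.rankAtStalk (R := R) F m))
        (Localization m.asIdeal.primeCompl) (LocalizedModule m.asIdeal.primeCompl F)),
      IsUnit (detOn b (locMap m.asIdeal.primeCompl F g)) := by
  classical
  have hlc := isLocallyConstant_rankAtStalk' (R := R) (F := F)
  cases nonempty_fintype (MaximalSpectrum R)
  have hb : ∀ m : MaximalSpectrum R, _ := fun m =>
    exists_basis_rankAtStalk (F := F) m.toPrimeSpectrum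
  let b := fun m => (hb m).some
  have hg : ∀ m : MaximalSpectrum R, _ := fun m =>
    exists_smul_eq_locMap_extPow m.toPrimeSpectrum hlc
      (y := ιMulti _ _ (b m)) (ιMulti_range _ _ ⟨_, rfl⟩)
  choose t ht g hg hgt using hg
  -- The product of the `c m m'` over `m'` avoids `m` but lies in every other maximal ideal, so at
  -- each maximal ideal exactly one summand has unit coordinate.
  have hc : ∀ m m' : MaximalSpectrum R, ∃ c : R, c ∉ m.asIdeal ∧ (m' ≠ m → c ∈ m'.asIdeal) := by
    intro m m'
    by_cases h : m' = m
    · exact ⟨1, fun h1 => m.isMaximal.ne_top ((Ideal.eq_top_iff_one _).2 h1), fun h' => absurd h h'⟩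
    · have hnle : ¬ m'.asIdeal ≤ m.asIdeal := fun hle =>
        h (MaximalSpectrum.ext (m'.isMaximal.eq_of_le m.isMaximal.ne_top hle))
      obtain ⟨c, hc, hc'⟩ := SetLike.not_le_iff_exists.1 hnle
      exact ⟨c, hc', fun _ => hc⟩
  choose c hcm hcm' using hc
  refine ⟨∑ m, (∏ m', c m m') • g m, Submodule.sum_mem _ fun m _ => Submodule.smul_mem _ _ (hg m),
    fun p hp => ⟨b ⟨p.asIdeal, hp⟩, ?_⟩⟩
  obtain ⟨m, hm⟩ : ∃ m : MaximalSpectrum R, m = ⟨p.asIdeal, hp⟩ := ⟨_, rfl⟩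
  obtain rfl : p = m.toPrimeSpectrum := by rw [hm]; rfl
  change IsUnit (detOn (b m) _)
  have hloc : IsLocalRing (Localization m.toPrimeSpectrum.asIdeal.primeCompl) :=
    inferInstanceAs (IsLocalRing (Localization.AtPrime m.toPrimeSpectrum.asIdeal))
  have hat : IsLocalization.AtPrime (Localization m.toPrimeSpectrum.asIdeal.primeCompl)
    m.toPrimeSpectrum.asIdeal := inferInstanceAs (IsLocalization _ _)
  rw [map_sum, map_sum]
  rw [← Finset.add_sum_erase _ _ (Finset.mem_univ m)]
  simp only [← algebraMap_smul_locMap, LinearMap.map_smul, smul_eq_mul]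
  have hu : IsUnit (algebraMap R (Localization m.toPrimeSpectrum.asIdeal.primeCompl)
      (∏ m', c m m') * detOn (b m) (locMap m.toPrimeSpectrum.asIdeal.primeCompl F (g m))) := by
    refine IsUnit.mul (isUnit_algebraMap_of_notMem (p := m.toPrimeSpectrum) ?_) ?_
    · exact (m.toPrimeSpectrum.asIdeal.primeCompl).prod_mem fun m' _ => hcm m m'
    · rw [hgt, map_smul, detOn_ιMulti, Module.Basis.det_self, smul_eq_mul, mul_one]
      exact isUnit_algebraMap_of_notMem (ht m)
  -- A unit plus elements of the maximal ideal is a unit.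
  by_contra hn
  have h1 := Ideal.sub_mem _ ((IsLocalRing.mem_maximalIdeal _).2 hn)
    (Ideal.sum_mem (IsLocalRing.maximalIdeal _) (t := Finset.univ.erase m)
      (f := fun x => algebraMap R (Localization m.toPrimeSpectrum.asIdeal.primeCompl)
      (∏ m', c x m') * detOn (b m) (locMap m.toPrimeSpectrum.asIdeal.primeCompl F (g x)))
      fun x hx => Ideal.mul_mem_right _ _ ?_)
  · rw [add_sub_cancel_right] at h1
    exact h1 hu
  · rw [IsLocalization.AtPrime.to_map_mem_maximal_iff _ m.toPrimeSpectrum.asIdeal]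
    exact Ideal.mem_of_dvd _ (Finset.dvd_prod_of_mem _ (Finset.mem_univ m))
      (hcm' x m (Finset.ne_of_mem_erase hx).symm)

/-- Over a semilocal ring the determinant of a finitely generated projective module is free. -/
theorem exists_topPow_equiv [Finite (MaximalSpectrum R)] [Module.Finite R F]
    [Module.Projective R F] : Nonempty (topPow R F ≃ₗ[R] R) := by
  have hlc := isLocallyConstant_rankAtStalk' (R := R) (F := F)
  obtain ⟨g, hg, hgu⟩ := exists_topPow_generator (R := R) (F := F)
  refine ⟨(LinearEquiv.ofBijective (LinearMap.toSpanSingleton R (topPow R F) ⟨g, hg⟩) ⟨?_, ?_⟩).symm⟩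
  · rw [injective_iff_map_eq_zero]
    intro r hr
    refine (Submodule.mem_bot R).1 (Submodule.mem_of_forall_isMaximal ⊥ fun p hp => ?_)
    obtain ⟨b, hu⟩ := hgu ⟨p, hp.isPrime⟩ hp
    have h1 : r • g = 0 := congrArg Subtype.val hr
    have h2 := congrArg (fun x => detOn b (locMap _ F x)) h1
    simp only [← algebraMap_smul_locMap] at h2
    rw [LinearMap.map_smul, map_zero, map_zero, smul_eq_mul] at h2
    have h3 := hu.mul_left_eq_zero.1 h2
    obtain ⟨t, ht⟩ := (IsLocalization.map_eq_zero_iff p.primeCompl _ r).1 h3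
    exact ⟨t, t.2, by simpa using ht⟩
  · intro x
    suffices h : (x : ExteriorAlgebra R F) ∈ Submodule.span R {g} by
      obtain ⟨r, hr⟩ := Submodule.mem_span_singleton.1 h
      exact ⟨r, Subtype.ext hr⟩
    refine Submodule.mem_of_forall_isMaximal _ fun p hp => ?_
    obtain ⟨P, rfl⟩ : ∃ P : PrimeSpectrum R, P.asIdeal = p := ⟨⟨p, hp.isPrime⟩, rfl⟩
    obtain ⟨b, hu⟩ := hgu P hp
    have hx := eq_detOn_smul b (locMap_mem_of_mem_extPow P hlc x.2)
    have hg' := eq_detOn_smul b (locMap_mem_of_mem_extPow P hlc hg)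
    obtain ⟨u, hu'⟩ := hu
    obtain ⟨⟨r, s⟩, hrs⟩ := IsLocalization.surj P.asIdeal.primeCompl
      (detOn b (locMap P.asIdeal.primeCompl F (x : ExteriorAlgebra R F)) * ↑u⁻¹)
    rw [← hu'] at hg'
    have h1 : locMap P.asIdeal.primeCompl F ((s : R) • (x : ExteriorAlgebra R F) - r • g) = 0 := by
      rw [map_sub, ← algebraMap_smul_locMap, ← algebraMap_smul_locMap, hx, hg', ← hrs, smul_smul,
        smul_smul, sub_eq_zero]
      congr 1
      linear_combination (-(detOn b (locMap P.asIdeal.primeCompl F (x : ExteriorAlgebra R F)))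
        * algebraMap R _ (s : R)) * u.inv_mul
    obtain ⟨t, ht, h2⟩ := exists_smul_eq_zero_of_locMap_eq_zero _ h1
    refine ⟨t * s, P.asIdeal.primeCompl.mul_mem ht s.2, ?_⟩
    rw [smul_sub, sub_eq_zero, smul_smul, smul_smul] at h2
    rw [h2]
    exact Submodule.smul_mem _ _ (Submodule.mem_span_singleton_self g)

/-- A form whose localization is a unit multiple of the wedge of the basis is itself a multiple of
the global generator, so the generator has unit coordinate at every prime. -/
theorem isUnit_detOn_generator [Module.Finite R F] [Module.Projective R F]
    (γ : topPow R F ≃ₗ[R] R) (p : PrimeSpectrum R)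
    (b : Module.Basis (Fin (Module.rankAtStalk (R := R) F p))
        (Localization p.asIdeal.primeCompl) (LocalizedModule p.asIdeal.primeCompl F)) :
    IsUnit (detOn b (locMap p.asIdeal.primeCompl F (γ.symm 1 : topPow R F))) := by
  have hlc := isLocallyConstant_rankAtStalk' (R := R) (F := F)
  obtain ⟨t, ht, x, hx, h⟩ := exists_smul_eq_locMap_extPow p hlc
      (y := ιMulti _ _ b) (ιMulti_range _ _ ⟨_, rfl⟩)
  have h1 : x = γ ⟨x, hx⟩ • (γ.symm 1 : topPow R F) := by
    have : (⟨x, hx⟩ : topPow R F) = γ ⟨x, hx⟩ • γ.symm 1 := by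
      rw [← map_smul, smul_eq_mul, mul_one, LinearEquiv.symm_apply_apply]
    exact congrArg Subtype.val this
  have h2 := congrArg (detOn b) h
  rw [h1, ← algebraMap_smul_locMap, map_smul, map_smul, detOn_ιMulti, Module.Basis.det_self,
    smul_eq_mul, smul_eq_mul, mul_one] at h2
  exact isUnit_of_mul_isUnit_right (h2 ▸ isUnit_algebraMap_of_notMem ht)

end Top

end PerfDet

/-! ### Local rings of depth at most one: splitting of injections between free modules. -/

namespace IsLocalRing

variable {A : Type*} [CommRing A] [IsLocalRing A]

/-- A noetherian local ring of dimension at most one has depth at most one. -/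
theorem exists_socle_of_height_le_one [IsNoetherianRing A] (h : (maximalIdeal A).height ≤ 1) :
    ∃ x c : A, (x = 0 ∨ x ∈ nonZeroDivisors A) ∧ ¬ x ∣ c ∧ ∀ y ∈ maximalIdeal A, x ∣ y * c := by
  by_cases hx : ∃ x ∈ maximalIdeal A, x ∈ nonZeroDivisors A
  · obtain ⟨x, hxm, hx⟩ := hx
    obtain ⟨P, c, hP, hc, hPc, hle⟩ := Ideal.exists_isPrime_colon (Ideal.span {x}) (c := (1 : A))
      (fun h1 => (maximalIdeal.isMaximal A).ne_top ((Ideal.eq_top_iff_one _).2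
        ((Ideal.span_singleton_le_iff_mem _).2 hxm h1)))
    have hxP : x ∈ P := hle x (by simp)
    -- `P` contains the non-zero-divisor `x` and is therefore not minimal; in dimension at most one
    -- only the maximal ideal is left.
    have hPm : P = maximalIdeal A := by
      by_contra hne
      have hlt : P < maximalIdeal A := lt_of_le_of_ne (le_maximalIdeal hP.ne_top) hne
      have h1 := (Ideal.height_add_one_le_of_lt_of_isPrime hlt).trans h
      have h2 : P.height = 0 := by
        have : P.height + 1 ≤ 0 + 1 := by simpa using h1
        simpa using (ENat.add_le_add_iff_right ENat.one_ne_top).1 this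
      rw [Ideal.height_eq_zero_iff] at h2
      exact Set.disjoint_left.1 (Ideal.disjoint_nonZeroDivisors_of_mem_minimalPrimes h2) hxP hx
    refine ⟨x, c, Or.inr hx, fun h => hc (Ideal.mem_span_singleton.2 h), fun y hy => ?_⟩
    exact Ideal.mem_span_singleton.1 ((hPc y).1 (hPm ▸ hy))
  -- If the maximal ideal consists of zero divisors, it lies in an associated prime of the ring, and
  -- `x = 0` works with the element that this prime annihilates.
  · push Not at hx
    have hsub : (maximalIdeal A : Set A) ⊆ ⋃ p ∈ associatedPrimes A A, (p : Set A) := by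
      rw [biUnion_associatedPrimes_eq_zero_divisors]
      intro s hs
      have h1 := hx s hs
      rw [mem_nonZeroDivisors_iff_right] at h1
      push Not at h1
      obtain ⟨x, hx, hx0⟩ := h1
      exact ⟨x, hx0, by rwa [smul_eq_mul, mul_comm]⟩
    have hfin := associatedPrimes.finite A A
    have hsub' : (maximalIdeal A : Set A) ⊆
        ⋃ p ∈ ((hfin.toFinset : Finset (Ideal A)) : Set (Ideal A)), ((id p : Ideal A) : Set A) := by
      simpa using hsub
    rw [Ideal.subset_union_prime ⊥ ⊥ (fun p hp _ _ => by
      have : p ∈ associatedPrimes A A := by simpa using hp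
      exact this.isPrime)] at hsub'
    obtain ⟨p, hp, hle⟩ := hsub'
    have hp' : p ∈ associatedPrimes A A := by simpa using hp
    obtain ⟨hpp, a, ha⟩ := isAssociatedPrime_iff.1 hp'
    refine ⟨0, a, Or.inl rfl, ?_, fun y hy => ?_⟩
    · rw [zero_dvd_iff]
      rintro rfl
      refine hpp.ne_top ?_
      rw [ha, Ideal.eq_top_iff_one, Submodule.mem_colon_singleton, smul_zero]
      exact Submodule.zero_mem _
    · have := hle hy
      rw [id, ha, Submodule.mem_colon_singleton] at this
      simpa using this

variable {B F G : Type*} [AddCommGroup B] [Module A B] [AddCommGroup F] [Module A F]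
  [AddCommGroup G] [Module A G]

/-- An injection of free modules over a local ring splits if it remains injective modulo an element
`x` such that the maximal ideal is associated to `A ⧸ x`. -/
theorem exists_retraction_of_dvd [Module.Free A B] [Module.Finite A B] [Module.Free A F]
    [Module.Finite A F] {x c : A} (hxc : ¬ x ∣ c) (hc : ∀ y ∈ maximalIdeal A, x ∣ y * c)
    {f : B →ₗ[A] F} (hx : ∀ b y, f b = x • y → ∃ b', b = x • b') :
    ∃ r : F →ₗ[A] B, r ∘ₗ f = LinearMap.id := by
  rw [IsLocalRing.split_injective_iff_lTensor_residueField_injective,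
    injective_iff_map_eq_zero]
  intro z hz
  let eB := TensorProduct.quotTensorEquivQuotSMul B (maximalIdeal A)
  let eF := TensorProduct.quotTensorEquivQuotSMul F (maximalIdeal A)
  obtain ⟨b, rfl⟩ : ∃ b : B, ((1 : ResidueField A) ⊗ₜ[A] b) = z := by
    obtain ⟨b, hb⟩ := Submodule.Quotient.mk_surjective _ (eB z)
    refine ⟨b, eB.injective ?_⟩
    rw [← hb]
    exact TensorProduct.quotTensorEquivQuotSMul_mk_tmul (maximalIdeal A) 1 b |>.trans
      (by rw [one_smul])
  rw [LinearMap.lTensor_tmul] at hz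
  have h1 : f b ∈ maximalIdeal A • (⊤ : Submodule A F) := by
    rw [← Submodule.Quotient.mk_eq_zero]
    have h2 := (congrArg eF hz).trans (LinearEquiv.map_zero eF)
    rw [← h2]
    exact (TensorProduct.quotTensorEquivQuotSMul_mk_tmul (maximalIdeal A) 1 (f b) |>.trans
      (by rw [one_smul])).symm
  have h2 : ∀ y ∈ maximalIdeal A • (⊤ : Submodule A F), ∃ y', c • y = x • y' := by
    intro y hy
    induction hy using Submodule.smul_induction_on' with
    | smul r hr n _ =>
      obtain ⟨e, he⟩ := hc r hr
      exact ⟨e • n, by rw [smul_smul, smul_smul, mul_comm, he]⟩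
    | add y _ z _ hy hz =>
      obtain ⟨y', hy'⟩ := hy
      obtain ⟨z', hz'⟩ := hz
      exact ⟨y' + z', by rw [smul_add, smul_add, hy', hz']⟩
  -- Injectivity over the residue field is what must be shown. If `f b` lies in the maximal ideal
  -- times `F`, then `c • f b` is divisible by `x`, and hence so is `c • b`.
  obtain ⟨y, hy⟩ := h2 _ h1
  obtain ⟨b', hb'⟩ : ∃ b', c • b = x • b' := hx _ y (by rw [map_smul, hy])
  have h6 : b ∈ maximalIdeal A • (⊤ : Submodule A B) := by
    let e := Module.Free.chooseBasis A B
    rw [← e.sum_repr b]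
    refine Submodule.sum_mem _ fun i _ => Submodule.smul_mem_smul ?_ Submodule.mem_top
    -- A unit coordinate of `b` would give `x ∣ c`.
    rw [mem_maximalIdeal]
    intro hu
    have h7 := congrArg (fun w => e.repr w i) hb'
    simp only [map_smul, Finsupp.smul_apply, smul_eq_mul] at h7
    exact hxc ((hu.dvd_mul_right).1 ⟨_, h7⟩)
  refine eB.injective (Eq.trans ?_ (LinearEquiv.map_zero eB).symm)
  refine (TensorProduct.quotTensorEquivQuotSMul_mk_tmul (maximalIdeal A) 1 b).trans ?_
  rw [one_smul, Submodule.Quotient.mk_eq_zero]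
  exact h6

/-- Over a local ring of depth at most one an injection of free modules splits as soon as its cokernel
embeds in a free module. -/
theorem exists_retraction_of_exact [Module.Free A B] [Module.Finite A B] [Module.Free A F]
    [Module.Finite A F] [Module.Free A G] {x c : A} (hx : x = 0 ∨ x ∈ nonZeroDivisors A)
    (hxc : ¬ x ∣ c) (hc : ∀ y ∈ maximalIdeal A, x ∣ y * c) {f : B →ₗ[A] F}
    (hf : Function.Injective f) {g : F →ₗ[A] G} (hfg : Function.Exact f g) :
    ∃ r : F →ₗ[A] B, r ∘ₗ f = LinearMap.id := by
  refine exists_retraction_of_dvd hxc hc fun b y hy => ?_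
  rcases hx with rfl | hx
  · exact ⟨0, hf (by rw [hy, zero_smul, zero_smul, map_zero])⟩
  -- As `x` is regular on the free module `G`, the element `y` lies in the kernel of `g`, which is
  -- the image of `f`; injectivity of `f` then divides `b` by `x`.
  · have h3 : x • g y = 0 := by
      rw [← map_smul, ← hy]
      exact hfg.apply_apply_eq_zero _
    have h4 : g y = 0 := by
      refine (Module.Free.chooseBasis A G).ext_elem fun i => ?_
      have h5 := congrArg (fun w => (Module.Free.chooseBasis A G).repr w i) h3
      simp only [map_smul, Finsupp.smul_apply, smul_eq_mul, map_zero, Finsupp.zero_apply] at h5 ⊢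
      exact (mul_right_mem_nonZeroDivisors_eq_zero_iff hx).1 ((mul_comm _ _).trans h5)
    obtain ⟨b', rfl⟩ := (hfg y).1 h4
    exact ⟨b', hf (by rw [hy, map_smul])⟩

/-- Over a noetherian local ring of dimension zero every injection of free modules splits. -/
theorem exists_retraction_of_height_eq_zero [IsNoetherianRing A] (h0 : (maximalIdeal A).height = 0)
    [Module.Free A B] [Module.Finite A B] [Module.Free A F] [Module.Finite A F] {f : B →ₗ[A] F}
    (hf : Function.Injective f) : ∃ r : F →ₗ[A] B, r ∘ₗ f = LinearMap.id := by
  obtain ⟨x, c, hx, hxc, hc⟩ := exists_socle_of_height_le_one (A := A) (by rw [h0]; exact zero_le_one)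
  -- `x` is not a unit, since it fails to divide `c`; in dimension zero the maximal ideal is a
  -- minimal prime and contains no non-zero-divisor.
  have hx0 : x = 0 := by
    refine hx.resolve_right fun hx => ?_
    have hxm : x ∈ maximalIdeal A := (mem_maximalIdeal x).2 fun hu => hxc (hu.dvd)
    exact Set.disjoint_left.1 (Ideal.disjoint_nonZeroDivisors_of_mem_minimalPrimes
      (Ideal.height_eq_zero_iff.1 h0)) hxm hx
  subst hx0
  refine exists_retraction_of_dvd hxc hc fun b y hy => ⟨0, hf ?_⟩
  rw [hy, zero_smul, zero_smul, map_zero]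

theorem free_ker_of_free_range [Module.Free A F] [Module.Finite A F] (f : F →ₗ[A] G)
    [Module.Free A (LinearMap.range f)] : Module.Free A (LinearMap.ker f) := by
  obtain ⟨s, hs⟩ := Module.projective_lifting_property f.rangeRestrict LinearMap.id
    f.surjective_rangeRestrict
  have hs' : ∀ y, f (s y) = y := fun y => congrArg Subtype.val (LinearMap.congr_fun hs y)
  let r : F →ₗ[A] LinearMap.ker f := (LinearMap.id - s ∘ₗ f.rangeRestrict).codRestrict _ (fun y => by
    rw [LinearMap.mem_ker]
    simp only [LinearMap.sub_apply, LinearMap.id_apply, LinearMap.comp_apply, map_sub, hs']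
    simp)
  have hr : r ∘ₗ (LinearMap.ker f).subtype = LinearMap.id := by
    ext y
    have hy : f.rangeRestrict y = 0 := Subtype.ext y.2
    simp [r, hy]
  have hsurj : Function.Surjective r := fun y => ⟨y, LinearMap.congr_fun hr y⟩
  have : Module.Finite A (LinearMap.ker f) := Module.Finite.of_surjective r hsurj
  have : Module.Projective A (LinearMap.ker f) := Module.Projective.of_split _ r hr
  exact Module.free_of_flat_of_isLocalRing

/-- The projector `id - f ∘ r` kills the kernel of `g` and so induces a section of `F → range g`;
the range is projective, hence free. -/
theorem free_range_of_retraction [Module.Free A F] [Module.Finite A F] {f : B →ₗ[A] F}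
    {g : F →ₗ[A] G} (hfg : Function.Exact f g) (r : F →ₗ[A] B) (hr : r ∘ₗ f = LinearMap.id) :
    Module.Free A (LinearMap.range g) := by
  have hr' : ∀ y, r (f y) = y := LinearMap.congr_fun hr
  have hker : LinearMap.ker g ≤ LinearMap.ker (LinearMap.id - f ∘ₗ r) := by
    intro y hy
    obtain ⟨z, rfl⟩ := (hfg y).1 hy
    simp [hr']
  let s : LinearMap.range g →ₗ[A] F :=
    (LinearMap.ker g).liftQ (LinearMap.id - f ∘ₗ r) hker ∘ₗ g.quotKerEquivRange.symm.toLinearMap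
  have hs : g.rangeRestrict ∘ₗ s = LinearMap.id := by
    refine LinearMap.ext fun y => ?_
    obtain ⟨z, rfl⟩ := g.surjective_rangeRestrict y
    have : g.quotKerEquivRange.symm (g.rangeRestrict z) = Submodule.Quotient.mk z := by
      rw [LinearEquiv.symm_apply_eq]; rfl
    refine Subtype.ext ?_
    simp [s, this, hfg.apply_apply_eq_zero]
  have : Module.Projective A (LinearMap.range g) := Module.Projective.of_split s _ hs
  have : Module.Finite A (LinearMap.range g) := Module.Finite.range g
  exact Module.free_of_flat_of_isLocalRing

end IsLocalRing

/-! ### Wedge products along exact sequences of free modules. -/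

namespace ExteriorAlgebra

variable {A : Type*} [CommRing A] {M N Z M₀ : Type*} [AddCommGroup M] [Module A M]
  [AddCommGroup N] [Module A N] [AddCommGroup Z] [Module A Z] [AddCommGroup M₀] [Module A M₀]

/-- A top form wedged with one more basis vector repeats a vector. -/
theorem mul_ι_eq_zero_of_top {n : ℕ} (ζ : Module.Basis (Fin n) A Z) {x : ExteriorAlgebra A Z}
    (hx : x ∈ ⋀[A]^n Z) (z : Z) : x * ι A z = 0 := by
  rw [eq_detOn_smul ζ hx, smul_mul_assoc]
  suffices h : ∀ i, ιMulti A n ζ * ι A (ζ i) = 0 by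
    rw [← ζ.sum_repr z, map_sum, Finset.mul_sum]
    simp only [map_smul, mul_smul_comm, h, smul_zero, Finset.sum_const_zero]
  intro i
  have h1 : ι A (ζ i) = ιMulti A 1 ![ζ i] := by simp [ιMulti_apply]
  rw [h1, ιMulti_mul_ιMulti]
  refine ιMulti_eq_zero_of_not_inj fun hinj => ?_
  have h2 : Fin.append ζ ![ζ i] (Fin.castAdd 1 i) = Fin.append ζ ![ζ i] (Fin.natAdd n 0) := by simp
  have := congrArg Fin.val (hinj h2)
  simp at this
  omega

/-- Since `y` kills the kernel of `d`, the factor `x` may be replaced by its projection to a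
complement isomorphic to the range of `d`. There `x` is a top form, hence a multiple of the wedge of
the lifted basis `w`. -/
theorem mul_eq_detOn_smul {k : ℕ} {d : M →ₗ[A] N} (b : Module.Basis (Fin k) A (LinearMap.range d))
    {w : Fin k → M} (hw : ∀ j, d (w j) = b j) {y : ExteriorAlgebra A M}
    (hy : ∀ z ∈ LinearMap.ker d, y * ι A z = 0) {x : ExteriorAlgebra A M} (hx : x ∈ ⋀[A]^k M) :
    y * x = detOn b (map d.rangeRestrict x) • (y * ιMulti A k w) := by
  let s : LinearMap.range d →ₗ[A] M := b.constr A w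
  have hs : ∀ r, d (s r) = r := by
    have : d ∘ₗ s = (LinearMap.range d).subtype := by
      refine b.ext fun j => ?_
      simp [s, hw]
    exact LinearMap.congr_fun this
  rw [mul_eq_mul_map (g := s ∘ₗ d.rangeRestrict) (fun m => hy _ ?_), ← map_comp_map,
    AlgHom.comp_apply, eq_detOn_smul b (map_mem d.rangeRestrict hx), map_smul, map_apply_ιMulti,
    mul_smul_comm, map_smul, detOn_ιMulti, Module.Basis.det_self, smul_eq_mul, mul_one]
  · congr 3
    funext j
    simp [s]
  · rw [LinearMap.mem_ker, map_sub, LinearMap.comp_apply, hs]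
    simp

theorem map_eq_detOn_smul {n : ℕ} {d : M₀ →ₗ[A] M} (b : Module.Basis (Fin n) A (LinearMap.range d))
    {x : ExteriorAlgebra A M₀} (hx : x ∈ ⋀[A]^n M₀) :
    map d x = detOn b (map d.rangeRestrict x) • ιMulti A n (fun i => (b i : M)) := by
  have h1 : map d x = map (LinearMap.range d).subtype (map d.rangeRestrict x) := by
    rw [← AlgHom.comp_apply, map_comp_map]; rfl
  rw [h1]
  conv_lhs => rw [eq_detOn_smul b (map_mem d.rangeRestrict hx), map_smul, map_apply_ιMulti]
  rfl

/-- A basis of the kernel and lifts of a basis of the range form a basis. -/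
theorem _root_.Module.Basis.exists_append {m k : ℕ} {i : Z →ₗ[A] M} {d : M →ₗ[A] N}
    (hi : Function.Injective i) (hid : Function.Exact i d) (ζ : Module.Basis (Fin m) A Z)
    (b : Module.Basis (Fin k) A (LinearMap.range d)) {w : Fin k → M} (hw : ∀ j, d (w j) = b j) :
    ∃ E : Module.Basis (Fin (m + k)) A M, ⇑E = Fin.append (i ∘ ζ) w := by
  let s : LinearMap.range d →ₗ[A] M := b.constr A w
  have hs : ∀ r, d (s r) = r := by
    have : d ∘ₗ s = (LinearMap.range d).subtype := by
      refine b.ext fun j => ?_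
      simp [s, hw]
    exact LinearMap.congr_fun this
  let φ : (Z × LinearMap.range d) →ₗ[A] M := i.coprod s
  have hφ : Function.Bijective φ := by
    constructor
    · rw [injective_iff_map_eq_zero]
      rintro ⟨z, r⟩ h
      have h1 : i z + s r = 0 := h
      have h2 := congrArg d h1
      rw [map_add, hid.apply_apply_eq_zero, zero_add, hs, map_zero] at h2
      have hr : r = 0 := Subtype.ext h2
      subst hr
      rw [map_zero, add_zero] at h1
      rw [hi (h1.trans (map_zero i).symm)]; rfl
    · intro x
      have h1 : d (x - s (d.rangeRestrict x)) = 0 := by rw [map_sub, hs]; simp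
      obtain ⟨z, hz⟩ := (hid _).1 h1
      exact ⟨(z, d.rangeRestrict x), by simp [φ, hz]⟩
  refine ⟨((ζ.prod b).map (LinearEquiv.ofBijective φ hφ)).reindex finSumFinEquiv, ?_⟩
  funext j
  refine Fin.addCases (fun j => ?_) (fun j => ?_) j
  · simp [φ]
  · simp [φ, s]

/-- The degreewise formula for a differential that is exact on the left. -/
theorem detOn_map_mul {n k : ℕ} {d₀ : M₀ →ₗ[A] M} {d : M →ₗ[A] N} (h : Function.Exact d₀ d)
    (b₀ : Module.Basis (Fin n) A (LinearMap.range d₀))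
    (b : Module.Basis (Fin k) A (LinearMap.range d)) :
    ∃ E : Module.Basis (Fin (n + k)) A M, ∀ x₀ ∈ ⋀[A]^n M₀, ∀ x ∈ ⋀[A]^k M,
      detOn E (map d₀ x₀ * x) = detOn b₀ (map d₀.rangeRestrict x₀) * detOn b (map d.rangeRestrict x) := by
  choose w hw using fun j => (b j).2
  have hex : Function.Exact (LinearMap.range d₀).subtype d := by
    intro y
    rw [h y]
    simp
  obtain ⟨E, hE⟩ := Module.Basis.exists_append (Submodule.subtype_injective _) hex b₀ b hw
  refine ⟨E, fun x₀ hx₀ x hx => ?_⟩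
  -- By exactness the kernel of `d` is the range of `d₀`, and `map d₀ x₀` is a top form of that
  -- range.
  have hz : ∀ z ∈ LinearMap.ker d, map d₀ x₀ * ι A z = 0 := by
    intro z hz
    obtain ⟨z, rfl⟩ : ∃ z' : LinearMap.range d₀, (z' : M) = z := ⟨⟨z, (h z).1 hz⟩, rfl⟩
    have h1 := mul_ι_eq_zero_of_top b₀ (map_mem d₀.rangeRestrict hx₀) z
    have h2 := congrArg (map (LinearMap.range d₀).subtype) h1
    rw [map_mul, map_apply_ι, map_zero, ← AlgHom.comp_apply, map_comp_map] at h2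
    exact h2
  rw [mul_eq_detOn_smul b hw hz hx, map_eq_detOn_smul b₀ hx₀, smul_mul_assoc, ιMulti_mul_ιMulti,
    map_smul, map_smul, detOn_ιMulti]
  have : Fin.append (fun i => (b₀ i : M)) w = E := by rw [hE]; rfl
  rw [this, Module.Basis.det_self, smul_eq_mul, smul_eq_mul, mul_one, mul_comm]

/-- The degreewise formula in the degree with cohomology: `Z` is the kernel of `d`, and `b₁` a basis
of the coboundaries in `Z`. -/
theorem detOn_map_mul_mul {n l k m : ℕ} {d₀ : M₀ →ₗ[A] M} {d : M →ₗ[A] N} {i : Z →ₗ[A] M}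
    (hi : Function.Injective i) (hid : Function.Exact i d)
    (ζ : Module.Basis (Fin m) A Z) (hm : m = n + l)
    (b₀ : Module.Basis (Fin n) A (LinearMap.range d₀)) {b₁ : Fin n → Z} (hb : ∀ j, i (b₁ j) = b₀ j)
    (b : Module.Basis (Fin k) A (LinearMap.range d)) :
    ∃ E : Module.Basis (Fin (m + k)) A M, ∀ x₀ ∈ ⋀[A]^n M₀, ∀ y ∈ ⋀[A]^l Z, ∀ x ∈ ⋀[A]^k M,
      detOn E (map d₀ x₀ * map i y * x) =
        detOn b₀ (map d₀.rangeRestrict x₀) * detOn b (map d.rangeRestrict x)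
          * detOn ζ (ιMulti A n b₁ * y) := by
  choose w hw using fun j => (b j).2
  obtain ⟨E, hE⟩ := Module.Basis.exists_append hi hid ζ b hw
  refine ⟨E, fun x₀ hx₀ y hy x hx => ?_⟩
  have hby : ιMulti A n b₁ * y ∈ ⋀[A]^m Z := by
    rw [hm]
    change _ ∈ (ι A).range ^ (n + l)
    rw [pow_add]
    exact Submodule.mul_mem_mul (ιMulti_range _ _ ⟨_, rfl⟩) hy
  have h0 : map d₀ x₀ * map i y
      = detOn b₀ (map d₀.rangeRestrict x₀) • map i (ιMulti A n b₁ * y) := by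
    rw [map_eq_detOn_smul b₀ hx₀, smul_mul_assoc, map_mul, map_apply_ιMulti]
    congr 3
    simp [funext_iff, hb]
  -- Coboundary form and `y` together make a top form of `Z`, because its rank is `n + l`.
  have hz : ∀ z ∈ LinearMap.ker d, (map d₀ x₀ * map i y) * ι A z = 0 := by
    intro z hz
    obtain ⟨z, rfl⟩ := (hid z).1 hz
    rw [h0, smul_mul_assoc, ← map_apply_ι, ← map_mul, mul_ι_eq_zero_of_top ζ hby, map_zero, smul_zero]
  have h3 : map i (ιMulti A n b₁ * y)
      = detOn ζ (ιMulti A n b₁ * y) • ιMulti A m (i ∘ ζ) := by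
    conv_lhs => rw [eq_detOn_smul ζ hby]
    rw [map_smul, map_apply_ιMulti]
  rw [mul_eq_detOn_smul b hw hz hx, h0, h3, smul_mul_assoc, smul_mul_assoc, ιMulti_mul_ιMulti]
  simp only [LinearMap.map_smul]
  rw [← hE, detOn_ιMulti, Module.Basis.det_self]
  simp only [smul_eq_mul]
  ring

end ExteriorAlgebra

/-! ### Localized linear maps. -/

namespace LocalizedModule

variable {R : Type*} [CommRing R] (S : Submonoid R) {M N Q : Type*} [AddCommGroup M] [Module R M]
  [AddCommGroup N] [Module R N] [AddCommGroup Q] [Module R Q]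

theorem map_comp_apply (g : M →ₗ[R] N) (h : N →ₗ[R] Q) (x : LocalizedModule S M) :
    map S (h ∘ₗ g) x = map S h (map S g x) :=
  LinearMap.congr_fun (IsLocalizedModule.map_comp' S (mkLinearMap S M) (mkLinearMap S N)
    (mkLinearMap S Q) g h) x

theorem exact_map {g : M →ₗ[R] N} {h : N →ₗ[R] Q} (ex : Function.Exact g h) :
    Function.Exact (map S g) (map S h) :=
  LocalizedModule.map_exact S g h ex

theorem injective_map {g : M →ₗ[R] N} (hg : Function.Injective g) :
    Function.Injective (map S g) :=
  IsLocalizedModule.map_injective S (mkLinearMap S M) (mkLinearMap S N) g hg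

theorem surjective_map {g : M →ₗ[R] N} (hg : Function.Surjective g) :
    Function.Surjective (map S g) :=
  IsLocalizedModule.map_surjective S (mkLinearMap S M) (mkLinearMap S N) g hg

end LocalizedModule

/-! ### Localized complexes and freeness of their coboundaries. -/

namespace PerfDet

section Complex

variable {R : Type u} [CommRing R] (P : CochainComplex (ModuleCat.{u} R) ℤ)

theorem iCycles_injective (i : ℤ) : Function.Injective (P.iCycles i).hom :=
  (ModuleCat.mono_iff_injective _).1 inferInstance

theorem exact_iCycles_d {i j : ℤ} (h : i + 1 = j) :
    Function.Exact (P.iCycles i).hom (P.d i j).hom := by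
  have h1 := ShortComplex.exact_of_f_is_kernel
    (ShortComplex.mk (P.iCycles i) (P.d i j) (P.iCycles_d i j))
    (P.cyclesIsKernel i j ((ComplexShape.up ℤ).next_eq' h))
  exact (ShortComplex.ShortExact.moduleCat_exact_iff_function_exact _).1 h1

theorem exact_toCycles_homologyπ {i j : ℤ} (h : i + 1 = j) :
    Function.Exact (P.toCycles i j).hom (P.homologyπ j).hom := by
  have h1 := ShortComplex.exact_of_g_is_cokernel
    (ShortComplex.mk (P.toCycles i j) (P.homologyπ j) (P.toCycles_comp_homologyπ i j))
    (P.homologyIsCokernel i j ((ComplexShape.up ℤ).prev_eq' h))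
  exact (ShortComplex.ShortExact.moduleCat_exact_iff_function_exact _).1 h1

theorem homologyπ_surjective (i : ℤ) : Function.Surjective (P.homologyπ i).hom :=
  (ModuleCat.epi_iff_surjective _).1 inferInstance

theorem iCycles_comp_toCycles (i j : ℤ) :
    (P.iCycles j).hom ∘ₗ (P.toCycles i j).hom = (P.d i j).hom := by
  rw [← ModuleCat.hom_comp, P.toCycles_i]

variable {P} {K : CochainComplex (ModuleCat.{u} R) ℤ} (f : P ⟶ K)

theorem homologyMap_bijective [QuasiIso f] (i : ℤ) :
    Function.Bijective (HomologicalComplex.homologyMap f i).hom :=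
  ConcreteCategory.bijective_of_isIso (HomologicalComplex.homologyMap f i)

theorem cocycleClass_surjective [QuasiIso f] (i : ℤ) : Function.Surjective (cocycleClass f i) := by
  rw [cocycleClass, ModuleCat.hom_comp]
  exact (homologyMap_bijective f i).2.comp (homologyπ_surjective P i)

theorem exact_toCycles_cocycleClass [QuasiIso f] {i j : ℤ} (h : i + 1 = j) :
    Function.Exact (P.toCycles i j).hom (cocycleClass f j) := by
  intro y
  rw [← exact_toCycles_homologyπ P h y, cocycleClass, ModuleCat.hom_comp, LinearMap.comp_apply]
  exact map_eq_zero_iff _ (homologyMap_bijective f j).1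

end Complex

section Localized

variable {R : Type u} [CommRing R] (P : CochainComplex (ModuleCat.{u} R) ℤ) (p : PrimeSpectrum R)

/-- The differential of a complex, localized at a prime. -/
noncomputable def dLoc (i j : ℤ) :
    LocalizedModule p.asIdeal.primeCompl (P.X i) →ₗ[Localization p.asIdeal.primeCompl]
      LocalizedModule p.asIdeal.primeCompl (P.X j) :=
  LocalizedModule.map p.asIdeal.primeCompl (P.d i j).hom

/-- The localization at `p` of the complex is exact in the degrees different from `1`. -/
def ExactOffOne : Prop :=
  ∀ i j k : ℤ, i + 1 = j → j + 1 = k → j ≠ 1 → Function.Exact (dLoc P p i j) (dLoc P p j k)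

variable {P p}

theorem exact_dLoc_of_subsingleton {i j k : ℤ} (hij : i + 1 = j) (hjk : j + 1 = k)
    [Subsingleton (LocalizedModule p.asIdeal.primeCompl (P.homology j))] :
    Function.Exact (dLoc P p i j) (dLoc P p j k) := by
  have h1 := LocalizedModule.exact_map p.asIdeal.primeCompl (exact_iCycles_d P hjk)
  have h2 := LocalizedModule.exact_map p.asIdeal.primeCompl (exact_toCycles_homologyπ P hij)
  intro y
  have h3 : ∀ x, dLoc P p i j x = LocalizedModule.map p.asIdeal.primeCompl (P.iCycles j).hom
      (LocalizedModule.map p.asIdeal.primeCompl (P.toCycles i j).hom x) := fun x => by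
    rw [← LocalizedModule.map_comp_apply, iCycles_comp_toCycles]; rfl
  refine (h1 y).trans ⟨?_, ?_⟩
  · rintro ⟨z, rfl⟩
    obtain ⟨x, rfl⟩ := (h2 z).1 (Subsingleton.elim _ _)
    exact ⟨x, h3 x⟩
  · rintro ⟨x, rfl⟩
    exact ⟨_, (h3 x).symm⟩

/-- The ranks of the coboundaries of a bounded complex are determined by the ranks of its terms. -/
theorem rank_unique {β ρ : ℤ → ℕ} {a b : ℤ}
    (h : ∀ i, i ≠ 1 → β i + β (i + 1) = ρ i + ρ (i + 1))
    (hβ : ∀ i, i ≤ a ∨ b < i → β i = 0) (hρ : ∀ i, i ≤ a ∨ b < i → ρ i = 0) : β = ρ := by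
  -- The relation at degree 1, which would link the values at 1 and 2, is missing. The values are
  -- therefore determined from the left end up to 1, and from the right end down to 2.
  have h1 : ∀ n : ℕ, a + n ≤ 1 → β (a + n) = ρ (a + n) := by
    intro n
    induction n with
    | zero => intro _; rw [hβ _ (Or.inl (by simp)), hρ _ (Or.inl (by simp))]
    | succ n ih =>
      intro hn
      push_cast at hn ⊢
      have := h (a + n) (by omega)
      have h2 := ih (by omega)
      rw [← add_assoc]
      omega
  have h2 : ∀ n : ℕ, 2 ≤ b + 1 - n → β (b + 1 - n) = ρ (b + 1 - n) := by
    intro n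
    induction n with
    | zero => intro _; rw [hβ _ (Or.inr (by simp)), hρ _ (Or.inr (by simp))]
    | succ n ih =>
      intro hn
      push_cast at hn ⊢
      have := h (b + 1 - (n + 1)) (by omega)
      rw [show b + 1 - ((n : ℤ) + 1) + 1 = b + 1 - n by ring] at this
      have h2 := ih (by omega)
      omega
  funext i
  by_cases hi : i ≤ 1
  · by_cases hia : i ≤ a
    · rw [hβ i (Or.inl hia), hρ i (Or.inl hia)]
    · have := h1 (i - a).toNat
      rw [Int.toNat_of_nonneg (by omega), add_sub_cancel] at this
      exact this hi
  · by_cases hib : b < i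
    · rw [hβ i (Or.inr hib), hρ i (Or.inr hib)]
    · have := h2 (b + 1 - i).toNat
      rw [Int.toNat_of_nonneg (by omega), sub_sub_cancel] at this
      exact this (by omega)

variable {a b : ℤ}

theorem subsingleton_loc (hP : IsStrictlyPerfect a b P) {i : ℤ} (hi : i < a ∨ b < i) :
    Subsingleton (LocalizedModule p.asIdeal.primeCompl (P.X i)) := by
  have := hP.zero_outside i hi
  exact LocalizedModule.subsingleton_iff.2 fun m => ⟨1, one_mem _, Subsingleton.elim _ _⟩

theorem finrank_range_eq_zero (hP : IsStrictlyPerfect a b P) {i j : ℤ} (hij : i + 1 = j)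
    (h : i < a ∨ b ≤ i) :
    Subsingleton (LinearMap.range (dLoc P p i j)) := by
  rw [subsingleton_iff_forall_eq 0]
  rintro ⟨_, y, rfl⟩
  refine Subtype.ext ?_
  by_cases hi : i < a ∨ b < i
  · have := subsingleton_loc (p := p) hP hi
    exact (congrArg (dLoc P p i j) (Subsingleton.elim y 0)).trans (map_zero _)
  · have := subsingleton_loc (p := p) hP (i := j) (by omega)
    exact Subsingleton.elim _ _

/-- By exactness these coboundaries are the kernel of the next differential, and the kernel of a map
with free range is a direct summand. Freeness thus travels to the left. -/
theorem free_range_dLoc_pred (hP : IsStrictlyPerfect a b P) (hE : ExactOffOne P p) {i j k : ℤ}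
    (hij : i + 1 = j) (hjk : j + 1 = k) (hj : j ≠ 1)
    (h : Module.Free (Localization p.asIdeal.primeCompl) (LinearMap.range (dLoc P p j k))) :
    Module.Free (Localization p.asIdeal.primeCompl) (LinearMap.range (dLoc P p i j)) := by
  have : IsLocalRing (Localization p.asIdeal.primeCompl) :=
    inferInstanceAs (IsLocalRing (Localization.AtPrime p.asIdeal))
  have := hP.finite j
  have := hP.projective j
  have := free_localizedModule (F := P.X j) p
  have h1 := IsLocalRing.free_ker_of_free_range (dLoc P p j k)
  rwa [(hE i j k hij hjk hj).linearMap_ker_eq] at h1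

/-- Descending induction from the right end, where the range is zero. No bound on the height of `p`
enters, because only exactness in degrees at least 2 is used. -/
theorem free_range_dLoc_of_one_le (hP : IsStrictlyPerfect a b P) (hE : ExactOffOne P p) {i j : ℤ}
    (hij : i + 1 = j) (hi : 1 ≤ i) :
    Module.Free (Localization p.asIdeal.primeCompl) (LinearMap.range (dLoc P p i j)) := by
  have h1 : ∀ (n : ℕ) (i j : ℤ), i + 1 = j → i + n = b → 1 ≤ i →
      Module.Free (Localization p.asIdeal.primeCompl) (LinearMap.range (dLoc P p i j)) := by
    intro n
    induction n with
    | zero =>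
      intro i j hij hn _
      have := finrank_range_eq_zero (p := p) hP hij (Or.inr (by omega))
      infer_instance
    | succ n ih =>
      intro i j hij hn hi
      exact free_range_dLoc_pred hP hE hij rfl (by omega)
        (ih j (j + 1) rfl (by push_cast at hn; omega) (by omega))
  by_cases hb : b < i
  · have := finrank_range_eq_zero (p := p) hP hij (Or.inr hb.le)
    infer_instance
  · exact h1 (b - i).toNat i j hij (by omega) (by omega)

/-- Degree 1 is the only gap in the leftward induction, so freeness of the degree-one coboundaries
is the single condition to secure at a prime. -/
theorem free_range_dLoc (hP : IsStrictlyPerfect a b P) (hE : ExactOffOne P p)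
    (h0 : Module.Free (Localization p.asIdeal.primeCompl) (LinearMap.range (dLoc P p 0 1)))
    {i j : ℤ} (hij : i + 1 = j) :
    Module.Free (Localization p.asIdeal.primeCompl) (LinearMap.range (dLoc P p i j)) := by
  have h2 : ∀ (n : ℕ) (i j : ℤ), i + 1 = j → i + n = 0 →
      Module.Free (Localization p.asIdeal.primeCompl) (LinearMap.range (dLoc P p i j)) := by
    intro n
    induction n with
    | zero =>
      intro i j hij hn
      obtain rfl : i = 0 := by simpa using hn
      obtain rfl : j = 1 := by omega
      exact h0
    | succ n ih =>
      intro i j hij hn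
      exact free_range_dLoc_pred hP hE hij rfl (by omega)
        (ih j (j + 1) rfl (by push_cast at hn; omega))
  by_cases hi : i ≤ 0
  · exact h2 (0 - i).toNat i j hij (by omega)
  · exact free_range_dLoc_of_one_le hP hE hij (by omega)

/-- Below degree 1 freeness travels to the right, from the left end where the range is zero, thanks
to depth at most one. Free coboundaries inside a free term have a quotient that embeds in the next
free term, so the inclusion splits and the next coboundaries are free. -/
theorem free_range_dLoc_zero_one (hP : IsStrictlyPerfect a b P) (hE : ExactOffOne P p)
    [IsNoetherianRing R] (hp : p.asIdeal.height ≤ 1) :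
    Module.Free (Localization p.asIdeal.primeCompl) (LinearMap.range (dLoc P p 0 1)) := by
  have : IsLocalRing (Localization p.asIdeal.primeCompl) :=
    inferInstanceAs (IsLocalRing (Localization.AtPrime p.asIdeal))
  have : IsNoetherianRing (Localization p.asIdeal.primeCompl) :=
    inferInstanceAs (IsNoetherianRing (Localization.AtPrime p.asIdeal))
  have hht : (IsLocalRing.maximalIdeal (Localization p.asIdeal.primeCompl)).height ≤ 1 := by
    rw [← WithBot.coe_le_coe, IsLocalRing.maximalIdeal_height_eq_ringKrullDim]
    refine le_of_eq_of_le ?_ (WithBot.coe_le_coe.2 hp)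
    exact IsLocalization.AtPrime.ringKrullDim_eq_height p.asIdeal (Localization.AtPrime p.asIdeal)
  obtain ⟨x, c, hx, hxc, hc⟩ := IsLocalRing.exists_socle_of_height_le_one hht
  have hfree : ∀ i, Module.Free (Localization p.asIdeal.primeCompl)
      (LocalizedModule p.asIdeal.primeCompl (P.X i)) ∧ Module.Finite
      (Localization p.asIdeal.primeCompl) (LocalizedModule p.asIdeal.primeCompl (P.X i)) := by
    intro i
    have := hP.finite i
    have := hP.projective i
    exact ⟨free_localizedModule p, inferInstance⟩
  have hstep : ∀ i j k : ℤ, i + 1 = j → j + 1 = k → j ≠ 1 →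
      Module.Free (Localization p.asIdeal.primeCompl) (LinearMap.range (dLoc P p i j)) →
      Module.Free (Localization p.asIdeal.primeCompl) (LinearMap.range (dLoc P p j k)) := by
    intro i j k hij hjk hj _
    have := (hfree i).2
    have := (hfree j).1
    have := (hfree j).2
    have := (hfree k).1
    have hex : Function.Exact (LinearMap.range (dLoc P p i j)).subtype (dLoc P p j k) := by
      intro y
      rw [hE i j k hij hjk hj y]
      simp
    obtain ⟨r, hr⟩ := IsLocalRing.exists_retraction_of_exact hx hxc hc
      (Submodule.subtype_injective _) hex
    exact IsLocalRing.free_range_of_retraction hex r hr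
  have h1 : ∀ (n : ℕ) (i j : ℤ), i + 1 = j → i < a + n → i ≤ 0 →
      Module.Free (Localization p.asIdeal.primeCompl) (LinearMap.range (dLoc P p i j)) := by
    intro n
    induction n with
    | zero =>
      intro i j hij hn _
      have := finrank_range_eq_zero (p := p) hP hij (Or.inl (by simpa using hn))
      infer_instance
    | succ n ih =>
      intro i j hij hn hi
      exact hstep (i - 1) i j (by omega) hij (by omega)
        (ih (i - 1) i (by omega) (by push_cast at hn; omega) (by omega))
  exact h1 (1 - a).toNat 0 1 rfl (by omega) le_rfl

end Localized

end PerfDet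

/-! ### Ranks of coboundaries and the Euler characteristic. -/

namespace PerfDet

theorem finrank_eq_add {A : Type*} [CommRing A] [Nontrivial A] {Z M N : Type*} [AddCommGroup Z]
    [Module A Z] [AddCommGroup M] [Module A M] [AddCommGroup N] [Module A N] {i : Z →ₗ[A] M}
    {d : M →ₗ[A] N} (hi : Function.Injective i) (hid : Function.Exact i d) [Module.Free A Z]
    [Module.Finite A Z] [Module.Finite A M] [Module.Free A (LinearMap.range d)] :
    Module.finrank A M = Module.finrank A Z + Module.finrank A (LinearMap.range d) := by
  choose w hw using fun j => (Module.finBasis A (LinearMap.range d) j).2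
  obtain ⟨E, -⟩ := Module.Basis.exists_append hi hid (Module.finBasis A Z)
    (Module.finBasis A (LinearMap.range d)) hw
  rw [Module.finrank_eq_card_basis E, Fintype.card_fin]

variable {R : Type u} [CommRing R]

instance (p : PrimeSpectrum R) : IsLocalRing (Localization p.asIdeal.primeCompl) :=
  inferInstanceAs (IsLocalRing (Localization.AtPrime p.asIdeal))

variable {P : CochainComplex (ModuleCat.{u} R) ℤ} {p : PrimeSpectrum R} {a b : ℤ}

/-- The inclusion of the `1`-cocycles, localized at a prime. -/
noncomputable def iLoc (P : CochainComplex (ModuleCat.{u} R) ℤ) (p : PrimeSpectrum R) :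
    LocalizedModule p.asIdeal.primeCompl (P.cycles 1) →ₗ[Localization p.asIdeal.primeCompl]
      LocalizedModule p.asIdeal.primeCompl (P.X 1) :=
  LocalizedModule.map p.asIdeal.primeCompl (P.iCycles 1).hom

theorem iLoc_injective : Function.Injective (iLoc P p) :=
  LocalizedModule.injective_map _ (iCycles_injective P 1)

theorem exact_iLoc : Function.Exact (iLoc P p) (dLoc P p 1 2) :=
  LocalizedModule.exact_map _ (exact_iCycles_d P rfl)

theorem free_loc (hP : IsStrictlyPerfect a b P) (i : ℤ) :
    Module.Free (Localization p.asIdeal.primeCompl) (LocalizedModule p.asIdeal.primeCompl (P.X i)) :=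
  have := hP.finite i
  have := hP.projective i
  free_localizedModule p

theorem finite_loc (hP : IsStrictlyPerfect a b P) (i : ℤ) :
    Module.Finite (Localization p.asIdeal.primeCompl)
      (LocalizedModule p.asIdeal.primeCompl (P.X i)) :=
  have := hP.finite i
  inferInstance

theorem free_cycles (hP : IsStrictlyPerfect a b P)
    (h : Module.Free (Localization p.asIdeal.primeCompl) (LinearMap.range (dLoc P p 1 2))) :
    Module.Free (Localization p.asIdeal.primeCompl)
      (LocalizedModule p.asIdeal.primeCompl (P.cycles 1)) ∧
    Module.Finite (Localization p.asIdeal.primeCompl)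
      (LocalizedModule p.asIdeal.primeCompl (P.cycles 1)) := by
  have := free_loc (p := p) hP 1
  have := finite_loc (p := p) hP 1
  have h1 := IsLocalRing.free_ker_of_free_range (dLoc P p 1 2)
  rw [exact_iLoc.linearMap_ker_eq] at h1
  let e := LinearEquiv.ofInjective (iLoc P p) iLoc_injective
  refine ⟨Module.Free.of_equiv e.symm, ?_⟩
  obtain ⟨s, hs⟩ := Module.projective_lifting_property (dLoc P p 1 2).rangeRestrict LinearMap.id
    (dLoc P p 1 2).surjective_rangeRestrict
  have hs' : ∀ y, dLoc P p 1 2 (s y) = y := fun y => congrArg Subtype.val (LinearMap.congr_fun hs y)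
  let r : LocalizedModule p.asIdeal.primeCompl (P.X 1) →ₗ[Localization p.asIdeal.primeCompl]
      LinearMap.range (iLoc P p) :=
    (LinearMap.id - s ∘ₗ (dLoc P p 1 2).rangeRestrict).codRestrict _ (fun y => by
      rw [← exact_iLoc.linearMap_ker_eq, LinearMap.mem_ker]
      simp only [LinearMap.sub_apply, LinearMap.id_apply, LinearMap.comp_apply, map_sub, hs']
      simp)
  have hr : Function.Surjective r := by
    rintro ⟨y, hy⟩
    refine ⟨y, Subtype.ext ?_⟩
    have : (dLoc P p 1 2).rangeRestrict y = 0 :=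
      Subtype.ext (by rwa [← exact_iLoc.linearMap_ker_eq] at hy)
    simp [r, this]
  have := Module.Finite.of_surjective r hr
  exact Module.Finite.equiv e.symm

/-- The condition that the ranks of a strictly perfect complex decompose as for a complex whose
cohomology has rank `l` in degree `1` and rank `0` in the other degrees. -/
def RankCond (P : CochainComplex (ModuleCat.{u} R) ℤ) (β : ℤ → PrimeSpectrum R → ℕ)
    (l : PrimeSpectrum R → ℕ) : Prop :=
  ∀ i p, Module.rankAtStalk (R := R) (P.X i) p
      = β i p + β (i + 1) p + (if i = 1 then l p else 0)

variable {β : ℤ → PrimeSpectrum R → ℕ} {l : PrimeSpectrum R → ℕ}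

theorem rankAtStalk_eq_zero (hP : IsStrictlyPerfect a b P) {i : ℤ} (hi : i < a ∨ b < i) :
    Module.rankAtStalk (R := R) (P.X i) p = 0 := by
  have := hP.zero_outside i hi
  rw [Module.rankAtStalk_eq_zero_of_subsingleton]; rfl

/-- The ranks are natural numbers, so a zero term forces all its summands to vanish. The bound on
the left is `i ≤ a` because `β i` already occurs in the rank of degree `i - 1`. -/
theorem RankCond.eq_zero (hP : IsStrictlyPerfect a b P) (ha : a ≤ 1) (hb : 1 ≤ b)
    (h : RankCond P β l) (p : PrimeSpectrum R) {i : ℤ} (hi : i ≤ a ∨ b < i) : β i p = 0 := by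
  by_cases hi' : i ≤ a
  · have h1 := h (i - 1) p
    rw [rankAtStalk_eq_zero hP (Or.inl (by omega)), sub_add_cancel] at h1
    omega
  · have h1 := h i p
    rw [rankAtStalk_eq_zero hP (Or.inr (by omega))] at h1
    omega

/-- Solving the recursion from both ends writes each `β i` in terms of the ranks of the projective
terms, which are locally constant. -/
theorem RankCond.isLocallyConstant (hP : IsStrictlyPerfect a b P) (ha : a ≤ 1) (hb : 1 ≤ b)
    (h : RankCond P β l) (i : ℤ) : IsLocallyConstant (β i) := by
  have hr : ∀ i, IsLocallyConstant (Module.rankAtStalk (R := R) (P.X i)) := fun i =>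
    have := hP.finite i
    have := hP.projective i
    isLocallyConstant_rankAtStalk'
  have h0 : ∀ i, i ≤ a ∨ b < i → IsLocallyConstant (β i) := fun i hi => by
    rw [show β i = fun _ => 0 from funext fun p => h.eq_zero hP ha hb p hi]
    exact IsLocallyConstant.const 0
  have h1 : ∀ (n : ℕ) (i : ℤ), i ≤ 1 → i ≤ a + n → IsLocallyConstant (β i) := by
    intro n
    induction n with
    | zero => intro i _ hi; exact h0 i (Or.inl (by simpa using hi))
    | succ n ih =>
      intro i hi1 hi
      have h2 := (hr (i - 1)).comp₂ (ih (i - 1) (by omega) (by push_cast at hi; omega)) (· - ·)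
      convert h2 using 1
      funext p
      have := h (i - 1) p
      rw [sub_add_cancel, if_neg (by omega)] at this
      omega
  have h2 : ∀ (n : ℕ) (i : ℤ), 2 ≤ i → b + 1 ≤ i + n → IsLocallyConstant (β i) := by
    intro n
    induction n with
    | zero => intro i _ hi; exact h0 i (Or.inr (by simp at hi; omega))
    | succ n ih =>
      intro i hi1 hi
      have h2 := (hr i).comp₂ (ih (i + 1) (by omega) (by push_cast at hi; omega)) (· - ·)
      convert h2 using 1
      funext p
      have := h i p
      rw [if_neg (by omega)] at this
      omega
  by_cases hi : i ≤ 1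
  · exact h1 (i - a).toNat i hi (by omega)
  · exact h2 (b + 1 - i).toNat i (by omega) (by omega)

theorem RankCond.isLocallyConstant_degree (hP : IsStrictlyPerfect a b P) (ha : a ≤ 1) (hb : 1 ≤ b)
    (h : RankCond P β l) : IsLocallyConstant l := by
  have := hP.finite 1
  have := hP.projective 1
  have h1 := ((isLocallyConstant_rankAtStalk' (R := R) (F := P.X 1)).comp₂
    (h.isLocallyConstant hP ha hb 1) (· - ·)).comp₂ (h.isLocallyConstant hP ha hb 2) (· - ·)
  convert h1 using 1
  funext p
  have := h 1 p
  rw [if_pos rfl, one_add_one_eq_two] at this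
  omega

theorem rankAtStalk_eq_add (hP : IsStrictlyPerfect a b P)
    (hF : ∀ i j : ℤ, i + 1 = j →
      Module.Free (Localization p.asIdeal.primeCompl) (LinearMap.range (dLoc P p i j)))
    (hE : ExactOffOne P p) {i j k : ℤ} (hij : i + 1 = j) (hjk : j + 1 = k) (hj : j ≠ 1) :
    Module.rankAtStalk (R := R) (P.X j) p
      = Module.finrank (Localization p.asIdeal.primeCompl) (LinearMap.range (dLoc P p i j))
        + Module.finrank (Localization p.asIdeal.primeCompl) (LinearMap.range (dLoc P p j k)) := by
  have := finite_loc (p := p) hP i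
  have := finite_loc (p := p) hP j
  have := hF i j hij
  have := hF j k hjk
  have hex : Function.Exact (LinearMap.range (dLoc P p i j)).subtype (dLoc P p j k) := by
    intro y
    rw [hE i j k hij hjk hj y]
    simp
  exact finrank_eq_add (Submodule.subtype_injective _) hex

theorem rankAtStalk_one_eq_add (hP : IsStrictlyPerfect a b P)
    (hF : Module.Free (Localization p.asIdeal.primeCompl) (LinearMap.range (dLoc P p 1 2))) :
    Module.rankAtStalk (R := R) (P.X 1) p
      = Module.finrank (Localization p.asIdeal.primeCompl)
          (LocalizedModule p.asIdeal.primeCompl (P.cycles 1))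
        + Module.finrank (Localization p.asIdeal.primeCompl) (LinearMap.range (dLoc P p 1 2)) := by
  have := finite_loc (p := p) hP 1
  obtain ⟨_, _⟩ := free_cycles hP hF
  exact finrank_eq_add iLoc_injective exact_iLoc

theorem finrank_range_pred {i j : ℤ} (hij : i + 1 = j) :
    Module.finrank (Localization p.asIdeal.primeCompl) (LinearMap.range (dLoc P p (j - 1) j))
      = Module.finrank (Localization p.asIdeal.primeCompl) (LinearMap.range (dLoc P p i j)) := by
  obtain rfl : i = j - 1 := by omega
  rfl

/-- The true ranks of the coboundaries satisfy the same recursion off degree 1 and the same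
vanishing at the ends as `β`. -/
theorem RankCond.finrank_range (hP : IsStrictlyPerfect a b P) (ha : a ≤ 1) (hb : 1 ≤ b)
    (h : RankCond P β l) (hE : ExactOffOne P p)
    (hF : ∀ i j : ℤ, i + 1 = j →
      Module.Free (Localization p.asIdeal.primeCompl) (LinearMap.range (dLoc P p i j)))
    {i j : ℤ} (hij : i + 1 = j) :
    Module.finrank (Localization p.asIdeal.primeCompl) (LinearMap.range (dLoc P p i j)) = β j p := by
  have h1 := rank_unique (a := a) (b := b) (β := fun j => Module.finrank
    (Localization p.asIdeal.primeCompl) (LinearMap.range (dLoc P p (j - 1) j)))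
    (ρ := fun j => β j p) ?_ ?_ (fun i hi => h.eq_zero hP ha hb p hi)
  · obtain rfl : i = j - 1 := by omega
    exact congrFun h1 j
  · intro i hi
    have h2 := h i p
    rw [rankAtStalk_eq_add hP hF hE (sub_add_cancel i 1) rfl hi, if_neg hi] at h2
    simp only [finrank_range_pred (p := p) (P := P) (show i + 1 = i + 1 from rfl)]
    omega
  · intro i hi
    have := finrank_range_eq_zero (p := p) hP (i := i - 1) (j := i) (by omega) (by omega)
    exact Module.finrank_zero_of_subsingleton

theorem RankCond.finrank_cycles (hP : IsStrictlyPerfect a b P) (ha : a ≤ 1) (hb : 1 ≤ b)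
    (h : RankCond P β l) (hE : ExactOffOne P p)
    (hF : ∀ i j : ℤ, i + 1 = j →
      Module.Free (Localization p.asIdeal.primeCompl) (LinearMap.range (dLoc P p i j))) :
    Module.finrank (Localization p.asIdeal.primeCompl)
      (LocalizedModule p.asIdeal.primeCompl (P.cycles 1)) = β 1 p + l p := by
  have h1 := h 1 p
  rw [rankAtStalk_one_eq_add hP (hF 1 2 rfl), h.finrank_range hP ha hb hE hF (i := 1) (j := 2) rfl, if_pos rfl,
    one_add_one_eq_two] at h1
  omega

theorem exists_minimal_le (p : PrimeSpectrum R) :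
    ∃ m : PrimeSpectrum R, m ≤ p ∧ m.asIdeal.height = 0 := by
  obtain ⟨m, hm, hle⟩ := Ideal.exists_minimalPrimes_le (I := ⊥) (J := p.asIdeal) bot_le
  refine ⟨⟨m, hm.1.1⟩, hle, ?_⟩
  have := hm.1.1
  exact Ideal.height_eq_zero_iff.2 hm

/-- Existence of the ranks of the coboundaries and of the cohomology. -/
theorem exists_rankCond [IsNoetherianRing R] (hP : IsStrictlyPerfect a b P)
    (hE : ∀ p : PrimeSpectrum R, p.asIdeal.height ≤ 1 → ExactOffOne P p) :
    ∃ β l, RankCond P β l := by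
  -- The ranks at `p` are read off at a minimal prime below `p`, where the coboundaries are free;
  -- the rank of a projective module does not change along a specialization.
  choose m hm h0 using exists_minimal_le (R := R)
  have h0' : ∀ p, (m p).asIdeal.height ≤ 1 := fun p => by rw [h0]; exact zero_le_one
  have hF : ∀ p, ∀ i j : ℤ, i + 1 = j → Module.Free (Localization (m p).asIdeal.primeCompl)
      (LinearMap.range (dLoc P (m p) i j)) := fun p i j hij =>
    free_range_dLoc hP (hE _ (h0' p)) (free_range_dLoc_zero_one hP (hE _ (h0' p)) (h0' p)) hij
  refine ⟨fun i p => Module.finrank (Localization (m p).asIdeal.primeCompl)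
      (LinearMap.range (dLoc P (m p) (i - 1) i)),
    fun p => Module.finrank (Localization (m p).asIdeal.primeCompl)
      (LocalizedModule (m p).asIdeal.primeCompl (P.cycles 1)) -
      Module.finrank (Localization (m p).asIdeal.primeCompl)
      (LinearMap.range (dLoc P (m p) 0 1)), fun i p => ?_⟩
  have := hP.finite i
  have := hP.projective i
  rw [← Module.rankAtStalk_eq_of_le_of_finite_of_flat (P.X i) (hm p)]
  by_cases hi : i = 1
  · subst hi
    have := finite_loc (p := m p) hP 0
    obtain ⟨_, _⟩ := free_cycles hP (hF p 1 2 rfl)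
    have := hF p 0 1 rfl
    -- The coboundaries inject into the cocycles, so the truncated subtraction defining `l` is a
    -- true one. This is where nonnegativity of the Euler characteristic comes from.
    have hex : ∀ y ∈ LinearMap.range (dLoc P (m p) 0 1), y ∈ LinearMap.range (iLoc P (m p)) := by
      rintro _ ⟨x, rfl⟩
      refine ⟨LocalizedModule.map _ (P.toCycles 0 1).hom x, ?_⟩
      rw [iLoc, ← LocalizedModule.map_comp_apply, iCycles_comp_toCycles]; rfl
    let φ := (LinearEquiv.ofInjective (iLoc P (m p)) iLoc_injective).symm.toLinearMap ∘ₗ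
      Submodule.inclusion (show LinearMap.range (dLoc P (m p) 0 1) ≤ _ from hex)
    have hφ : Function.Injective φ := by
      intro x y hxy
      exact Submodule.inclusion_injective hex
        ((LinearEquiv.ofInjective (iLoc P (m p)) iLoc_injective).symm.injective hxy)
    have := LinearMap.finrank_le_finrank_of_injective hφ
    rw [rankAtStalk_one_eq_add hP (hF p 1 2 rfl), if_pos rfl]
    have h1 := finrank_range_pred (p := m p) (P := P) (zero_add (1 : ℤ))
    have h2 : Module.finrank (Localization (m p).asIdeal.primeCompl)
        (LinearMap.range (dLoc P (m p) (1 + 1 - 1) (1 + 1)))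
        = Module.finrank (Localization (m p).asIdeal.primeCompl)
        (LinearMap.range (dLoc P (m p) 1 2)) :=
      finrank_range_pred (i := 1) (j := 2) rfl
    beta_reduce
    omega
  · rw [rankAtStalk_eq_add hP (hF p) (hE _ (h0' p)) (sub_add_cancel i 1) rfl hi, if_neg hi]
    simp only [finrank_range_pred (p := m p) (P := P) (show i + 1 = i + 1 from rfl), add_zero]

theorem sum_Icc_succ_eq {M : Type*} [AddCommMonoid M] {g : ℤ → M} (h : ∀ i, i ≤ a ∨ b < i → g i = 0) :
    ∑ i ∈ Finset.Icc a b, g (i + 1) = ∑ i ∈ Finset.Icc a b, g i := by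
  have hg : ∀ i, g i ≠ 0 → a < i ∧ i ≤ b := fun i hi => by
    by_contra hc
    exact hi (h i (by omega))
  refine Finset.sum_bij_ne_zero (fun i _ _ => i + 1) ?_ ?_ ?_ ?_
  · intro i hi hne
    have := hg _ hne
    rw [Finset.mem_Icc]; omega
  · intro i _ _ j _ _ hij
    omega
  · intro i hi hne
    have := hg _ hne
    exact ⟨i - 1, by rw [Finset.mem_Icc]; omega, by rwa [sub_add_cancel], by omega⟩
  · intros; rfl

/-- The contributions of `β` telescope with alternating signs and leave only `l` in degree 1. -/
theorem RankCond.eq_eulerChar (hP : IsStrictlyPerfect a b P) (ha : a ≤ 1) (hb : 1 ≤ b)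
    (h : RankCond P β l) (p : PrimeSpectrum R) : (l p : ℤ) = eulerChar a b P p := by
  have h1 := sum_Icc_succ_eq (a := a) (b := b) (g := fun i => ((i - 1).negOnePow : ℤ) * (β i p : ℤ))
    (fun i hi => by simp [h.eq_zero hP ha hb p hi])
  have h2 : ∀ i, ((i - 1).negOnePow : ℤ) * (Module.rankAtStalk (R := R) (P.X i) p : ℤ)
      = ((i - 1).negOnePow : ℤ) * (β i p : ℤ)
        - ((i + 1 - 1).negOnePow : ℤ) * (β (i + 1) p : ℤ) + if i = 1 then (l p : ℤ) else 0 := by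
    intro i
    rw [h i p, add_sub_right_comm, Int.negOnePow_succ]
    split_ifs with hi
    · subst hi; push_cast; simp
    · push_cast; ring
  rw [eulerChar, Finset.sum_congr rfl fun i _ => h2 i, Finset.sum_add_distrib, Finset.sum_sub_distrib,
    h1, sub_self, zero_add, Finset.sum_ite_eq' , if_pos (Finset.mem_Icc.2 ⟨ha, hb⟩)]

/-- Shifting by one exchanges the parities; boundary terms are harmless because `C` is 1 outside
`[a, b)`. -/
theorem prod_evenDeg_sub_one {M : Type*} [CommMonoid M] {C : ℤ → M}
    (h : ∀ i, i < a ∨ b ≤ i → C i = 1) :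
    ∏ i ∈ evenDeg a b, C (i - 1) = ∏ i ∈ oddDeg a b, C i := by
  have hg : ∀ i, C i ≠ 1 → a ≤ i ∧ i < b := fun i hi => by
    by_contra hc
    exact hi (h i (by omega))
  refine Finset.prod_bij_ne_one (fun i _ _ => i - 1) ?_ ?_ ?_ ?_
  · intro i hi hne
    have := hg _ hne
    rw [Finset.mem_filter] at hi
    rw [Finset.mem_filter, Finset.mem_Icc]
    exact ⟨by omega, hi.2.sub_odd odd_one⟩
  · intro i _ _ j _ _ hij
    omega
  · intro i hi hne
    have := hg _ hne
    rw [Finset.mem_filter] at hi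
    refine ⟨i + 1, ?_, by rwa [add_sub_cancel_right], by omega⟩
    rw [Finset.mem_filter, Finset.mem_Icc]
    exact ⟨by omega, hi.2.add_odd odd_one⟩
  · intros; rfl

theorem prod_oddDeg_sub_one {M : Type*} [CommMonoid M] {C : ℤ → M}
    (h : ∀ i, i < a ∨ b ≤ i → C i = 1) :
    ∏ i ∈ oddDeg a b, C (i - 1) = ∏ i ∈ evenDeg a b, C i := by
  have hg : ∀ i, C i ≠ 1 → a ≤ i ∧ i < b := fun i hi => by
    by_contra hc
    exact hi (h i (by omega))
  refine Finset.prod_bij_ne_one (fun i _ _ => i - 1) ?_ ?_ ?_ ?_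
  · intro i hi hne
    have := hg _ hne
    rw [Finset.mem_filter] at hi
    rw [Finset.mem_filter, Finset.mem_Icc]
    exact ⟨by omega, hi.2.sub_odd odd_one⟩
  · intro i _ _ j _ _ hij
    omega
  · intro i hi hne
    have := hg _ hne
    rw [Finset.mem_filter] at hi
    refine ⟨i + 1, ?_, by rwa [add_sub_cancel_right], by omega⟩
    rw [Finset.mem_filter, Finset.mem_Icc]
    exact ⟨by omega, hi.2.add_odd odd_one⟩
  · intros; rfl

end PerfDet

/-! ### Test data and the local formula for the ratio of numerator and denominator. -/

namespace ExteriorAlgebra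

theorem detOn_one {A : Type*} [CommRing A] {M : Type*} [AddCommGroup M] [Module A M] {n : ℕ}
    (hn : n = 0) (b : Module.Basis (Fin n) A M) : detOn b 1 = 1 := by
  subst hn
  have h1 : ιMulti A 0 b = 1 := by simp [ιMulti_apply]
  rw [← h1, detOn_ιMulti, Module.Basis.det_self]

end ExteriorAlgebra

namespace PerfDet

open ExteriorAlgebra

variable {R : Type u} [CommRing R]

/-- The test data for the natural map. -/
structure Admissible (a b : ℤ) (P : CochainComplex (ModuleCat.{u} R) ℤ)
    (β : ℤ → PrimeSpectrum R → ℕ) (l : PrimeSpectrum R → ℕ) where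
  X : (i : ℤ) → ExteriorAlgebra R (P.X i)
  X_mem : ∀ i, X i ∈ extPow R (β (i + 1)) (P.X i)
  X_eq_one : ∀ i, i < a ∨ b ≤ i → X i = 1
  Y : (i : ℤ) → ExteriorAlgebra R (P.cycles i)
  Y_mem : Y 1 ∈ extPow R l (P.cycles 1)
  Y_eq_one : ∀ i, i ≠ 1 → Y i = 1
  ω : (i : ℤ) → topPow R (P.X i)
  ω_eq : ∀ i, (ω i : ExteriorAlgebra R (P.X i))
      = ExteriorAlgebra.map (P.d (i - 1) i).hom (X (i - 1))
        * ExteriorAlgebra.map (P.iCycles i).hom (Y i) * X i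

namespace Admissible

variable {a b : ℤ} {P : CochainComplex (ModuleCat.{u} R) ℤ}
  {β : ℤ → PrimeSpectrum R → ℕ} {l : PrimeSpectrum R → ℕ}

theorem ω_eq' (t : Admissible a b P β l) {i j : ℤ} (hij : i + 1 = j) :
    (t.ω j : ExteriorAlgebra R (P.X j))
      = ExteriorAlgebra.map (P.d i j).hom (t.X i)
        * ExteriorAlgebra.map (P.iCycles j).hom (t.Y j) * t.X j := by
  obtain rfl : i = j - 1 := by omega
  exact t.ω_eq j

/-- The product of the coordinates of the `ω i` of even degree. -/
noncomputable def den (γ : ∀ i, topPow R (P.X i) ≃ₗ[R] R) (t : Admissible a b P β l) : R :=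
  ∏ i ∈ evenDeg a b, γ i (t.ω i)

/-- The product of the coordinates of the `ω i` of odd degree. -/
noncomputable def num (γ : ∀ i, topPow R (P.X i) ≃ₗ[R] R) (t : Admissible a b P β l) : R :=
  ∏ i ∈ oddDeg a b, γ i (t.ω i)

/-- The wedge degrees add up to the rank of each term by `RankCond`, so the products `ω i` do lie in
the top powers. -/
theorem exists_of_mem (hP : IsStrictlyPerfect a b P) (ha : a ≤ 1) (hb : 1 ≤ b)
    (h : RankCond P β l) {X : (i : ℤ) → ExteriorAlgebra R (P.X i)}
    (hX : ∀ i, X i ∈ extPow R (β (i + 1)) (P.X i)) (hX' : ∀ i, i < a ∨ b ≤ i → X i = 1)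
    {y : ExteriorAlgebra R (P.cycles 1)} (hy : y ∈ extPow R l (P.cycles 1)) :
    ∃ t : Admissible a b P β l, t.X = X ∧ t.Y 1 = y := by
  let Y : (i : ℤ) → ExteriorAlgebra R (P.cycles i) := Function.update (fun _ => 1) 1 y
  have hY1 : Y 1 = y := Function.update_self _ _ _
  have hY : ∀ i, i ≠ 1 → Y i = 1 := fun i hi => Function.update_of_ne hi _ _
  have hlc := h.isLocallyConstant hP ha hb
  have hω : ∀ i, ExteriorAlgebra.map (P.d (i - 1) i).hom (X (i - 1))
        * ExteriorAlgebra.map (P.iCycles i).hom (Y i) * X i ∈ topPow R (P.X i) := by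
    intro i
    have h1 := hX (i - 1)
    rw [sub_add_cancel] at h1
    by_cases hi : i = 1
    · subst hi
      have h2 := mul_mem_extPow ((hlc 1).add (h.isLocallyConstant_degree hP ha hb)) (hlc (1 + 1))
        (mul_mem_extPow (hlc 1) (h.isLocallyConstant_degree hP ha hb)
          (map_mem_extPow (P.d (1 - 1) 1).hom h1) (map_mem_extPow (P.iCycles 1).hom (hY1 ▸ hy)))
        (hX 1)
      convert h2 using 1
      refine congrArg (fun r => extPow R r (P.X 1)) (funext fun p => ?_)
      rw [h 1 p, if_pos rfl, add_right_comm]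
      rfl
    · have h2 := mul_mem_extPow (hlc i) (hlc (i + 1))
        (map_mem_extPow (P.d (i - 1) i).hom h1) (hX i)
      rw [hY i hi, map_one, mul_one]
      convert h2 using 1
      refine congrArg (fun r => extPow R r (P.X i)) (funext fun p => ?_)
      rw [h i p, if_neg hi, add_zero]
  exact ⟨⟨X, hX, hX', Y, hY1 ▸ hy, hY, fun i => ⟨_, hω i⟩, fun _ => rfl⟩, rfl, hY1⟩

end Admissible

/-- Two coordinates on a free module of rank one differ by a unit, the local coordinate of the
global generator. -/
theorem detOn_locMap_topPow {F : Type u} [AddCommGroup F] [Module R F] [Module.Finite R F]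
    [Module.Projective R F] (γ : topPow R F ≃ₗ[R] R) (p : PrimeSpectrum R) {n : ℕ}
    (hn : Module.rankAtStalk (R := R) F p = n)
    (b : Module.Basis (Fin n)
        (Localization p.asIdeal.primeCompl) (LocalizedModule p.asIdeal.primeCompl F)) :
    ∃ u : (Localization p.asIdeal.primeCompl)ˣ, ∀ ω : topPow R F,
      algebraMap R (Localization p.asIdeal.primeCompl) (γ ω) * u
        = detOn b (locMap p.asIdeal.primeCompl F (ω : ExteriorAlgebra R F)) := by
  subst hn
  refine ⟨(isUnit_detOn_generator γ p b).unit, fun ω => ?_⟩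
  have h1 : (ω : ExteriorAlgebra R F) = γ ω • ((γ.symm 1 : topPow R F) : ExteriorAlgebra R F) := by
    have : ω = γ ω • γ.symm 1 := by
      rw [← map_smul, smul_eq_mul, mul_one, LinearEquiv.symm_apply_apply]
    exact congrArg Subtype.val this
  conv_rhs => rw [h1, ← algebraMap_smul_locMap, LinearMap.map_smul, smul_eq_mul]
  rfl

section

variable {P K : CochainComplex (ModuleCat.{u} R) ℤ} {p : PrimeSpectrum R} {a b : ℤ} (f : P ⟶ K)

/-- The map from cocycles to cohomology, localized at a prime. -/
noncomputable def πLoc (p : PrimeSpectrum R) :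
    LocalizedModule p.asIdeal.primeCompl (P.cycles 1) →ₗ[Localization p.asIdeal.primeCompl]
      LocalizedModule p.asIdeal.primeCompl (K.homology 1) :=
  LocalizedModule.map p.asIdeal.primeCompl (cocycleClass f 1)

theorem πLoc_surjective [QuasiIso f] : Function.Surjective (πLoc f p) :=
  LocalizedModule.surjective_map _ (cocycleClass_surjective f 1)

theorem map_ker_πLoc [QuasiIso f] :
    (LinearMap.ker (πLoc f p)).map (iLoc P p) = LinearMap.range (dLoc P p 0 1) := by
  have h1 := LocalizedModule.exact_map p.asIdeal.primeCompl
    (exact_toCycles_cocycleClass f (zero_add (1 : ℤ)))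
  have h2 : ∀ x, dLoc P p 0 1 x = iLoc P p
      (LocalizedModule.map p.asIdeal.primeCompl (P.toCycles 0 1).hom x) := fun x => by
    rw [iLoc, ← LocalizedModule.map_comp_apply, iCycles_comp_toCycles]; rfl
  ext y
  constructor
  · rintro ⟨z, hz, rfl⟩
    obtain ⟨x, rfl⟩ := (h1 z).1 hz
    exact ⟨x, h2 x⟩
  · rintro ⟨x, rfl⟩
    exact ⟨_, (h1 _).2 ⟨x, rfl⟩, (h2 x).symm⟩

/-- The coboundaries of degree one as a submodule of the cocycles. -/
noncomputable def kerEquivRange [QuasiIso f] :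
    LinearMap.ker (πLoc f p) ≃ₗ[Localization p.asIdeal.primeCompl]
      LinearMap.range (dLoc P p 0 1) :=
  (Submodule.equivMapOfInjective (iLoc P p) iLoc_injective _).trans
    (LinearEquiv.ofEq _ _ (map_ker_πLoc f))

theorem kerEquivRange_apply [QuasiIso f] (x : LinearMap.ker (πLoc f p)) :
    (kerEquivRange f x : LocalizedModule p.asIdeal.primeCompl (P.X 1)) = iLoc P p x := rfl

variable {β : ℤ → PrimeSpectrum R → ℕ} {l : PrimeSpectrum R → ℕ}

set_option maxHeartbeats 600000 in
/-- At a prime where the coboundaries are free, the ratio that defines the natural map is, up to a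
unit, the determinant of the coboundaries and of `Y` in a basis of the cocycles. -/
theorem exists_local_formula [QuasiIso f] (hP : IsStrictlyPerfect a b P) (ha : a ≤ 1) (hb : 1 ≤ b)
    (h : RankCond P β l) (γ : ∀ i, topPow R (P.X i) ≃ₗ[R] R) (hE : ExactOffOne P p)
    (h0 : Module.Free (Localization p.asIdeal.primeCompl) (LinearMap.range (dLoc P p 0 1))) :
    ∃ (ζ : Module.Basis (Fin (β 1 p + l p)) (Localization p.asIdeal.primeCompl)
        (LocalizedModule p.asIdeal.primeCompl (P.cycles 1)))
      (c : Module.Basis (Fin (β 1 p)) (Localization p.asIdeal.primeCompl)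
        (LinearMap.ker (πLoc f p)))
      (κ : (Localization p.asIdeal.primeCompl)ˣ),
      (∀ t : Admissible a b P β l, algebraMap R (Localization p.asIdeal.primeCompl) (t.num γ)
        = algebraMap R (Localization p.asIdeal.primeCompl) (t.den γ) * (κ *
          detOn ζ (ιMulti _ _ (fun i => (c i : LocalizedModule p.asIdeal.primeCompl (P.cycles 1)))
            * locMap p.asIdeal.primeCompl (P.cycles 1) (t.Y 1)))) ∧
      ∀ y ∈ extPow R l (P.cycles 1), ∃ t : Admissible a b P β l, t.Y 1 = y ∧
        t.den γ ∉ p.asIdeal := by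
  have hF : ∀ i j : ℤ, i + 1 = j →
      Module.Free (Localization p.asIdeal.primeCompl) (LinearMap.range (dLoc P p i j)) :=
    fun i j hij => free_range_dLoc hP hE h0 hij
  have hlc := h.isLocallyConstant hP ha hb
  have hB : ∀ i j : ℤ, i + 1 = j → Nonempty (Module.Basis (Fin (β j p))
      (Localization p.asIdeal.primeCompl) (LinearMap.range (dLoc P p i j))) := by
    intro i j hij
    have := hF i j hij
    have := finite_loc (p := p) hP i
    exact exists_basis_fin _ _ (h.finrank_range hP ha hb hE hF hij)
  let B := fun i j hij => (hB i j hij).some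
  obtain ⟨_, _⟩ := free_cycles hP (hF 1 2 rfl)
  obtain ⟨ζ⟩ := exists_basis_fin _ _ (h.finrank_cycles hP ha hb hE hF)
  let c : Module.Basis (Fin (β 1 p)) (Localization p.asIdeal.primeCompl)
    (LinearMap.ker (πLoc f p)) := (B 0 1 rfl).map (kerEquivRange f).symm
  have hc : ∀ j, iLoc P p (c j) = B 0 1 rfl j := fun j => by
    rw [← kerEquivRange_apply]
    simp [c]
  -- `C i j x` is the coordinate of `d x` as a top form of the coboundaries of degree `j`; it is the
  -- factor shared by `ω i` and `ω j`.
  let C : (i j : ℤ) → i + 1 = j → ExteriorAlgebra R (P.X i) →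
      Localization p.asIdeal.primeCompl := fun i j hij x =>
    detOn (B i j hij) (map (dLoc P p i j).rangeRestrict (locMap p.asIdeal.primeCompl (P.X i) x))
  have hC1 : ∀ i j hij, i < a ∨ b ≤ i → C i j hij 1 = 1 := by
    intro i j hij hi
    simp only [C, map_one]
    exact detOn_one (h.eq_zero hP ha hb p (by omega)) _
  have hCeq : ∀ (t : Admissible a b P β l) i i' j j' hij hij', i = i' →
      C i j hij (t.X i) = C i' j' hij' (t.X i') := by
    intro t i i' j j' hij hij' hi
    subst hi
    subst hij
    subst hij'
    rfl
  have hX : ∀ (t : Admissible a b P β l) i j, i + 1 = j →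
      locMap p.asIdeal.primeCompl (P.X i) (t.X i) ∈ ⋀[Localization p.asIdeal.primeCompl]^(β j p)
        (LocalizedModule p.asIdeal.primeCompl (P.X i)) := by
    intro t i j hij
    subst hij
    exact locMap_mem_of_mem_extPow p (hlc (i + 1)) (t.X_mem i)
  let δ : Admissible a b P β l → Localization p.asIdeal.primeCompl := fun t =>
    detOn ζ (ιMulti _ _ (fun i => (c i : LocalizedModule p.asIdeal.primeCompl (P.cycles 1)))
            * locMap p.asIdeal.primeCompl (P.cycles 1) (t.Y 1))
  -- Up to a unit, each `ω i` has as coordinate the product of its incoming and its outgoing factor;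
  -- degree 1 carries in addition the determinant `δ` of coboundaries and `Y`.
  have hu : ∀ i, ∃ u : (Localization p.asIdeal.primeCompl)ˣ, ∀ t : Admissible a b P β l,
      algebraMap R (Localization p.asIdeal.primeCompl) (γ i (t.ω i)) * u
        = C (i - 1) (i - 1 + 1) rfl (t.X (i - 1)) * C i (i + 1) rfl (t.X i)
          * if i = 1 then δ t else 1 := by
    intro i
    have := hP.finite i
    have := hP.projective i
    by_cases hi : i = 1
    · subst hi
      obtain ⟨E, hEt⟩ := detOn_map_mul_mul iLoc_injective exact_iLoc ζ rfl (B 0 1 rfl) hc (B 1 2 rfl)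
      obtain ⟨u, hu⟩ := detOn_locMap_topPow (γ 1) p (by
        have := h 1 p
        rw [if_pos rfl, one_add_one_eq_two] at this
        rw [this]; ring) E
      refine ⟨u, fun t => ?_⟩
      rw [hu, if_pos rfl, t.ω_eq' (zero_add 1), map_mul (locMap _ _), map_mul (locMap _ _), locMap_map, locMap_map,
        hCeq t 1 1 (1 + 1) 2 rfl rfl rfl,
        hCeq t (1 - 1) 0 (1 - 1 + 1) 1 rfl rfl (sub_self 1)]
      exact hEt _ (hX t 0 1 rfl) _
        (locMap_mem_of_mem_extPow p (h.isLocallyConstant_degree hP ha hb) t.Y_mem) _ (hX t 1 2 rfl)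
    · obtain ⟨E, hEt⟩ := detOn_map_mul (hE (i - 1) i (i + 1) (sub_add_cancel i 1) rfl hi)
        (B (i - 1) i (sub_add_cancel i 1)) (B i (i + 1) rfl)
      obtain ⟨u, hu⟩ := detOn_locMap_topPow (γ i) p (by
        have := h i p
        rwa [if_neg hi, add_zero] at this) E
      refine ⟨u, fun t => ?_⟩
      rw [hu, if_neg hi, t.ω_eq i, t.Y_eq_one i hi, map_one, mul_one, map_mul (locMap _ _), locMap_map,
        hCeq t (i - 1) (i - 1) (i - 1 + 1) i rfl (sub_add_cancel i 1) rfl, mul_one]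
      exact hEt _ (hX t (i - 1) i (sub_add_cancel i 1)) _ (hX t i (i + 1) rfl)
  choose u hu using hu
  have hCt : ∀ t : Admissible a b P β l, ∀ i, i < a ∨ b ≤ i → C i (i + 1) rfl (t.X i) = 1 := by
    intro t i hi
    rw [t.X_eq_one i hi]
    exact hC1 i (i + 1) rfl hi
  -- Even degrees pick up every `C i` once, as outgoing factor for even `i` and as incoming factor
  -- for odd `i`. The odd degrees do the same and have the extra `δ`, so the ratio is `δ` up to a
  -- unit.
  have heven : ∀ t : Admissible a b P β l,
      algebraMap R (Localization p.asIdeal.primeCompl) (t.den γ)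
        * ((∏ i ∈ evenDeg a b, u i : (Localization p.asIdeal.primeCompl)ˣ) :
          Localization p.asIdeal.primeCompl)
      = (∏ i ∈ oddDeg a b, C i (i + 1) rfl (t.X i)) * ∏ i ∈ evenDeg a b, C i (i + 1) rfl (t.X i) := by
    intro t
    rw [Admissible.den, map_prod, Units.coe_prod, ← Finset.prod_mul_distrib,
      ← prod_evenDeg_sub_one (hCt t), ← Finset.prod_mul_distrib]
    refine Finset.prod_congr rfl fun i hi => ?_
    rw [hu, if_neg, mul_one]
    rintro rfl
    rw [Finset.mem_filter] at hi
    exact absurd hi.2 (by decide)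
  have hodd : ∀ t : Admissible a b P β l,
      algebraMap R (Localization p.asIdeal.primeCompl) (t.num γ)
        * ((∏ i ∈ oddDeg a b, u i : (Localization p.asIdeal.primeCompl)ˣ) :
          Localization p.asIdeal.primeCompl)
      = ((∏ i ∈ evenDeg a b, C i (i + 1) rfl (t.X i)) * ∏ i ∈ oddDeg a b, C i (i + 1) rfl (t.X i))
        * δ t := by
    intro t
    have h1 : ∏ i ∈ oddDeg a b, (if i = 1 then δ t else 1) = δ t := by
      rw [Finset.prod_ite_eq' , if_pos]
      rw [Finset.mem_filter, Finset.mem_Icc]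
      exact ⟨⟨ha, hb⟩, odd_one⟩
    rw [Admissible.num, map_prod, Units.coe_prod, ← Finset.prod_mul_distrib,
      ← prod_oddDeg_sub_one (hCt t), ← Finset.prod_mul_distrib]
    conv_rhs => rw [← h1, ← Finset.prod_mul_distrib]
    exact Finset.prod_congr rfl fun i hi => hu i t
  refine ⟨ζ, c, (∏ i ∈ evenDeg a b, u i) * (∏ i ∈ oddDeg a b, u i)⁻¹, fun t => ?_, fun y hy => ?_⟩
  · rw [← Units.mul_left_inj (∏ i ∈ oddDeg a b, u i), hodd, mul_comm (∏ i ∈ evenDeg a b, _),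
      ← heven, Units.val_mul]
    linear_combination (-(algebraMap R (Localization p.asIdeal.primeCompl) (t.den γ)) *
      ((∏ i ∈ evenDeg a b, u i : (Localization p.asIdeal.primeCompl)ˣ) :
          Localization p.asIdeal.primeCompl) * δ t) * (∏ i ∈ oddDeg a b, u i).inv_mul
  -- Locally `X i` is a unit multiple of the wedge of lifts of a basis of the coboundaries, which
  -- makes every `C i` a unit. Outside `[a, b)` the value 1 is prescribed and has coordinate 1.
  · have hx : ∀ i, ∃ x ∈ extPow R (β (i + 1)) (P.X i), (i < a ∨ b ≤ i → x = 1) ∧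
        IsUnit (C i (i + 1) rfl x) := by
      intro i
      by_cases hi : i < a ∨ b ≤ i
      · refine ⟨1, one_mem_extPow fun q => h.eq_zero hP ha hb q (by omega), fun _ => rfl, ?_⟩
        rw [hC1 i _ rfl hi]
        exact isUnit_one
      · choose w hw using fun j => (B i (i + 1) rfl j).2
        obtain ⟨t, ht, x, hx, hxt⟩ := exists_smul_eq_locMap_extPow p (hlc (i + 1))
          (y := ιMulti _ _ w) (ιMulti_range _ _ ⟨_, rfl⟩)
        refine ⟨x, hx, fun h' => absurd h' hi, ?_⟩
        have h1 : (fun j => (dLoc P p i (i + 1)).rangeRestrict (w j)) = B i (i + 1) rfl := by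
          funext j
          exact Subtype.ext (hw j)
        simp only [C]
        rw [hxt, map_smul, LinearMap.map_smul, map_apply_ιMulti, detOn_ιMulti]
        change IsUnit (_ • (B i (i + 1) rfl).det
          (fun j => (dLoc P p i (i + 1)).rangeRestrict (w j)))
        rw [h1, Module.Basis.det_self, smul_eq_mul, mul_one]
        exact isUnit_algebraMap_of_notMem ht
    choose X hX1 hX2 hX3 using hx
    obtain ⟨t, rfl, rfl⟩ := Admissible.exists_of_mem hP ha hb h hX1 hX2 hy
    refine ⟨t, rfl, notMem_of_isUnit_algebraMap (isUnit_of_mul_isUnit_left (y := ((∏ i ∈ evenDeg a b,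
      u i : (Localization p.asIdeal.primeCompl)ˣ) : Localization p.asIdeal.primeCompl)) ?_)⟩
    rw [heven]
    exact (IsUnit.prod_iff.2 fun i _ => hX3 i).mul (IsUnit.prod_iff.2 fun i _ => hX3 i)

end

end PerfDet

/-! ### Passage to the quotient by a free submodule. -/

namespace ExteriorAlgebra

variable {A : Type*} [CommRing A] {Z H : Type*} [AddCommGroup Z] [Module A Z] [AddCommGroup H]
  [Module A H]

theorem detOn_map_equiv {n : ℕ} (h : Module.Basis (Fin n) A Z) (e : Z ≃ₗ[A] H)
    {x : ExteriorAlgebra A Z} (hx : x ∈ ⋀[A]^n Z) :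
    detOn (h.map e) (map e.toLinearMap x) = detOn h x := by
  have h1 : (fun i => e (h i)) = h.map e := rfl
  conv_lhs => rw [eq_detOn_smul h hx, map_smul, map_apply_ιMulti, LinearMap.map_smul, detOn_ιMulti]
  change _ • (h.map e).det (fun i => e (h i)) = _
  rw [h1, Module.Basis.det_self, smul_eq_mul, mul_one]

theorem ιMulti_ker_mul_ι {n : ℕ} {π : Z →ₗ[A] H} (c : Module.Basis (Fin n) A (LinearMap.ker π))
    {z : Z} (hz : z ∈ LinearMap.ker π) : ιMulti A n (fun i => (c i : Z)) * ι A z = 0 := by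
  have h1 := mul_ι_eq_zero_of_top c (x := ιMulti A n c) (ιMulti_range _ _ ⟨_, rfl⟩) ⟨z, hz⟩
  have h2 := congrArg (map (LinearMap.ker π).subtype) h1
  rw [map_mul, map_apply_ι, map_zero, map_apply_ιMulti] at h2
  exact h2

/-- If the quotient is free, the determinant of a basis of the kernel and of a form is the
determinant of the image of the form in the quotient. -/
theorem exists_detOn_ιMulti_ker_mul {n l : ℕ} {π : Z →ₗ[A] H} (hπ : Function.Surjective π)
    (ζ : Module.Basis (Fin (n + l)) A Z) (c : Module.Basis (Fin n) A (LinearMap.ker π))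
    (h : Module.Basis (Fin l) A H) :
    ∃ u : Aˣ, ∀ x ∈ ⋀[A]^l Z,
      detOn ζ (ιMulti A n (fun i => (c i : Z)) * x) = u * detOn h (map π x) := by
  let e : H ≃ₗ[A] LinearMap.range π :=
    (LinearEquiv.ofTop _ (LinearMap.range_eq_top.2 hπ)).symm
  have he : e.toLinearMap ∘ₗ π = π.rangeRestrict := by
    ext z; rfl
  choose w hw using fun j => ((h.map e) j).2
  have hex : Function.Exact (LinearMap.ker π).subtype π := by
    intro y; simp
  obtain ⟨E, hE⟩ := Module.Basis.exists_append (Submodule.subtype_injective _) hex c (h.map e) hw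
  refine ⟨(Module.Basis.isUnit_det ζ E).unit, fun x hx => ?_⟩
  rw [mul_eq_detOn_smul (h.map e) hw (fun z hz => ιMulti_ker_mul_ι c hz) hx, ιMulti_mul_ιMulti,
    LinearMap.map_smul, detOn_ιMulti, ← he, ← map_comp_map, AlgHom.comp_apply,
    detOn_map_equiv h e (map_mem π hx), smul_eq_mul, mul_comm]
  congr 1
  change ζ.det _ = ζ.det E
  rw [hE]
  rfl

end ExteriorAlgebra

/-! ### The scalar form of the natural map: construction by gluing. -/

namespace PerfDet

open ExteriorAlgebra

variable {R : Type u} [CommRing R] {P K : CochainComplex (ModuleCat.{u} R) ℤ} {p : PrimeSpectrum R}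
  {a b : ℤ} (f : P ⟶ K) {β : ℤ → PrimeSpectrum R → ℕ} {l : PrimeSpectrum R → ℕ}

theorem height_maximalIdeal (p : PrimeSpectrum R) :
    (IsLocalRing.maximalIdeal (Localization p.asIdeal.primeCompl)).height = p.asIdeal.height := by
  rw [← WithBot.coe_inj, IsLocalRing.maximalIdeal_height_eq_ringKrullDim]
  exact IsLocalization.AtPrime.ringKrullDim_eq_height p.asIdeal (Localization.AtPrime p.asIdeal)

/-- In dimension zero the inclusion of the free coboundaries into the free cocycles splits. -/
theorem free_homology_of_height_eq_zero [QuasiIso f] [IsNoetherianRing R]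
    (hP : IsStrictlyPerfect a b P) (hE : ExactOffOne P p) (hp : p.asIdeal.height = 0) :
    Module.Free (Localization p.asIdeal.primeCompl)
      (LocalizedModule p.asIdeal.primeCompl (K.homology 1)) := by
  have : IsNoetherianRing (Localization p.asIdeal.primeCompl) :=
    inferInstanceAs (IsNoetherianRing (Localization.AtPrime p.asIdeal))
  have h01 := free_range_dLoc_zero_one hP hE (by rw [hp]; exact zero_le_one)
  obtain ⟨_, _⟩ := free_cycles hP (free_range_dLoc hP hE h01 (i := 1) (j := 2) rfl)
  have := Module.Free.of_equiv (kerEquivRange f (p := p)).symm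
  obtain ⟨r, hr⟩ := IsLocalRing.exists_retraction_of_height_eq_zero
    ((height_maximalIdeal p).trans hp) (LinearMap.ker (πLoc f p)).subtype_injective
  have hex : Function.Exact (LinearMap.ker (πLoc f p)).subtype (πLoc f p) := by
    intro y; simp
  have := IsLocalRing.free_range_of_retraction hex r hr
  exact Module.Free.of_equiv (LinearEquiv.ofTop _ (LinearMap.range_eq_top.2 (πLoc_surjective f)))

theorem finrank_homology [QuasiIso f] (hP : IsStrictlyPerfect a b P) (ha : a ≤ 1) (hb : 1 ≤ b)
    (h : RankCond P β l) (hE : ExactOffOne P p)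
    (h0 : Module.Free (Localization p.asIdeal.primeCompl) (LinearMap.range (dLoc P p 0 1)))
    (hH : Module.Free (Localization p.asIdeal.primeCompl)
      (LocalizedModule p.asIdeal.primeCompl (K.homology 1))) :
    Nonempty (Module.Basis (Fin (l p)) (Localization p.asIdeal.primeCompl)
      (LocalizedModule p.asIdeal.primeCompl (K.homology 1))) := by
  have hF : ∀ i j : ℤ, i + 1 = j →
      Module.Free (Localization p.asIdeal.primeCompl) (LinearMap.range (dLoc P p i j)) :=
    fun i j hij => free_range_dLoc hP hE h0 hij
  obtain ⟨_, _⟩ := free_cycles hP (hF 1 2 rfl)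
  have := finite_loc (p := p) hP 0
  have := Module.Free.of_equiv (kerEquivRange f (p := p)).symm
  have := Module.Finite.equiv (kerEquivRange f (p := p)).symm
  have : Module.Finite (Localization p.asIdeal.primeCompl)
      (LocalizedModule p.asIdeal.primeCompl (K.homology 1)) :=
    Module.Finite.of_surjective _ (πLoc_surjective f)
  let e := (LinearEquiv.ofTop _ (LinearMap.range_eq_top.2 (πLoc_surjective f (p := p))))
  have := Module.Free.of_equiv e.symm
  have hex : Function.Exact (LinearMap.ker (πLoc f p)).subtype (πLoc f p) := by
    intro y; simp
  have h1 := finrank_eq_add (Submodule.subtype_injective _) hex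
  rw [h.finrank_cycles hP ha hb hE hF, LinearEquiv.finrank_eq (kerEquivRange f (p := p)),
    h.finrank_range hP ha hb hE hF (zero_add 1), LinearEquiv.finrank_eq e] at h1
  exact exists_basis_fin _ _ (by omega)

/-- The class of an element of the exterior power of the cocycles. -/
noncomputable def extClass (l : PrimeSpectrum R → ℕ) (y : extPow R l (P.cycles 1)) :
    extPow R l (K.homology 1) :=
  ⟨map (cocycleClass f 1) y, map_mem_extPow _ y.2⟩

theorem locMap_extClass (y : extPow R l (P.cycles 1)) :
    locMap p.asIdeal.primeCompl (K.homology 1) (extClass f l y : ExteriorAlgebra R _)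
      = map (πLoc f p) (locMap p.asIdeal.primeCompl (P.cycles 1) (y : ExteriorAlgebra R _)) :=
  locMap_map _ _ _

theorem exists_extClass_eq [QuasiIso f] (hl : IsLocallyConstant l) (z : extPow R l (K.homology 1)) :
    ∃ y, extClass f l y = z := by
  obtain ⟨y, hy, h⟩ := exists_extPow_map_eq hl (cocycleClass_surjective f 1) z.2
  exact ⟨⟨y, hy⟩, Subtype.ext h⟩

/-- The class of the test datum. -/
noncomputable def Admissible.cls (t : Admissible a b P β l) : extPow R l (K.homology 1) :=
  extClass f l ⟨t.Y 1, t.Y_mem⟩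

/-- Where the cohomology is free, the ratio that defines the natural map is, up to a unit, the
coordinate of the class. -/
theorem exists_local_formula_of_free [QuasiIso f] (hP : IsStrictlyPerfect a b P) (ha : a ≤ 1)
    (hb : 1 ≤ b) (h : RankCond P β l) (γ : ∀ i, topPow R (P.X i) ≃ₗ[R] R) (hE : ExactOffOne P p)
    (h0 : Module.Free (Localization p.asIdeal.primeCompl) (LinearMap.range (dLoc P p 0 1)))
    (hB : Module.Basis (Fin (l p)) (Localization p.asIdeal.primeCompl)
      (LocalizedModule p.asIdeal.primeCompl (K.homology 1))) :
    ∃ κ : (Localization p.asIdeal.primeCompl)ˣ, ∀ t : Admissible a b P β l,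
      algebraMap R (Localization p.asIdeal.primeCompl) (t.num γ)
        = algebraMap R (Localization p.asIdeal.primeCompl) (t.den γ) * (κ *
          detOn hB (locMap p.asIdeal.primeCompl (K.homology 1)
            (t.cls f : ExteriorAlgebra R (K.homology 1)))) := by
  obtain ⟨ζ, c, κ, h1, -⟩ := exists_local_formula f hP ha hb h γ hE h0
  obtain ⟨u, hu⟩ := exists_detOn_ιMulti_ker_mul (πLoc_surjective f) ζ c hB
  refine ⟨κ * u, fun t => ?_⟩
  rw [h1, hu _ (locMap_mem_of_mem_extPow p (h.isLocallyConstant_degree hP ha hb) t.Y_mem),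
    Admissible.cls, locMap_extClass, Units.val_mul]
  ring

/-- The scalar form of the natural map. -/
def IsScalar (a b : ℤ) (β : ℤ → PrimeSpectrum R → ℕ) (γ : ∀ i, topPow R (P.X i) ≃ₗ[R] R)
    (ψ : extPow R l (K.homology 1) → R) : Prop :=
  ∀ t : Admissible a b P β l, t.num γ = ψ (t.cls f) * t.den γ

variable {f}

/-- For each `y` there are test data whose denominator is invertible at `p`, so it can be cancelled
from the defining relation. -/
theorem IsScalar.local_formula [QuasiIso f] {γ : ∀ i, topPow R (P.X i) ≃ₗ[R] R}
    {ψ : extPow R l (K.homology 1) → R} (hψ : IsScalar f a b β γ ψ) (hP : IsStrictlyPerfect a b P)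
    (ha : a ≤ 1) (hb : 1 ≤ b) (h : RankCond P β l) (hE : ExactOffOne P p)
    (h0 : Module.Free (Localization p.asIdeal.primeCompl) (LinearMap.range (dLoc P p 0 1))) :
    ∃ (ζ : Module.Basis (Fin (β 1 p + l p)) (Localization p.asIdeal.primeCompl)
        (LocalizedModule p.asIdeal.primeCompl (P.cycles 1)))
      (c : Module.Basis (Fin (β 1 p)) (Localization p.asIdeal.primeCompl)
        (LinearMap.ker (πLoc f p)))
      (κ : (Localization p.asIdeal.primeCompl)ˣ),
      ∀ y : extPow R l (P.cycles 1),
        algebraMap R (Localization p.asIdeal.primeCompl) (ψ (extClass f l y)) = κ *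
          detOn ζ (ιMulti _ _ (fun i => (c i : LocalizedModule p.asIdeal.primeCompl (P.cycles 1)))
            * locMap p.asIdeal.primeCompl (P.cycles 1) (y : ExteriorAlgebra R _)) := by
  obtain ⟨ζ, c, κ, h1, h2⟩ := exists_local_formula f hP ha hb h γ hE h0
  refine ⟨ζ, c, κ, fun y => ?_⟩
  obtain ⟨t, ht, hd⟩ := h2 y y.2
  have h3 := h1 t
  have h4 : t.cls f = extClass f l y := congrArg (extClass f l) (Subtype.ext ht)
  rw [hψ t, h4, map_mul, ht, mul_comm] at h3
  exact (isUnit_algebraMap_of_notMem hd).mul_left_cancel h3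

theorem IsScalar.local_formula_of_free [QuasiIso f] {γ : ∀ i, topPow R (P.X i) ≃ₗ[R] R}
    {ψ : extPow R l (K.homology 1) → R} (hψ : IsScalar f a b β γ ψ) (hP : IsStrictlyPerfect a b P)
    (ha : a ≤ 1) (hb : 1 ≤ b) (h : RankCond P β l) (hE : ExactOffOne P p)
    (h0 : Module.Free (Localization p.asIdeal.primeCompl) (LinearMap.range (dLoc P p 0 1)))
    (hB : Module.Basis (Fin (l p)) (Localization p.asIdeal.primeCompl)
      (LocalizedModule p.asIdeal.primeCompl (K.homology 1))) :
    ∃ κ : (Localization p.asIdeal.primeCompl)ˣ, ∀ z : extPow R l (K.homology 1),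
      algebraMap R (Localization p.asIdeal.primeCompl) (ψ z) = κ *
          detOn hB (locMap p.asIdeal.primeCompl (K.homology 1) (z : ExteriorAlgebra R _)) := by
  have hl := h.isLocallyConstant_degree hP ha hb
  obtain ⟨ζ, c, κ, h1⟩ := hψ.local_formula hP ha hb h hE h0
  obtain ⟨u, hu⟩ := exists_detOn_ιMulti_ker_mul (πLoc_surjective f) ζ c hB
  refine ⟨κ * u, fun z => ?_⟩
  obtain ⟨y, rfl⟩ := exists_extClass_eq f hl z
  rw [h1, hu _ (locMap_mem_of_mem_extPow p hl y.2), locMap_extClass, Units.val_mul]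
  ring

variable (f)

/-- The value at `z` is the common ratio over all test data of class `z`. The ratios agree at
minimal primes, where the local formula depends on the class alone, and at each prime of height at
most one some denominator is a unit; `S₂` turns this into a ring element. Linearity can be checked
at minimal primes, where `ψ` is a unit times a coordinate. -/
theorem exists_isScalar [QuasiIso f] [IsNoetherianRing R] (hR : SerreSTwo R)
    (hP : IsStrictlyPerfect a b P) (ha : a ≤ 1) (hb : 1 ≤ b) (h : RankCond P β l)
    (γ : ∀ i, topPow R (P.X i) ≃ₗ[R] R)
    (hE : ∀ p : PrimeSpectrum R, p.asIdeal.height ≤ 1 → ExactOffOne P p) :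
    ∃ ψ : extPow R l (K.homology 1) →ₗ[R] R, IsScalar f a b β γ ψ := by
  have hl := h.isLocallyConstant_degree hP ha hb
  have h01 : ∀ p : PrimeSpectrum R, p.asIdeal.height ≤ 1 → Module.Free
      (Localization p.asIdeal.primeCompl) (LinearMap.range (dLoc P p 0 1)) := fun p hp =>
    free_range_dLoc_zero_one hP (hE p hp) hp
  have hle : ∀ p : PrimeSpectrum R, p.asIdeal.height = 0 → p.asIdeal.height ≤ 1 :=
    fun p hp => by rw [hp]; exact zero_le_one
  have hbas : ∀ p : PrimeSpectrum R, p.asIdeal.height = 0 → Nonempty _ := fun p hp =>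
    finrank_homology f hP ha hb h (hE p (hle p hp)) (h01 p (hle p hp))
      (free_homology_of_height_eq_zero f hP (hE p (hle p hp)) hp)
  have heq : ∀ x y : R, (∀ p : PrimeSpectrum R, p.asIdeal.height = 0 →
      algebraMap R (Localization p.asIdeal.primeCompl) x = algebraMap R _ y) → x = y := by
    intro x y hxy
    refine hR.eq_of_minimal fun p hp hp0 => ?_
    obtain ⟨t, ht⟩ := IsLocalization.exists_of_eq (M := p.primeCompl)
      (S := Localization p.primeCompl) (hxy ⟨p, hp⟩ hp0)
    exact ⟨t, t.2, ht⟩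
  have hex : ∀ z : extPow R l (K.homology 1), ∃ r : R, ∀ t : Admissible a b P β l,
      t.cls f = z → t.num γ = r * t.den γ := by
    intro z
    -- Well-definedness: cross multiplication avoids dividing by denominators that may be zero
    -- divisors.
    have hcross : ∀ t t' : {t : Admissible a b P β l // t.cls f = z},
        t.1.num γ * t'.1.den γ = t'.1.num γ * t.1.den γ := by
      intro t t'
      refine heq _ _ fun p hp => ?_
      obtain ⟨hB⟩ := hbas p hp
      obtain ⟨κ, hκ⟩ := exists_local_formula_of_free f hP ha hb h γ (hE p (hle p hp))
        (h01 p (hle p hp)) hB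
      rw [map_mul, map_mul, hκ, hκ, t.2, t'.2]
      ring
    obtain ⟨r, hr⟩ := hR.exists_eq_mul _ _ hcross fun p hp hp1 => by
      obtain ⟨ζ, c, κ, -, h2⟩ := exists_local_formula f hP ha hb h γ (hE ⟨p, hp⟩ hp1)
        (h01 ⟨p, hp⟩ hp1)
      obtain ⟨y, rfl⟩ := exists_extClass_eq f hl z
      obtain ⟨t, ht, hd⟩ := h2 y y.2
      exact ⟨⟨t, congrArg (extClass f l) (Subtype.ext ht)⟩, hd⟩
    exact ⟨r, fun t ht => hr ⟨t, ht⟩⟩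
  choose ψ hψ using hex
  have hs : IsScalar f a b β γ ψ := fun t => hψ _ t rfl
  have hadd : ∀ z z', ψ (z + z') = ψ z + ψ z' := by
    intro z z'
    refine heq _ _ fun p hp => ?_
    obtain ⟨hB⟩ := hbas p hp
    obtain ⟨κ, hκ⟩ := hs.local_formula_of_free hP ha hb h (hE p (hle p hp)) (h01 p (hle p hp)) hB
    rw [RingHom.map_add, hκ (z + z'), hκ z, hκ z', Submodule.coe_add, map_add (locMap _ _),
      LinearMap.map_add, mul_add]
  have hsmul : ∀ (r : R) z, ψ (r • z) = r * ψ z := by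
    intro r z
    refine heq _ _ fun p hp => ?_
    obtain ⟨hB⟩ := hbas p hp
    obtain ⟨κ, hκ⟩ := hs.local_formula_of_free hP ha hb h (hE p (hle p hp)) (h01 p (hle p hp)) hB
    rw [RingHom.map_mul, hκ (r • z), hκ z, Submodule.coe_smul, ← algebraMap_smul_locMap,
      LinearMap.map_smul, smul_eq_mul]
    ring
  exact ⟨⟨⟨ψ, hadd⟩, hsmul⟩, hs⟩

end PerfDet

/-! ### Trivialization of the determinant, uniqueness and kernel. -/

namespace PerfDet

open ExteriorAlgebra

variable {R : Type u} [CommRing R] {P K : CochainComplex (ModuleCat.{u} R) ℤ} {p : PrimeSpectrum R}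
  {a b : ℤ} {f : P ⟶ K} {β : ℤ → PrimeSpectrum R → ℕ} {l : PrimeSpectrum R → ℕ}
  {γ : ∀ i, topPow R (P.X i) ≃ₗ[R] R}

/-- The functionals on a module with a generator are given by their value at the generator. -/
noncomputable def dualTopEquiv {M : Type*} [AddCommMonoid M] [Module R M] (γ : M ≃ₗ[R] R) :
    Module.Dual R M ≃ₗ[R] R :=
  (γ.symm.dualMap).trans (LinearMap.ringLmapEquivSelf R R R)

/-- The trivialization of the determinant of a complex by trivializations of the determinants of
its terms. -/
noncomputable def detEquiv (a b : ℤ) (γ : ∀ i, topPow R (P.X i) ≃ₗ[R] R) : Det a b P ≃ₗ[R] R :=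
  (TensorProduct.congr
    ((PiTensorProduct.congr fun i : evenDeg a b => γ i).trans
      (PiTensorProduct.constantBaseRingEquiv _ R).toLinearEquiv)
    ((PiTensorProduct.congr fun i : oddDeg a b => dualTopEquiv (γ i)).trans
      (PiTensorProduct.constantBaseRingEquiv _ R).toLinearEquiv)).trans (TensorProduct.lid R R)

theorem detEquiv_tmul (ω : (i : ℤ) → topPow R (P.X i))
    (φ : (i : ℤ) → Module.Dual R (topPow R (P.X i))) :
    detEquiv a b γ ((PiTensorProduct.tprod R fun i : evenDeg a b => ω i) ⊗ₜ[R]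
        (PiTensorProduct.tprod R fun i : oddDeg a b => φ i))
      = (∏ i ∈ evenDeg a b, γ i (ω i)) * ∏ i ∈ oddDeg a b, φ i ((γ i).symm 1) := by
  have h1 : ∀ (g : (i : evenDeg a b) → topPow R (P.X i)),
      (PiTensorProduct.congr fun i : evenDeg a b => γ i).trans
      (PiTensorProduct.constantBaseRingEquiv _ R).toLinearEquiv (PiTensorProduct.tprod R g)
        = ∏ i : evenDeg a b, γ i (g i) := fun g => by
    rw [LinearEquiv.trans_apply, PiTensorProduct.congr_tprod]
    exact PiTensorProduct.constantBaseRingEquiv_tprod _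
  have h2 : ∀ (g : (i : oddDeg a b) → Module.Dual R (topPow R (P.X i))),
      (PiTensorProduct.congr fun i : oddDeg a b => dualTopEquiv (γ i)).trans
      (PiTensorProduct.constantBaseRingEquiv _ R).toLinearEquiv (PiTensorProduct.tprod R g)
        = ∏ i : oddDeg a b, dualTopEquiv (γ i) (g i) := fun g => by
    rw [LinearEquiv.trans_apply, PiTensorProduct.congr_tprod]
    exact PiTensorProduct.constantBaseRingEquiv_tprod _
  rw [detEquiv, LinearEquiv.trans_apply, TensorProduct.congr_tmul, h1, h2, TensorProduct.lid_tmul,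
    smul_eq_mul, ← Finset.prod_coe_sort (evenDeg a b), ← Finset.prod_coe_sort (oddDeg a b)]
  rfl

/-- The trivialization of the inverse determinant. -/
noncomputable def detInvEquiv (a b : ℤ) (γ : ∀ i, topPow R (P.X i) ≃ₗ[R] R) :
    DetInv a b P ≃ₗ[R] R :=
  dualTopEquiv (detEquiv a b γ)

theorem detInvEquiv_mul (F : DetInv a b P) (x : Det a b P) :
    F x = detInvEquiv a b γ F * detEquiv a b γ x := by
  have h1 : x = detEquiv a b γ x • (detEquiv a b γ).symm 1 := by
    rw [← map_smul, smul_eq_mul, mul_one, LinearEquiv.symm_apply_apply]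
  conv_lhs => rw [h1, map_smul, smul_eq_mul, mul_comm]
  rfl

theorem topPow_dual_apply {M : Type*} [AddCommGroup M] [Module R M] (γ : M ≃ₗ[R] R)
    (φ : Module.Dual R M) (ω : M) : φ ω = γ ω * φ (γ.symm 1) := by
  have h1 : ω = γ ω • γ.symm 1 := by
    rw [← map_smul, smul_eq_mul, mul_one, LinearEquiv.symm_apply_apply]
  conv_lhs => rw [h1, map_smul, smul_eq_mul]

theorem RankCond.unique (hP : IsStrictlyPerfect a b P) (ha : a ≤ 1) (hb : 1 ≤ b)
    {β β' : ℤ → PrimeSpectrum R → ℕ} (h : RankCond P β l) (h' : RankCond P β' l) : β = β' := by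
  funext i p
  refine congrFun (rank_unique (β := fun i => β i p) (ρ := fun i => β' i p) (a := a) (b := b) ?_
    (fun i hi => h.eq_zero hP ha hb p hi) (fun i hi => h'.eq_zero hP ha hb p hi)) i
  intro i hi
  have h1 := h i p
  rw [h' i p, if_neg hi] at h1
  omega

/-- Every functional on `det P^i` is a multiple of the trivialization `γ i`, and the characterizing
formula is linear in each `φ i`. Testing with `φ i = γ i` is therefore enough, and that case is the
scalar relation. -/
theorem isNaturalMap_iff (hP : IsStrictlyPerfect a b P) (ha : a ≤ 1) (hb : 1 ≤ b)
    (h : RankCond P β l) (γ : ∀ i, topPow R (P.X i) ≃ₗ[R] R)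
    (Ψ : extPow R l (K.homology 1) →ₗ[R] DetInv a b P) :
    IsNaturalMap a b f l Ψ ↔ IsScalar f a b β γ fun z => detInvEquiv a b γ (Ψ z) := by
  constructor
  · intro hΨ t
    have h1 := hΨ β h t.X t.X_mem t.X_eq_one t.Y t.Y_mem t.Y_eq_one (t.cls f) rfl t.ω t.ω_eq
      (fun i => (γ i).toLinearMap)
    have h2 := detEquiv_tmul (γ := γ) (a := a) (b := b) t.ω (fun i => (γ i).toLinearMap)
    simp only [LinearEquiv.coe_coe, LinearEquiv.apply_symm_apply, Finset.prod_const_one,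
      mul_one] at h2
    rw [detInvEquiv_mul (γ := γ)] at h1
    exact h1.symm.trans (congrArg (_ * ·) h2)
  · intro hψ β' h' X hX hX1 Y hY hY1 z hz ω hω φ
    obtain rfl := h.unique hP ha hb h'
    let t : Admissible a b P β l := ⟨X, hX, hX1, Y, hY, hY1, ω, hω⟩
    have h1 : t.cls f = z := Subtype.ext hz.symm
    have h2 : _ = _ := hψ t
    rw [h1] at h2
    rw [detInvEquiv_mul (γ := γ), detEquiv_tmul, ← mul_assoc]
    have h3 : ∏ i ∈ oddDeg a b, φ i (ω i)
        = (∏ i ∈ oddDeg a b, γ i (ω i)) * ∏ i ∈ oddDeg a b, φ i ((γ i).symm 1) := by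
      rw [← Finset.prod_mul_distrib]
      exact Finset.prod_congr rfl fun i _ => topPow_dual_apply (γ i) (φ i) (ω i)
    rw [h3]
    exact congrArg (· * _) h2.symm

theorem eq_of_algebraMap_eq (hR : SerreSTwo R) {x y : R} (hxy : ∀ p : PrimeSpectrum R,
    p.asIdeal.height = 0 →
      algebraMap R (Localization p.asIdeal.primeCompl) x = algebraMap R _ y) : x = y := by
  refine hR.eq_of_minimal fun p hp hp0 => ?_
  obtain ⟨t, ht⟩ := IsLocalization.exists_of_eq (M := p.primeCompl)
    (S := Localization p.primeCompl) (hxy ⟨p, hp⟩ hp0)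
  exact ⟨t, t.2, ht⟩

theorem exists_den_notMem [QuasiIso f] (hP : IsStrictlyPerfect a b P) (ha : a ≤ 1) (hb : 1 ≤ b)
    (h : RankCond P β l) (γ : ∀ i, topPow R (P.X i) ≃ₗ[R] R) (hE : ExactOffOne P p)
    (h0 : Module.Free (Localization p.asIdeal.primeCompl) (LinearMap.range (dLoc P p 0 1)))
    (z : extPow R l (K.homology 1)) :
    ∃ t : Admissible a b P β l, t.cls f = z ∧ t.den γ ∉ p.asIdeal := by
  obtain ⟨ζ, c, κ, -, h2⟩ := exists_local_formula f hP ha hb h γ hE h0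
  obtain ⟨y, rfl⟩ := exists_extClass_eq f (h.isLocallyConstant_degree hP ha hb) z
  obtain ⟨t, ht, hd⟩ := h2 y y.2
  exact ⟨t, congrArg (extClass f l) (Subtype.ext ht), hd⟩

variable [IsNoetherianRing R] [QuasiIso f]

/-- At a minimal prime some denominator for the class is a unit and can be cancelled. -/
theorem IsScalar.unique (hR : SerreSTwo R) (hP : IsStrictlyPerfect a b P) (ha : a ≤ 1) (hb : 1 ≤ b)
    (h : RankCond P β l) (hE : ∀ p : PrimeSpectrum R, p.asIdeal.height ≤ 1 → ExactOffOne P p)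
    {ψ ψ' : extPow R l (K.homology 1) → R} (hψ : IsScalar f a b β γ ψ)
    (hψ' : IsScalar f a b β γ ψ') : ψ = ψ' := by
  funext z
  refine eq_of_algebraMap_eq hR fun p hp => ?_
  have hp1 : p.asIdeal.height ≤ 1 := by rw [hp]; exact zero_le_one
  obtain ⟨t, rfl, hd⟩ := exists_den_notMem (f := f) hP ha hb h γ (hE p hp1)
    (free_range_dLoc_zero_one hP (hE p hp1) hp1) z
  have h1 := (hψ t).symm.trans (hψ' t)
  have h2 := congrArg (algebraMap R (Localization p.asIdeal.primeCompl)) h1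
  rw [map_mul, map_mul] at h2
  exact (isUnit_algebraMap_of_notMem hd).mul_right_cancel h2

/-- The kernel of the natural map is the torsion. -/
theorem IsScalar.ker_eq_torsion (hR : SerreSTwo R) (hP : IsStrictlyPerfect a b P) (ha : a ≤ 1)
    (hb : 1 ≤ b) (h : RankCond P β l)
    (hE : ∀ p : PrimeSpectrum R, p.asIdeal.height ≤ 1 → ExactOffOne P p)
    {ψ : extPow R l (K.homology 1) →ₗ[R] R} (hψ : IsScalar f a b β γ ψ) :
    LinearMap.ker ψ = Submodule.torsion R (extPow R l (K.homology 1)) := by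
  ext z
  rw [LinearMap.mem_ker, Submodule.mem_torsion_iff]
  constructor
  · intro hz
    -- At each minimal prime a form with zero coordinate is killed by an element outside the prime.
    -- The annihilator of `z` thus lies in no minimal prime, and `S₂` supplies a non-zero-divisor in
    -- it.
    obtain ⟨s, hs, hs0⟩ := hR.exists_nonZeroDivisor
      (I := (⊥ : Submodule R (ExteriorAlgebra R (K.homology 1))).colon {(z : ExteriorAlgebra R _)})
      (fun p hp hp0 hle => by
        have hp1 : p.height ≤ 1 := by rw [hp0]; exact zero_le_one
        have h01 := free_range_dLoc_zero_one hP (hE ⟨p, hp⟩ hp1) hp1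
        obtain ⟨hB⟩ := finrank_homology f hP ha hb h (hE ⟨p, hp⟩ hp1) h01
          (free_homology_of_height_eq_zero f hP (hE ⟨p, hp⟩ hp1) hp0)
        obtain ⟨κ, hκ⟩ := hψ.local_formula_of_free hP ha hb h (hE ⟨p, hp⟩ hp1) h01 hB
        have h1 := hκ z
        rw [hz, RingHom.map_zero] at h1
        have h2 := (Units.mul_right_eq_zero κ).1 h1.symm
        have h3 := eq_detOn_smul hB
          (locMap_mem_of_mem_extPow ⟨p, hp⟩ (h.isLocallyConstant_degree hP ha hb) z.2)
        rw [h2, zero_smul] at h3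
        obtain ⟨s, hs, hs0⟩ := exists_smul_eq_zero_of_locMap_eq_zero _ h3
        exact hs (hle (Submodule.mem_colon_singleton.2 ((Submodule.mem_bot R).2 hs0))))
    refine ⟨⟨s, hs0⟩, Subtype.ext ?_⟩
    exact (Submodule.mem_bot R).1 (Submodule.mem_colon_singleton.1 hs)
  · rintro ⟨s, hs⟩
    have h1 := congrArg ψ hs
    have h2 : (s : R) * ψ z = 0 := by
      rw [← smul_eq_mul, ← map_smul]
      exact h1.trans (map_zero ψ)
    exact (mul_right_mem_nonZeroDivisors_eq_zero_iff s.2).1 ((mul_comm _ _).trans h2)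

end PerfDet

/-! ### Independence of the free presentation. -/

namespace ExteriorAlgebra

section

variable {A : Type*} [CommRing A] {Z Z' H : Type*} [AddCommGroup Z] [Module A Z] [AddCommGroup Z']
  [Module A Z'] [AddCommGroup H] [Module A H]

theorem ι_mul_prod_comm (z : Z) (L : List Z) :
    ι A z * (L.map (ι A)).prod = (-1 : A) ^ L.length • ((L.map (ι A)).prod * ι A z) := by
  induction L with
  | nil => simp
  | cons y L ih =>
    have h1 : ι A z * ι A y = (-1 : A) • (ι A y * ι A z) := by
      have := ι_add_mul_swap (R := A) z y
      rw [neg_one_smul]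
      exact eq_neg_of_add_eq_zero_left this
    rw [List.map_cons, List.prod_cons, ← mul_assoc, h1, smul_mul_assoc, mul_assoc, ih,
      List.length_cons, mul_smul_comm, smul_smul, mul_assoc, pow_succ']

theorem prod_mul_prod_comm (L L' : List Z) :
    (L.map (ι A)).prod * (L'.map (ι A)).prod
      = (-1 : A) ^ (L.length * L'.length) • ((L'.map (ι A)).prod * (L.map (ι A)).prod) := by
  induction L with
  | nil => simp
  | cons y L ih =>
    rw [List.map_cons, List.prod_cons, mul_assoc, ih, mul_smul_comm, ← mul_assoc, ι_mul_prod_comm,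
      smul_mul_assoc, smul_smul, mul_assoc, ← pow_add, List.length_cons, add_mul, one_mul]

theorem ιMulti_mul_comm {m n : ℕ} (v : Fin m → Z) (w : Fin n → Z) :
    ιMulti A m v * ιMulti A n w = (-1 : A) ^ (m * n) • (ιMulti A n w * ιMulti A m v) := by
  have := prod_mul_prod_comm (A := A) (List.ofFn v) (List.ofFn w)
  rw [List.map_ofFn, List.map_ofFn, List.length_ofFn, List.length_ofFn] at this
  rw [ιMulti_apply, ιMulti_apply]
  exact this

theorem exists_detOn_ιMulti_ker_mul' {m n l : ℕ} (hm : m = n + l) {π : Z →ₗ[A] H}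
    (hπ : Function.Surjective π) (ζ : Module.Basis (Fin m) A Z)
    (c : Module.Basis (Fin n) A (LinearMap.ker π)) (h : Module.Basis (Fin l) A H) :
    ∃ u : Aˣ, ∀ x ∈ ⋀[A]^l Z,
      detOn ζ (ιMulti A n (fun i => (c i : Z)) * x) = u * detOn h (map π x) := by
  subst hm
  exact exists_detOn_ιMulti_ker_mul hπ ζ c h

theorem ιMulti_mul_mem {n l : ℕ} (v : Fin n → Z) {y : ExteriorAlgebra A Z} (hy : y ∈ ⋀[A]^l Z) :
    ιMulti A n v * y ∈ ⋀[A]^(n + l) Z := by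
  change _ ∈ (ι A).range ^ (n + l)
  rw [pow_add]
  exact Submodule.mul_mem_mul (ιMulti_range _ _ ⟨_, rfl⟩) hy

/-- The determinant of the relations and of a form does not depend, up to a unit, on the free
presentation of a module. -/
theorem exists_detOn_presentation {n n' l : ℕ} {π : Z →ₗ[A] H} {π' : Z' →ₗ[A] H}
    (hπ : Function.Surjective π)
    (ζ : Module.Basis (Fin (n + l)) A Z) (c : Module.Basis (Fin n) A (LinearMap.ker π))
    (ζ' : Module.Basis (Fin (n' + l)) A Z') (c' : Module.Basis (Fin n') A (LinearMap.ker π'))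
    {σ : Z →ₗ[A] Z'} (hσ : π' ∘ₗ σ = π) :
    ∃ u : Aˣ, ∀ y ∈ ⋀[A]^l Z, detOn ζ (ιMulti A n (fun i => (c i : Z)) * y)
      = u * detOn ζ' (ιMulti A n' (fun i => (c' i : Z')) * map σ y) := by
  have hσ' : ∀ z, π' (σ z) = π z := LinearMap.congr_fun hσ
  let B' := LinearMap.ker π'
  let ρ : (Z × B') →ₗ[A] Z' := σ.coprod B'.subtype
  -- The module `Z × ker π'` maps onto `Z'` by `ρ` with kernel isomorphic to `ker π`, and onto `Z`
  -- by the first projection with kernel `ker π'`. Both determinants are computed from the same top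
  -- form on this product.
  have hρ : Function.Surjective ρ := by
    intro z'
    obtain ⟨z, hz⟩ := hπ (π' z')
    exact ⟨(z, ⟨z' - σ z, by rw [LinearMap.mem_ker, map_sub, hσ', hz, sub_self]⟩), by simp [ρ]⟩
  let ξ : Module.Basis (Fin (n + (n' + l))) A (Z × B') :=
    (ζ.prod c').reindex (finSumFinEquiv.trans (finCongr (by ring)))
  let τ : LinearMap.ker π →ₗ[A] LinearMap.ker ρ :=
    LinearMap.codRestrict _ (LinearMap.prod (LinearMap.ker π).subtype
      (LinearMap.codRestrict B' (-(σ ∘ₗ (LinearMap.ker π).subtype)) (fun x => by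
        have h1 := x.2
        rw [LinearMap.mem_ker] at h1 ⊢
        simp [hσ']))) (fun x => by
          rw [LinearMap.mem_ker]
          simp [ρ])
  have hτ : Function.Bijective τ := by
    constructor
    · intro x y hxy
      have := congrArg (fun w : LinearMap.ker ρ => (w : Z × B').1) hxy
      exact Subtype.ext this
    · rintro ⟨⟨z, x⟩, hzx⟩
      have h1 : σ z + x = 0 := hzx
      have h2 : π z = 0 := by
        have h3 := congrArg π' h1
        rwa [map_add, hσ', LinearMap.mem_ker.1 x.2, add_zero, map_zero] at h3
      refine ⟨⟨z, h2⟩, Subtype.ext (Prod.ext rfl (Subtype.ext ?_))⟩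
      exact neg_eq_of_add_eq_zero_right h1
  let C : Module.Basis (Fin n) A (LinearMap.ker ρ) := c.map (LinearEquiv.ofBijective τ hτ)
  let ε : B' →ₗ[A] LinearMap.ker (LinearMap.fst A Z B') :=
    LinearMap.codRestrict _ (LinearMap.inr A Z B') (fun x => by simp)
  have hε : Function.Bijective ε := by
    constructor
    · intro x y hxy
      have := congrArg (fun w : LinearMap.ker (LinearMap.fst A Z B') => (w : Z × B').2) hxy
      exact this
    · rintro ⟨⟨z, x⟩, hzx⟩
      have h1 : z = 0 := hzx
      subst h1
      exact ⟨x, rfl⟩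
  let D : Module.Basis (Fin n') A (LinearMap.ker (LinearMap.fst A Z B')) :=
    c'.map (LinearEquiv.ofBijective ε hε)
  obtain ⟨u, hu⟩ := exists_detOn_ιMulti_ker_mul hρ ξ C ζ'
  obtain ⟨v, hv⟩ := exists_detOn_ιMulti_ker_mul' (by ring) Prod.fst_surjective ξ D ζ
  have hC : (fun i => ((C i : LinearMap.ker ρ) : Z × B').1) = fun i => (c i : Z) := rfl
  have hD : (fun i => ρ (D i : Z × B')) = fun i => (c' i : Z') := by
    funext i
    change σ 0 + (c' i : Z') = c' i
    rw [map_zero, zero_add]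
  have hs : IsUnit ((-1 : A) ^ (n' * n)) := (isUnit_one.neg).pow _
  refine ⟨v⁻¹ * hs.unit * u, fun y hy => ?_⟩
  have hy' : map (LinearMap.inl A Z B') y ∈ ⋀[A]^l (Z × B') := map_mem _ hy
  -- The form is `C ∧ D ∧ y` when projected to `Z'` and `D ∧ C ∧ y` when projected to `Z`; the two
  -- differ by a sign.
  have h1 := hu _ (ιMulti_mul_mem (fun i => (D i : Z × B')) hy')
  have h2 := hv _ (ιMulti_mul_mem (fun i => (C i : Z × B')) hy')
  rw [map_mul (map _), map_apply_ιMulti, ← AlgHom.comp_apply, map_comp_map] at h1 h2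
  have e1 : ρ ∘ₗ LinearMap.inl A Z B' = σ := by ext z; simp [ρ]
  have e2 : LinearMap.fst A Z B' ∘ₗ LinearMap.inl A Z B' = LinearMap.id := by ext z; simp
  rw [e1] at h1
  rw [e2, map_id, AlgHom.id_apply] at h2
  change _ = (u : A) * detOn ζ' (ιMulti A n' (fun i => ρ (D i : Z × B')) * _) at h1
  change _ = (v : A) * detOn ζ (ιMulti A n (fun i => (c i : Z)) * y) at h2
  rw [hD] at h1
  rw [← mul_assoc, ιMulti_mul_comm, smul_mul_assoc, LinearMap.map_smul, mul_assoc, h1,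
    smul_eq_mul] at h2
  rw [Units.val_mul, Units.val_mul, IsUnit.unit_spec, mul_assoc, mul_assoc, h2, ← mul_assoc,
    Units.inv_mul, one_mul]

end

end ExteriorAlgebra

/-! ### Independence of the strictly perfect complex. -/

namespace PerfDet

open ExteriorAlgebra

variable {R : Type u} [CommRing R] {P P' K : CochainComplex (ModuleCat.{u} R) ℤ}
  {p : PrimeSpectrum R} {a b a' b' : ℤ} {f : P ⟶ K} {f' : P' ⟶ K}
  {β β' : ℤ → PrimeSpectrum R → ℕ} {l : PrimeSpectrum R → ℕ}
  {γ : ∀ i, topPow R (P.X i) ≃ₗ[R] R} {γ' : ∀ i, topPow R (P'.X i) ≃ₗ[R] R}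

/-- The localized cocycles of `P` and `P'` are two free presentations of the same cohomology module,
related by a lift `σ`; the determinants in the two local formulas differ by a unit. -/
theorem IsScalar.local_comparison [QuasiIso f] [QuasiIso f']
    (hP : IsStrictlyPerfect a b P) (ha : a ≤ 1) (hb : 1 ≤ b) (h : RankCond P β l)
    (hP' : IsStrictlyPerfect a' b' P') (ha' : a' ≤ 1) (hb' : 1 ≤ b') (h' : RankCond P' β' l)
    {ψ ψ' : extPow R l (K.homology 1) →ₗ[R] R} (hψ : IsScalar f a b β γ ψ)
    (hψ' : IsScalar f' a' b' β' γ' ψ') (hE : ExactOffOne P p) (hE' : ExactOffOne P' p)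
    (h0 : Module.Free (Localization p.asIdeal.primeCompl) (LinearMap.range (dLoc P p 0 1)))
    (h0' : Module.Free (Localization p.asIdeal.primeCompl) (LinearMap.range (dLoc P' p 0 1))) :
    ∃ u : (Localization p.asIdeal.primeCompl)ˣ, ∀ z,
      algebraMap R (Localization p.asIdeal.primeCompl) (ψ z) = u * algebraMap R _ (ψ' z) := by
  have hl := h.isLocallyConstant_degree hP ha hb
  obtain ⟨ζ, c, κ, h1⟩ := hψ.local_formula hP ha hb h hE h0
  obtain ⟨ζ', c', κ', h1'⟩ := hψ'.local_formula hP' ha' hb' h' hE' h0'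
  have := Module.Projective.of_basis ζ
  obtain ⟨σ, hσ⟩ := Module.projective_lifting_property (πLoc f' p) (πLoc f p) (πLoc_surjective f')
  obtain ⟨u, hu⟩ := exists_detOn_presentation (πLoc_surjective f) ζ c ζ' c' hσ
  refine ⟨κ * u * κ'⁻¹, fun z => ?_⟩
  obtain ⟨y, rfl⟩ := exists_extClass_eq f hl z
  have hy := locMap_mem_of_mem_extPow p hl y.2
  -- The lift `σ` exists only at `p`. The form `σ y` comes from a form over `R` after multiplication
  -- by `t`, and its class is the expected one after multiplication by `s`.
  obtain ⟨t, ht, y'', hy'', hty⟩ := exists_smul_eq_locMap_extPow p hl (map_mem σ hy)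
  obtain ⟨s, hs, hsz⟩ := exists_smul_eq_zero_of_locMap_eq_zero p.asIdeal.primeCompl
    (x := (extClass f' l ⟨y'', hy''⟩ : ExteriorAlgebra R (K.homology 1))
      - t • (extClass f l y : ExteriorAlgebra R (K.homology 1))) (by
    rw [map_sub, ← algebraMap_smul_locMap, locMap_extClass, locMap_extClass, hty, map_smul,
      ← AlgHom.comp_apply, map_comp_map, hσ, sub_self])
  have hsz' : s • extClass f' l ⟨y'', hy''⟩ = s • t • extClass f l y :=
    Subtype.ext (by rwa [smul_sub, sub_eq_zero] at hsz)
  have h2 := congrArg (fun w => algebraMap R (Localization p.asIdeal.primeCompl) (ψ' w)) hsz'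
  simp only [LinearMap.map_smul, smul_eq_mul, RingHom.map_mul] at h2
  have h3 := (isUnit_algebraMap_of_notMem (p := p) hs).mul_left_cancel h2
  rw [h1', hty, mul_smul_comm, LinearMap.map_smul, smul_eq_mul] at h3
  have h4 : (κ' : Localization p.asIdeal.primeCompl) * detOn ζ' (ιMulti _ _
      (fun i => (c' i : LocalizedModule p.asIdeal.primeCompl (P'.cycles 1)))
        * map σ (locMap p.asIdeal.primeCompl (P.cycles 1) (y : ExteriorAlgebra R _)))
      = algebraMap R _ (ψ' (extClass f l y)) := by
    refine (isUnit_algebraMap_of_notMem (p := p) ht).mul_left_cancel ?_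
    rw [← h3]; ring
  rw [h1, hu _ hy, ← h4, Units.val_mul, Units.val_mul]
  linear_combination (-(κ * u * detOn ζ' (ιMulti _ _
      (fun i => (c' i : LocalizedModule p.asIdeal.primeCompl (P'.cycles 1)))
        * map σ (locMap p.asIdeal.primeCompl (P.cycles 1) (y : ExteriorAlgebra R _)))) :
        Localization p.asIdeal.primeCompl) * κ'.inv_mul

theorem exists_forall_mul_eq_zero [IsNoetherianRing R] (p : PrimeSpectrum R) (I : Ideal R)
    (h : ∀ x ∈ I, ∃ s ∉ p.asIdeal, s * x = 0) : ∃ s ∉ p.asIdeal, ∀ x ∈ I, s * x = 0 := by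
  obtain ⟨S, rfl⟩ := (isNoetherianRing_iff_ideal_fg R).1 inferInstance I
  choose! s hs hs0 using fun x (hx : x ∈ S) => h x (Ideal.subset_span hx)
  refine ⟨∏ x ∈ S, s x, p.asIdeal.primeCompl.prod_mem hs, fun x hx => ?_⟩
  have : Ideal.span (S : Set R) ≤ LinearMap.ker (LinearMap.mulLeft R (∏ x ∈ S, s x)) := by
    rw [Ideal.span_le]
    intro x hx
    obtain ⟨r, hr⟩ := Finset.dvd_prod_of_mem s hx
    change (∏ x ∈ S, s x) * x = 0
    rw [hr, mul_right_comm, hs0 x hx, zero_mul]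
  exact this hx

theorem exists_ψ_notMem [IsNoetherianRing R] [QuasiIso f] (hP : IsStrictlyPerfect a b P)
    (ha : a ≤ 1) (hb : 1 ≤ b) (h : RankCond P β l) (hE : ExactOffOne P p)
    (h0 : Module.Free (Localization p.asIdeal.primeCompl) (LinearMap.range (dLoc P p 0 1)))
    (hB : Module.Basis (Fin (l p)) (Localization p.asIdeal.primeCompl)
      (LocalizedModule p.asIdeal.primeCompl (K.homology 1)))
    {ψ : extPow R l (K.homology 1) →ₗ[R] R} (hψ : IsScalar f a b β γ ψ) : ∃ z, ψ z ∉ p.asIdeal := by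
  obtain ⟨κ, hκ⟩ := hψ.local_formula_of_free hP ha hb h hE h0 hB
  obtain ⟨t, ht, z, hz, hzt⟩ := exists_smul_eq_locMap_extPow p
    (h.isLocallyConstant_degree hP ha hb) (y := ιMulti _ _ hB) (ιMulti_range _ _ ⟨_, rfl⟩)
  refine ⟨⟨z, hz⟩, notMem_of_isUnit_algebraMap ?_⟩
  rw [hκ, hzt, LinearMap.map_smul, detOn_ιMulti, Module.Basis.det_self, smul_eq_mul, mul_one]
  exact κ.isUnit.mul (isUnit_algebraMap_of_notMem ht)

/-- The pairs in `J` are candidate fractions for `ψ' / ψ`. They agree at minimal primes, where `ψ`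
takes a unit value. At each prime of height at most one there is a pair with both entries outside
the prime, so the glued element `r` is contained in no such prime and is a unit. -/
theorem IsScalar.exists_unit [IsNoetherianRing R] (hR : SerreSTwo R) [QuasiIso f] [QuasiIso f']
    (hP : IsStrictlyPerfect a b P) (ha : a ≤ 1) (hb : 1 ≤ b) (h : RankCond P β l)
    (hP' : IsStrictlyPerfect a' b' P') (ha' : a' ≤ 1) (hb' : 1 ≤ b') (h' : RankCond P' β' l)
    {ψ ψ' : extPow R l (K.homology 1) →ₗ[R] R} (hψ : IsScalar f a b β γ ψ)
    (hψ' : IsScalar f' a' b' β' γ' ψ')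
    (hE : ∀ p : PrimeSpectrum R, p.asIdeal.height ≤ 1 → ExactOffOne P p)
    (hE' : ∀ p : PrimeSpectrum R, p.asIdeal.height ≤ 1 → ExactOffOne P' p) :
    ∃ r : Rˣ, ∀ z, ψ' z = r * ψ z := by
  have hle : ∀ p : PrimeSpectrum R, p.asIdeal.height = 0 → p.asIdeal.height ≤ 1 :=
    fun p hp => by rw [hp]; exact zero_le_one
  let J := {j : R × R // ∀ z, j.2 * ψ' z = j.1 * ψ z}
  have hcross : ∀ j k : J, j.1.1 * k.1.2 = k.1.1 * j.1.2 := by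
    intro j k
    refine eq_of_algebraMap_eq hR fun p hp => ?_
    have h01 := free_range_dLoc_zero_one hP (hE p (hle p hp)) (hle p hp)
    obtain ⟨hB⟩ := finrank_homology f hP ha hb h (hE p (hle p hp)) h01
      (free_homology_of_height_eq_zero f hP (hE p (hle p hp)) hp)
    obtain ⟨z, hz⟩ := exists_ψ_notMem hP ha hb h (hE p (hle p hp)) h01 hB hψ
    refine (isUnit_algebraMap_of_notMem hz).mul_right_cancel ?_
    rw [← RingHom.map_mul, ← RingHom.map_mul]
    congr 1
    linear_combination (-k.1.2) * j.2 z + j.1.2 * k.2 z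
  have hJ : ∀ p : PrimeSpectrum R, p.asIdeal.height ≤ 1 →
      ∃ j : J, j.1.2 ∉ p.asIdeal ∧ j.1.1 ∉ p.asIdeal := by
    intro p hp
    obtain ⟨u, hu⟩ := IsScalar.local_comparison hP ha hb h hP' ha' hb' h' hψ hψ' (hE p hp) (hE' p hp)
      (free_range_dLoc_zero_one hP (hE p hp) hp) (free_range_dLoc_zero_one hP' (hE' p hp) hp)
    obtain ⟨⟨n, d⟩, hnd⟩ := IsLocalization.surj p.asIdeal.primeCompl
      (u : Localization p.asIdeal.primeCompl)
    simp only at hnd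
    -- The equality `d ψ = n ψ'` holds after localization for each argument. The values of the
    -- difference form a finitely generated ideal, so one multiplier `s` serves all arguments at
    -- once.
    obtain ⟨s, hs, hs0⟩ := exists_forall_mul_eq_zero p
      (LinearMap.range ((d : R) • ψ - n • ψ')) (by
        rintro _ ⟨z, rfl⟩
        have h2 : algebraMap R (Localization p.asIdeal.primeCompl) (((d : R) • ψ - n • ψ') z) = 0 := by
          rw [LinearMap.sub_apply, LinearMap.smul_apply, LinearMap.smul_apply, smul_eq_mul, smul_eq_mul,
            RingHom.map_sub, RingHom.map_mul, RingHom.map_mul, hu, ← hnd]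
          ring
        obtain ⟨t, ht⟩ := (IsLocalization.map_eq_zero_iff p.asIdeal.primeCompl _ _).1 h2
        exact ⟨t, t.2, ht⟩)
    have hn : n ∉ p.asIdeal := by
      refine notMem_of_isUnit_algebraMap ?_
      rw [← hnd]
      exact u.isUnit.mul (isUnit_algebraMap_of_notMem d.2)
    refine ⟨⟨(s * d, s * n), fun z => ?_⟩, fun hm => (p.2.mem_or_mem hm).elim hs hn,
      fun hm => (p.2.mem_or_mem hm).elim hs d.2⟩
    have h3 := hs0 _ ⟨z, rfl⟩
    simp only [LinearMap.sub_apply, LinearMap.smul_apply, smul_eq_mul] at h3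
    linear_combination -h3
  obtain ⟨r, hr⟩ := hR.exists_eq_mul (fun j : J => j.1.2) (fun j : J => j.1.1) hcross
    fun p hp hp1 => by
      obtain ⟨j, hj, -⟩ := hJ ⟨p, hp⟩ hp1
      exact ⟨j, hj⟩
  have hru : IsUnit r := SerreSTwo.isUnit_of_forall_notMem fun p hp hp1 hrp => by
    obtain ⟨j, -, hj⟩ := hJ ⟨p, hp⟩ hp1
    exact hj (hr j ▸ Ideal.mul_mem_right _ _ hrp)
  refine ⟨hru.unit, fun z => eq_of_algebraMap_eq hR fun p hp => ?_⟩
  obtain ⟨j, hj, -⟩ := hJ p (hle p hp)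
  refine (isUnit_algebraMap_of_notMem hj).mul_left_cancel ?_
  rw [← RingHom.map_mul, ← RingHom.map_mul, j.2 z, hr j, IsUnit.unit_spec]
  congr 1
  ring

theorem _root_.IsLocallyConstant.eq_of_le {l : PrimeSpectrum R → ℕ} (hl : IsLocallyConstant l)
    {p q : PrimeSpectrum R} (hpq : p ≤ q) : l p = l q := by
  obtain ⟨e, -, he, h⟩ := exists_idempotent_of_isLocallyConstant hl q
  exact h p fun hep => he (hpq hep)

/-- At a minimal prime the degree is the rank of `H¹` of the target complex, which does not involve
the resolution. -/
theorem RankCond.degree_unique [IsNoetherianRing R] {l' : PrimeSpectrum R → ℕ}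
    [QuasiIso f] [QuasiIso f']
    (hP : IsStrictlyPerfect a b P) (ha : a ≤ 1) (hb : 1 ≤ b) (h : RankCond P β l)
    (hP' : IsStrictlyPerfect a' b' P') (ha' : a' ≤ 1) (hb' : 1 ≤ b') (h' : RankCond P' β' l')
    (hE : ∀ p : PrimeSpectrum R, p.asIdeal.height ≤ 1 → ExactOffOne P p)
    (hE' : ∀ p : PrimeSpectrum R, p.asIdeal.height ≤ 1 → ExactOffOne P' p) : l = l' := by
  funext p
  obtain ⟨m, hm, hm0⟩ := exists_minimal_le p
  have hm1 : m.asIdeal.height ≤ 1 := by rw [hm0]; exact zero_le_one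
  have hH := free_homology_of_height_eq_zero f hP (hE m hm1) hm0
  obtain ⟨B⟩ := finrank_homology f hP ha hb h (hE m hm1)
    (free_range_dLoc_zero_one hP (hE m hm1) hm1) hH
  obtain ⟨B'⟩ := finrank_homology f' hP' ha' hb' h' (hE' m hm1)
    (free_range_dLoc_zero_one hP' (hE' m hm1) hm1) hH
  rw [← (h.isLocallyConstant_degree hP ha hb).eq_of_le hm,
    ← (h'.isLocallyConstant_degree hP' ha' hb').eq_of_le hm]
  simpa using Fintype.card_congr (B.indexEquiv B')

end PerfDet

/-! ### Fitting ideals as determinants of relations. -/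

namespace PerfDet

section Fitting

variable {A : Type*} [CommRing A] {M : Type*} [AddCommGroup M] [Module A M]

/-- The ideal generated by the determinants of the square matrices of relations between the members
of a family. -/
def relDet {ι : Type} [Fintype ι] [DecidableEq ι] (g : ι → M) : Ideal A :=
  Ideal.span {δ : A | ∃ V : Matrix ι ι A, (∀ j, ∑ i, V j i • g i = 0) ∧ δ = V.det}

theorem relDet_le_comp_equiv {ι κ : Type} [Fintype ι] [DecidableEq ι] [Fintype κ] [DecidableEq κ]
    (e : κ ≃ ι) (g : ι → M) : relDet (A := A) g ≤ relDet (g ∘ e) := by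
  refine Ideal.span_le.2 ?_
  rintro _ ⟨V, hV, rfl⟩
  refine Ideal.subset_span ⟨V.submatrix e e, fun j => ?_, (Matrix.det_submatrix_equiv_self e V).symm⟩
  rw [← hV (e j)]
  exact e.sum_comp (fun i => V (e j) i • g i)

theorem relDet_comp_equiv {ι κ : Type} [Fintype ι] [DecidableEq ι] [Fintype κ] [DecidableEq κ]
    (e : κ ≃ ι) (g : ι → M) : relDet (A := A) (g ∘ e) = relDet g := by
  refine le_antisymm ?_ (relDet_le_comp_equiv e g)
  have := relDet_le_comp_equiv (A := A) e.symm (g ∘ e)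
  rwa [Function.comp_assoc, e.self_comp_symm, Function.comp_id] at this

/-- A column operation eliminates the redundant generator: every row of the remaining columns
becomes a relation between the `g i`, and Laplace expansion along the first column finishes one
inclusion. For the other, a matrix of relations is bordered by the relation `(1, -w)`. -/
theorem relDet_cons {n : ℕ} (g : Fin n → M) (w : Fin n → A) :
    relDet (A := A) (Fin.cons (∑ i, w i • g i) g : Fin (n + 1) → M) = relDet g := by
  apply le_antisymm
  · refine Ideal.span_le.2 ?_
    rintro _ ⟨V, hV, rfl⟩
    let V' : Matrix (Fin (n + 1)) (Fin (n + 1)) A :=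
      fun j => Fin.cons (V j 0) (fun i => V j i.succ + V j 0 * w i)
    have hV' : V.det = V'.det := by
      rw [← Matrix.det_transpose V, ← Matrix.det_transpose V']
      refine (Matrix.det_eq_of_forall_row_eq_smul_add_const (Fin.cons 0 w : Fin (n + 1) → A) 0 rfl
        fun i j => ?_).symm
      refine Fin.cases ?_ (fun i => ?_) i
      · exact ((congrArg (V j 0 + ·) (zero_mul (V j 0))).trans (add_zero _)).symm
      · exact congrArg (V j i.succ + ·) (mul_comm _ _)
    have hrel : ∀ j, ∑ i : Fin n, V' j i.succ • g i = 0 := by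
      intro j
      rw [← hV j, Fin.sum_univ_succ]
      simp [V', add_smul, mul_smul, Finset.sum_add_distrib, Finset.smul_sum, add_comm]
    rw [SetLike.mem_coe, hV', Matrix.det_succ_column_zero]
    refine Ideal.sum_mem _ fun j _ => Ideal.mul_mem_left _ _ (Ideal.subset_span ⟨_, fun r => ?_, rfl⟩)
    exact hrel _
  · refine Ideal.span_le.2 ?_
    rintro _ ⟨V, hV, rfl⟩
    let V' : Matrix (Fin (n + 1)) (Fin (n + 1)) A :=
      Matrix.of (Fin.cons (Fin.cons 1 (-w)) (fun j => Fin.cons 0 (V j)))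
    refine Ideal.subset_span ⟨V', fun j => ?_, ?_⟩
    · refine Fin.cases ?_ (fun j => ?_) j
      · rw [Fin.sum_univ_succ]; simp [V']
      · rw [Fin.sum_univ_succ]; simp [V', hV]
    · rw [Matrix.det_succ_column_zero, Fin.sum_univ_succ, Finset.sum_eq_zero, add_zero]
      · simp only [V', Matrix.of_apply, Fin.val_zero, pow_zero, one_mul, Fin.cons_zero, Fin.succAbove_zero]
        rfl
      · intro j _; simp [V']

theorem relDet_option {ι : Type} [Fintype ι] [DecidableEq ι] (g : Option ι → M)
    (h : g none ∈ Submodule.span A (Set.range (g ∘ some))) :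
    relDet (A := A) g = relDet (g ∘ some) := by
  let e := Fintype.equivFin ι
  obtain ⟨w, hw⟩ := (Submodule.mem_span_range_iff_exists_fun A).1 h
  have h1 := relDet_cons (A := A) (g ∘ some ∘ e.symm) (w ∘ e.symm)
  have h2 : ∑ i, (w ∘ e.symm) i • (g ∘ some ∘ e.symm) i = g none := by
    rw [← hw]
    exact e.symm.sum_comp (fun i => w i • g (some i))
  rw [h2] at h1
  have h3 := relDet_comp_equiv (A := A) e.symm (g ∘ some)
  rw [← h3, ← Function.comp_assoc] at *
  rw [← h1, ← relDet_comp_equiv (A := A) ((finSuccEquiv _).trans (Equiv.optionCongr e.symm)) g]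
  congr 1
  funext i
  refine Fin.cases ?_ (fun i => ?_) i
  · rfl
  · rfl

/-- Redundant generators are removed one by one, by induction on the finite type indexing them. -/
theorem relDet_sum {ι κ : Type} [Fintype ι] [DecidableEq ι] [Fintype κ] [DecidableEq κ] (g : ι → M)
    (g' : κ → M) (hg : Submodule.span A (Set.range g) = ⊤) :
    relDet (A := A) (Sum.elim g g') = relDet g := by
  classical
  refine Fintype.induction_empty_option
    (P := fun κ _ => ∀ [DecidableEq κ] (g' : κ → M), relDet (A := A) (Sum.elim g g') = relDet g)
    ?_ ?_ ?_ κ g'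
  · intro α β _ e h _ g'
    classical
    have := Fintype.ofEquiv β e.symm
    have h1 := h (g' ∘ e)
    rw [← h1, ← relDet_comp_equiv (Equiv.sumCongr (Equiv.refl ι) e)]
    have h2 : Sum.elim g g' ∘ (Equiv.sumCongr (Equiv.refl ι) e) = Sum.elim g (g' ∘ e) := by
      funext x
      rcases x with x | x <;> rfl
    rw [h2]
    convert rfl
  · intro _ g'
    rw [← relDet_comp_equiv (Equiv.sumEmpty ι PEmpty).symm]
    congr 1
  · intro α _ h _ g'
    let e : Option (ι ⊕ α) ≃ ι ⊕ Option α :=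
      { toFun := fun o => o.elim (Sum.inr none) (Sum.map id some)
        invFun := Sum.elim (fun i => some (Sum.inl i)) (fun o => o.map Sum.inr)
        left_inv := by rintro (_ | _ | _) <;> rfl
        right_inv := by rintro (_ | _ | _) <;> rfl }
    rw [← relDet_comp_equiv e, relDet_option, ← h (g' ∘ some)]
    · congr 1
      funext x
      rcases x with x | x <;> rfl
    · have : Set.range g ⊆ Set.range ((Sum.elim g g' ∘ e) ∘ some) := by
        rintro _ ⟨i, rfl⟩
        exact ⟨Sum.inl i, rfl⟩
      have h2 : Submodule.span A (Set.range ((Sum.elim g g' ∘ e) ∘ some)) = ⊤ :=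
        top_le_iff.1 (hg.symm.le.trans (Submodule.span_mono this))
      rw [h2]
      exact Submodule.mem_top

/-- The ideal of determinants of relations does not depend on the generators of the module. -/
theorem relDet_eq {ι κ : Type} [Fintype ι] [DecidableEq ι] [Fintype κ] [DecidableEq κ] (g : ι → M)
    (g' : κ → M) (hg : Submodule.span A (Set.range g) = ⊤)
    (hg' : Submodule.span A (Set.range g') = ⊤) : relDet (A := A) g = relDet g' := by
  rw [← relDet_sum g g' hg, ← relDet_sum g' g hg', ← relDet_comp_equiv (Equiv.sumComm κ ι)]
  congr 1
  funext x
  rcases x with x | x <;> rfl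

/-- A minor of a presentation matrix is the determinant of a square matrix of relations. Conversely
any such matrix can be appended to a generating set of the relations and becomes a minor of the
enlarged presentation. Finite generation of the relations is where noetherianity enters. -/
theorem fitting_eq_relDet [IsNoetherianRing A] {ι : Type} [Fintype ι] [DecidableEq ι] (g : ι → M)
    (hg : Submodule.span A (Set.range g) = ⊤) : fitting A M = relDet g := by
  apply le_antisymm
  · refine Ideal.span_le.2 ?_
    rintro _ ⟨m, n, H, π, hπ, hH, s, rfl⟩
    have hπe : ∀ x, π x = ∑ i, x i • π (Pi.single i 1) := fun x => by
      conv_lhs => rw [← Finset.univ_sum_single x, map_sum]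
      refine Finset.sum_congr rfl fun i _ => ?_
      rw [← map_smul, ← Pi.single_smul, smul_eq_mul, mul_one]
    rw [SetLike.mem_coe, relDet_eq g (fun i : Fin n => π (Pi.single i 1)) hg ?_]
    · refine Ideal.subset_span ⟨(H.submatrix id s).transpose, fun j => ?_,
        (Matrix.det_transpose _).symm⟩
      have h1 : H.mulVecLin (Pi.single (s j) 1) ∈ LinearMap.ker π := hH ▸ ⟨_, rfl⟩
      rw [LinearMap.mem_ker, hπe] at h1
      rw [← h1]
      refine Finset.sum_congr rfl fun i _ => ?_
      simp [Matrix.transpose_apply]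
    · rw [eq_top_iff]
      intro y _
      obtain ⟨x, rfl⟩ := hπ y
      rw [hπe]
      exact Submodule.sum_mem _ fun i _ => Submodule.smul_mem _ _ (Submodule.subset_span ⟨i, rfl⟩)
  · let e := Fintype.equivFin ι
    rw [← relDet_comp_equiv e.symm g]
    let π : (Fin (Fintype.card ι) → A) →ₗ[A] M := Fintype.linearCombination A (g ∘ e.symm)
    have hπ : Function.Surjective π := by
      rw [← LinearMap.range_eq_top, Fintype.range_linearCombination, e.symm.surjective.range_comp, hg]
    obtain ⟨k, v, hv⟩ := Submodule.fg_iff_exists_fin_generating_family.1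
      (IsNoetherian.noetherian (LinearMap.ker π))
    refine Ideal.span_le.2 ?_
    rintro _ ⟨V, hV, rfl⟩
    let H : Matrix (Fin (Fintype.card ι)) (Fin (k + Fintype.card ι)) A :=
      Matrix.of fun i j => Fin.append v V j i
    refine Ideal.subset_span ⟨k + Fintype.card ι, Fintype.card ι, H, π, hπ, ?_, Fin.natAdd k, ?_⟩
    · rw [Matrix.range_mulVecLin, ← hv]
      apply le_antisymm
      · rw [Submodule.span_le]
        rintro _ ⟨j, rfl⟩
        refine Fin.addCases (fun j => ?_) (fun j => ?_) j
        · refine Submodule.subset_span ⟨j, ?_⟩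
          funext i
          exact (congrFun (Fin.append_left v V j) i).symm
        · rw [hv]
          have : H.col (Fin.natAdd k j) = V j := by
            funext i
            exact congrFun (Fin.append_right v V j) i
          rw [this]
          exact (Fintype.linearCombination_apply A _ _).trans (hV j)
      · refine Submodule.span_mono ?_
        rintro _ ⟨j, rfl⟩
        refine ⟨Fin.castAdd _ j, ?_⟩
        funext i
        exact congrFun (Fin.append_left v V j) i
    · rw [← Matrix.det_transpose]
      congr 1
      ext i j
      exact (congrFun (Fin.append_right v V j) i).symm

/-- Denominators are cleared by a common `s`, and each row becomes a true relation after one more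
multiplier `t j`; the determinant changes by a unit. -/
theorem relDet_localized {R : Type*} [CommRing R] (S : Submonoid R) {M : Type*} [AddCommGroup M]
    [Module R M] {ι : Type} [Fintype ι] [DecidableEq ι] (g : ι → M) :
    (relDet (A := R) g).map (algebraMap R (Localization S))
      = relDet (fun i => LocalizedModule.mkLinearMap S M (g i)) := by
  apply le_antisymm
  · rw [relDet, Ideal.map_span, Ideal.span_le]
    rintro _ ⟨_, ⟨V, hV, rfl⟩, rfl⟩
    refine Ideal.subset_span ⟨V.map (algebraMap R (Localization S)), fun j => ?_,
      RingHom.map_det _ V⟩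
    have h1 := congrArg (LocalizedModule.mkLinearMap S M) (hV j)
    rw [map_sum, map_zero] at h1
    rw [← h1]
    refine Finset.sum_congr rfl fun i _ => ?_
    rw [map_smul, Matrix.map_apply, algebraMap_smul]
  · refine Ideal.span_le.2 ?_
    rintro _ ⟨V, hV, rfl⟩
    obtain ⟨s, hs⟩ := IsLocalization.exist_integer_multiples_of_finite S
      (fun x : ι × ι => V x.1 x.2)
    choose W hW using hs
    have hW' : ∀ j, ∃ t : S, (t : R) • ∑ i, W (j, i) • g i = 0 := by
      intro j
      have h1 : LocalizedModule.mkLinearMap S M (∑ i, W (j, i) • g i) = 0 := by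
        rw [map_sum]
        calc _ = ∑ i, algebraMap R (Localization S) s •
              (V j i • LocalizedModule.mkLinearMap S M (g i)) := by
              refine Finset.sum_congr rfl fun i _ => ?_
              rw [map_smul, ← algebraMap_smul (Localization S) (W (j, i)), hW, smul_smul,
                Algebra.smul_def]
          _ = 0 := by rw [← Finset.smul_sum, hV, smul_zero]
      obtain ⟨t, ht⟩ := (IsLocalizedModule.eq_zero_iff S (LocalizedModule.mkLinearMap S M)).1 h1
      exact ⟨t, ht⟩
    choose t ht using hW'
    have hdet : algebraMap R (Localization S) (Matrix.det (Matrix.of fun j i => (t j : R) * W (j, i)))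
        = (∏ j, algebraMap R (Localization S) ((t j : R) * s)) * V.det := by
      rw [← Matrix.det_mul_column, RingHom.map_det]
      congr 1
      ext j i
      rw [RingHom.mapMatrix_apply, Matrix.map_apply, Matrix.of_apply, map_mul, hW, Algebra.smul_def, Matrix.of_apply,
        map_mul]
      ring
    have hu : IsUnit (∏ j, algebraMap R (Localization S) ((t j : R) * s)) := by
      refine IsUnit.prod_iff.2 fun j _ => ?_
      exact IsLocalization.map_units (Localization S) (t j * s)
    rw [SetLike.mem_coe, ← Ideal.unit_mul_mem_iff_mem _ hu, ← hdet]
    refine Ideal.mem_map_of_mem _ (Ideal.subset_span ⟨_, fun j => ?_, rfl⟩)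
    rw [← ht j, Finset.smul_sum]
    exact Finset.sum_congr rfl fun i _ => mul_smul _ _ _

end Fitting

end PerfDet

/-! ### Maximal minors as coordinates of a wedge product. -/

namespace ExteriorAlgebra

theorem _root_.Equiv.Perm.exists_comp_eq {ι κ : Type*} [Fintype ι] {f g : κ → ι}
    (hf : Function.Injective f) (hg : Function.Injective g) :
    ∃ σ : Equiv.Perm ι, ∀ k, σ (f k) = g k := by
  classical
  let e : {x // x ∈ Set.range f} ≃ {x // x ∈ Set.range g} :=
    (Equiv.ofInjective f hf).symm.trans (Equiv.ofInjective g hg)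
  refine ⟨e.extendSubtype, fun k => ?_⟩
  rw [e.extendSubtype_apply_of_mem (f k) ⟨k, rfl⟩]
  have : (Equiv.ofInjective f hf).symm ⟨f k, ⟨k, rfl⟩⟩ = k :=
    Equiv.ofInjective_symm_apply hf k
  simp only [e, Equiv.trans_apply, this]
  rfl

variable {A : Type*} [CommRing A] {Z : Type*} [AddCommGroup Z] [Module A Z] {n l : ℕ}
  (ζ : Module.Basis (Fin (n + l)) A Z) (c : Fin n → Z)

/-- Permuting the rows by `σ` makes the coordinate matrix block triangular with an identity block,
and the remaining block is the minor on the complementary rows. -/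
theorem basis_det_append (σ : Equiv.Perm (Fin (n + l))) :
    ζ.det (Fin.append c fun j => ζ (σ (Fin.natAdd n j)))
      = Equiv.Perm.sign σ * (Matrix.of fun j i : Fin n => ζ.coord (σ (Fin.castAdd l j)) (c i)).det := by
  let N : Matrix (Fin (n + l)) (Fin (n + l)) A :=
    ζ.toMatrix (Fin.append c fun j => ζ (σ (Fin.natAdd n j)))
  have h1 : (N.submatrix σ id).det = Equiv.Perm.sign σ * N.det := Matrix.det_permute σ N
  have h2 : (N.submatrix σ id).submatrix finSumFinEquiv finSumFinEquiv
      = Matrix.fromBlocks (Matrix.of fun j i : Fin n => ζ.coord (σ (Fin.castAdd l j)) (c i)) 0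
        (Matrix.of fun (j : Fin l) (i : Fin n) => ζ.coord (σ (Fin.natAdd n j)) (c i)) 1 := by
    ext (i | i) (j | j)
    · simp [N, Module.Basis.toMatrix_apply]
    · simp [N, Module.Basis.toMatrix_apply, Finsupp.single_apply, Fin.ext_iff]
      intro h; omega
    · simp [N, Module.Basis.toMatrix_apply]
    · simp [N, Module.Basis.toMatrix_apply, Finsupp.single_apply, Matrix.one_apply, eq_comm]
  have h3 : (N.submatrix σ id).det
      = (Matrix.of fun j i : Fin n => ζ.coord (σ (Fin.castAdd l j)) (c i)).det := by
    rw [← Matrix.det_submatrix_equiv_self finSumFinEquiv, h2, Matrix.det_fromBlocks_zero₁₂,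
      Matrix.det_one, mul_one]
  rw [← h3, h1, ← mul_assoc, ← Int.cast_mul, Int.units_coe_mul_self, Int.cast_one, one_mul]
  rfl

/-- Modulo `I` the alternating map vanishes on injective tuples of basis vectors, hence everywhere.
-/
theorem _root_.AlternatingMap.mem_of_forall_injective {ι κ M : Type*} [Finite κ] [AddCommGroup M]
    [Module A M] (e : Module.Basis ι A M) (f : M [⋀^κ]→ₗ[A] A) (I : Ideal A)
    (h : ∀ v : κ → ι, Function.Injective v → f (fun k => e (v k)) ∈ I) (m : κ → M) : f m ∈ I := by
  classical
  cases nonempty_fintype κ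
  have h1 : (Submodule.mkQ I).compAlternatingMap f = 0 := by
    refine Module.Basis.ext_alternating e fun v hv => ?_
    rw [LinearMap.compAlternatingMap_apply, Submodule.mkQ_apply, AlternatingMap.zero_apply,
      Submodule.Quotient.mk_eq_zero]
    exact h v hv
  have h2 := congrArg (fun g => g m) h1
  rwa [LinearMap.compAlternatingMap_apply, Submodule.mkQ_apply, AlternatingMap.zero_apply,
    Submodule.Quotient.mk_eq_zero] at h2

/-- The maximal minors of a family of `n` vectors in a free module of rank `n + l` are, up to sign,
the coordinates of the wedge product of the family. -/
theorem span_det_eq_map :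
    Ideal.span {δ : A | ∃ φ : Fin n → Module.Dual A Z, δ = (Matrix.of fun j i => φ j (c i)).det}
      = (⋀[A]^l Z).map (detOn ζ ∘ₗ LinearMap.mulLeft A (ιMulti A n c)) := by
  apply le_antisymm
  · refine Ideal.span_le.2 ?_
    rintro _ ⟨φ, rfl⟩
    let J : Ideal A := (⋀[A]^l Z).map (detOn ζ ∘ₗ LinearMap.mulLeft A (ιMulti A n c))
    let f : Module.Dual A Z [⋀^Fin n]→ₗ[A] A := Matrix.detRowAlternating.compLinearMap
      (LinearMap.pi fun i => LinearMap.applyₗ (c i))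
    refine AlternatingMap.mem_of_forall_injective (M := Module.Dual A Z) ζ.dualBasis f J
      (fun v hv => ?_) φ
    -- The `n` chosen coordinates are completed to a permutation; the other `l` basis vectors form
    -- the complementary form that extracts this minor.
    obtain ⟨σ, hσ⟩ := Equiv.Perm.exists_comp_eq (Fin.castAdd_injective n l) hv
    have h1 : f (fun k => ζ.dualBasis (v k))
        = (Matrix.of fun j i : Fin n => ζ.coord (σ (Fin.castAdd l j)) (c i)).det := by
      simp only [hσ]
      change Matrix.det _ = _
      congr 1
      ext j i
      simp
    refine ⟨(Equiv.Perm.sign σ : A) • ιMulti A l (fun j => ζ (σ (Fin.natAdd n j))),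
      Submodule.smul_mem _ _ (ιMulti_range _ _ ⟨_, rfl⟩), ?_⟩
    rw [LinearMap.map_smul, LinearMap.comp_apply, LinearMap.mulLeft_apply, ιMulti_mul_ιMulti,
      detOn_ιMulti, basis_det_append, h1, smul_eq_mul, ← mul_assoc, ← Int.cast_mul,
      Int.units_coe_mul_self, Int.cast_one, one_mul]
  · rw [Submodule.map_le_iff_le_comap, ← ιMulti_span_fixedDegree, Submodule.span_le]
    rintro _ ⟨w, rfl⟩
    let J := Ideal.span
      {δ : A | ∃ φ : Fin n → Module.Dual A Z, δ = (Matrix.of fun j i => φ j (c i)).det}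
    refine AlternatingMap.mem_of_forall_injective ζ ((detOn ζ ∘ₗ
      LinearMap.mulLeft A (ιMulti A n c)).compAlternatingMap (ιMulti A l)) J (fun v hv => ?_) w
    obtain ⟨σ, hσ⟩ := Equiv.Perm.exists_comp_eq (Fin.natAdd_injective l n) hv
    rw [LinearMap.compAlternatingMap_apply, LinearMap.comp_apply, LinearMap.mulLeft_apply,
      ιMulti_mul_ιMulti, detOn_ιMulti]
    simp only [← hσ]
    rw [basis_det_append]
    exact Ideal.mul_mem_left _ _ (Ideal.subset_span ⟨_, rfl⟩)

end ExteriorAlgebra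

/-! ### `Ext¹` as a cokernel of dual modules, its localization and its Fitting ideal. -/

namespace PerfDet

open Abelian in
/-- `Ext¹` of a quotient of a projective module is the cokernel of the restriction of functionals to
the kernel. -/
theorem exists_dual_ker_ext {R : Type u} [CommRing R] {F : Type u} [AddCommGroup F] [Module R F]
    [Module.Projective R F] (H : ModuleCat.{u} R) (π : F →ₗ[R] H) (hπ : Function.Surjective π) :
    ∃ ψ : Module.Dual R (LinearMap.ker π) →ₗ[R] E 1 H, Function.Surjective ψ ∧
      ∀ φ, ψ φ = 0 ↔ ∃ χ : Module.Dual R F, χ ∘ₗ (LinearMap.ker π).subtype = φ := by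
  have hS := LinearMap.shortExact_shortComplexKer hπ
  let Y := ModuleCat.of R R
  let e : Module.Dual R (LinearMap.ker π) ≃ₗ[R] Ext (ModuleCat.of R (LinearMap.ker π)) Y 0 :=
    (ModuleCat.homLinearEquiv (S := R) (M := ModuleCat.of R (LinearMap.ker π)) (N := Y)).symm.trans
      (Ext.linearEquiv₀ (R := R)).symm
  have he : ∀ φ, e φ = Ext.mk₀ (ModuleCat.ofHom φ) := fun φ => rfl
  refine ⟨(hS.extClass.precompOfLinear R Y (add_zero 1)) ∘ₗ e.toLinearMap, ?_, fun φ => ?_⟩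
  · exact (precomp_extClass_surjective_of_projective_X₂ Y hS 0).comp e.surjective
  · constructor
    · intro h
      obtain ⟨x, hx⟩ := Ext.contravariant_sequence_exact₁ hS Y (e φ) (add_zero 1) h
      obtain ⟨χ, rfl⟩ := Ext.mk₀_bijective _ _ |>.surjective x
      refine ⟨χ.hom, ?_⟩
      rw [Ext.mk₀_comp_mk₀] at hx
      have := (Ext.mk₀_bijective _ _).injective hx
      exact congrArg (fun g => g.hom) this
    · rintro ⟨χ, rfl⟩
      have h1 : e (χ ∘ₗ (LinearMap.ker π).subtype)
          = (Ext.mk₀ (LinearMap.shortComplexKer π).f).comp (Ext.mk₀ (ModuleCat.ofHom χ))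
            (zero_add 0) := by
        rw [he, Ext.mk₀_comp_mk₀]; rfl
      change hS.extClass.comp (e _) (add_zero 1) = 0
      rw [h1, ShortComplex.ShortExact.extClass_comp_assoc]

/-- `Ext¹` of a quotient of a projective module is the cokernel of the restriction of functionals to
the relations. -/
theorem exists_dual_ext {R : Type u} [CommRing R] {F N : Type u} [AddCommGroup F] [Module R F]
    [Module.Projective R F] [AddCommGroup N] [Module R N] (H : ModuleCat.{u} R) (i : N →ₗ[R] F)
    (π : F →ₗ[R] H) (hi : Function.Injective i) (hiπ : Function.Exact i π)
    (hπ : Function.Surjective π) :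
    ∃ ψ : Module.Dual R N →ₗ[R] E 1 H, Function.Surjective ψ ∧
      ∀ φ, ψ φ = 0 ↔ ∃ χ : Module.Dual R F, χ ∘ₗ i = φ := by
  obtain ⟨ψ, h1, h2⟩ := exists_dual_ker_ext H π hπ
  let e : N ≃ₗ[R] LinearMap.ker π :=
    (LinearEquiv.ofInjective i hi).trans (LinearEquiv.ofEq _ _ (LinearMap.exact_iff.1 hiπ).symm)
  have he : (LinearMap.ker π).subtype ∘ₗ e.toLinearMap = i := rfl
  refine ⟨ψ ∘ₗ (LinearEquiv.dualMap e.symm).toLinearMap,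
    h1.comp (LinearEquiv.dualMap e.symm).surjective, fun φ => ?_⟩
  have h3 : (ψ ∘ₗ (LinearEquiv.dualMap e.symm).toLinearMap) φ = ψ (φ ∘ₗ e.symm.toLinearMap) := rfl
  rw [h3, h2]
  refine exists_congr fun χ => ?_
  rw [← he, ← LinearMap.comp_assoc]
  constructor
  · intro h
    rw [h, LinearMap.comp_assoc, LinearEquiv.symm_comp, LinearMap.comp_id]
  · rintro rfl
    rw [LinearMap.comp_assoc, LinearEquiv.comp_symm, LinearMap.comp_id]

section Localization

variable {R : Type u} [CommRing R] (S : Submonoid R)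

/-- The functional on the localization of a module induced by a functional on the module. -/
noncomputable def dualLoc (N : Type*) [AddCommGroup N] [Module R N] :
    Module.Dual R N →ₗ[R] Module.Dual (Localization S) (LocalizedModule S N) :=
  IsLocalizedModule.mapExtendScalars S (LocalizedModule.mkLinearMap S N)
    (Algebra.linearMap R (Localization S)) (Localization S)

instance (N : Type*) [AddCommGroup N] [Module R N] [Module.FinitePresentation R N] :
    IsLocalizedModule S (dualLoc S N) :=
  Module.FinitePresentation.isLocalizedModule_mapExtendScalars _ _ _ _

theorem dualLoc_mk {N : Type*} [AddCommGroup N] [Module R N] (φ : Module.Dual R N) (x : N) :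
    dualLoc S N φ (LocalizedModule.mkLinearMap S N x) = algebraMap R (Localization S) (φ x) :=
  IsLocalizedModule.map_apply S (LocalizedModule.mkLinearMap S N)
    (Algebra.linearMap R (Localization S)) φ x

/-- `Ext¹` of a finite module over a noetherian ring commutes with localization. -/
theorem exists_localizedModule_ext_equiv [IsNoetherianRing R] (H : ModuleCat.{u} R)
    [Module.Finite R H] :
    Nonempty (LocalizedModule S (E 1 H) ≃ₗ[Localization S]
      E 1 (ModuleCat.of (Localization S) (LocalizedModule S H))) := by
  obtain ⟨k, π, hπ⟩ := Module.Finite.exists_fin' R H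
  let F := Fin k → R
  let N := LinearMap.ker π
  let i : N →ₗ[R] F := N.subtype
  have hi : Function.Injective i := N.subtype_injective
  have hiπ : Function.Exact i π := LinearMap.exact_subtype_ker_map π
  obtain ⟨δ, hδ, hδ'⟩ := exists_dual_ext H i π hi hiπ hπ
  obtain ⟨ψ, hψ, hψ'⟩ := exists_dual_ext
    (F := LocalizedModule S F) (N := LocalizedModule S N)
    (H := ModuleCat.of (Localization S) (LocalizedModule S H)) (i := LocalizedModule.map S i)
    (π := LocalizedModule.map S π) (LocalizedModule.injective_map S hi)
    (LocalizedModule.exact_map S hiπ) (LocalizedModule.surjective_map S hπ)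
  have : Module.FinitePresentation R N := Module.finitePresentation_of_finite R N
  let r : Module.Dual R F →ₗ[R] Module.Dual R N := LinearMap.lcomp R R i
  have hr : Function.Exact r δ := fun φ => hδ' φ
  let Θ : Module.Dual (Localization S) (LocalizedModule S N) →ₗ[Localization S]
      LocalizedModule S (E 1 H) :=
    IsLocalizedModule.mapExtendScalars S (dualLoc S N) (LocalizedModule.mkLinearMap S (E 1 H))
      (Localization S) δ
  have hΘ : Function.Surjective Θ :=
    IsLocalizedModule.map_surjective S (dualLoc S N) (LocalizedModule.mkLinearMap S (E 1 H)) δ hδ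
  have hex : Function.Exact (IsLocalizedModule.map S (dualLoc S F) (dualLoc S N) r) Θ :=
    IsLocalizedModule.map_exact S (dualLoc S F) (dualLoc S N)
      (LocalizedModule.mkLinearMap S (E 1 H)) r δ hr
  -- Duals of finitely presented modules commute with localization, and restriction of functionals
  -- is compatible with this. Hence the localized cokernel and the one computing `Ext¹` of the
  -- localized module are quotients by the same submodule.
  have hr' : IsLocalizedModule.map S (dualLoc S F) (dualLoc S N) r
      = (LinearMap.lcomp (Localization S) (Localization S)
          (LocalizedModule.map S i)).restrictScalars R := by
    refine IsLocalizedModule.linearMap_ext S (dualLoc S F) (dualLoc S N) ?_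
    rw [IsLocalizedModule.map_comp]
    refine LinearMap.ext fun φ => ?_
    refine LinearMap.restrictScalars_injective R ?_
    refine IsLocalizedModule.linearMap_ext S (LocalizedModule.mkLinearMap S N)
      (Algebra.linearMap R (Localization S)) (LinearMap.ext fun x => ?_)
    have h1 : LocalizedModule.map S i (LocalizedModule.mkLinearMap S N x)
        = LocalizedModule.mkLinearMap S F (i x) :=
      IsLocalizedModule.map_apply S (LocalizedModule.mkLinearMap S N)
        (LocalizedModule.mkLinearMap S F) i x
    calc _ = algebraMap R (Localization S) (φ (i x)) := dualLoc_mk S (r φ) x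
      _ = dualLoc S F φ (LocalizedModule.mkLinearMap S F (i x)) := (dualLoc_mk S φ (i x)).symm
      _ = _ := by rw [← h1]; rfl
  have hker : LinearMap.ker Θ = LinearMap.ker ψ := by
    ext φ
    rw [LinearMap.mem_ker, LinearMap.mem_ker, hψ', hex φ, hr']
    rfl
  exact ⟨(Θ.quotKerEquivOfSurjective hΘ).symm.trans
    ((Submodule.quotEquivOfEq _ _ hker).trans (ψ.quotKerEquivOfSurjective hψ))⟩

/-- If the module `H_S` is the quotient of a free module by a free submodule with basis `c`, the
localization of the Fitting ideal of `Ext¹(H, R)` is generated by the maximal minors of `c`. -/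
theorem map_fitting_ext [IsNoetherianRing R] (H : ModuleCat.{u} R) [Module.Finite R H]
    {Z : Type u} [AddCommGroup Z] [Module (Localization S) Z] [Module.Projective (Localization S) Z]
    (π : Z →ₗ[Localization S] LocalizedModule S H) (hπ : Function.Surjective π) {n : ℕ}
    (c : Module.Basis (Fin n) (Localization S) (LinearMap.ker π)) :
    (fitting R (E 1 H)).map (algebraMap R (Localization S))
      = Ideal.span {δ : Localization S | ∃ φ : Fin n → Module.Dual (Localization S) Z,
          δ = (Matrix.of fun j i => φ j (c i)).det} := by
  obtain ⟨e⟩ := exists_localizedModule_ext_equiv S H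
  obtain ⟨ψ, hψ, hψ'⟩ := exists_dual_ker_ext
    (ModuleCat.of (Localization S) (LocalizedModule S H)) π hπ
  have : Module.Finite R (E 1 H) := ModuleCat.finite_ext R H (ModuleCat.of R R) 1
  obtain ⟨k, g, hg⟩ := Submodule.fg_iff_exists_fin_generating_family.1
    (Module.Finite.fg_top (R := R) (M := E 1 H))
  have h1 : Submodule.span (Localization S)
      (Set.range fun i => LocalizedModule.mkLinearMap S (E 1 H) (g i)) = ⊤ := by
    rw [Set.range_comp' _ g]
    exact span_eq_top_of_isLocalizedModule (Localization S) S
      (LocalizedModule.mkLinearMap S (E 1 H)) hg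
  -- `Ext¹` is a quotient of the dual of the relation module, so the dual basis of `c` yields
  -- generators.
  have h2 : Submodule.span (Localization S) (Set.range fun i => e.symm (ψ (c.coord i))) = ⊤ := by
    have h3 : (fun i => e.symm (ψ (c.coord i)))
        = (e.symm.toLinearMap ∘ₗ ψ) ∘ c.dualBasis := by
      funext i
      simp
    rw [h3, Set.range_comp, Submodule.span_image, c.dualBasis.span_eq, Submodule.map_top,
      LinearMap.range_eq_top]
    exact e.symm.surjective.comp hψ
  rw [fitting_eq_relDet g hg, relDet_localized, relDet_eq _ _ h1 h2, relDet]
  congr 1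
  ext δ
  -- A vector is a relation between these generators exactly when the functional with these values
  -- on `c` extends to `Z`. Square matrices of relations are therefore the matrices `φ j (c i)`.
  have h4 : ∀ v : Fin n → Localization S, ∑ i, v i • e.symm (ψ (c.coord i)) = 0 ↔
      ∃ χ : Module.Dual (Localization S) Z, ∀ i, χ (c i) = v i := by
    intro v
    have h5 : ∑ i, v i • e.symm (ψ (c.coord i)) = e.symm (ψ (∑ i, v i • c.coord i)) := by
      simp
    have h6 : ∀ j, (∑ i, v i • c.coord i) (c j) = v j := by
      intro j
      simp [LinearMap.sum_apply, Finsupp.single_apply]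
    rw [h5, LinearEquiv.map_eq_zero_iff, hψ']
    refine exists_congr fun χ => ⟨?_, fun h => c.ext fun j => ?_⟩
    · intro h i
      rw [← h6 i, ← h]
      rfl
    · rw [h6, ← h]
      rfl
  constructor
  · rintro ⟨V, hV, rfl⟩
    choose φ hφ using fun j => (h4 _).1 (hV j)
    refine ⟨φ, congrArg Matrix.det ?_⟩
    ext j i
    exact (hφ j i).symm
  · rintro ⟨φ, rfl⟩
    exact ⟨_, fun j => (h4 _).2 ⟨φ j, fun i => rfl⟩, rfl⟩

/-- Two ideals that agree at all primes disjoint from a multiplicative set agree after inverting it. -/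
theorem map_le_map_of_forall_prime {I J : Ideal R}
    (h : ∀ p : PrimeSpectrum R, Disjoint (p.asIdeal : Set R) S →
      I.map (algebraMap R (Localization p.asIdeal.primeCompl))
        ≤ J.map (algebraMap R (Localization p.asIdeal.primeCompl))) :
    I.map (algebraMap R (Localization S)) ≤ J.map (algebraMap R (Localization S)) := by
  refine Ideal.map_le_iff_le_comap.2 fun x hx => ?_
  rw [Ideal.mem_comap, IsLocalization.algebraMap_mem_map_algebraMap_iff S]
  by_contra! hc
  obtain ⟨p, hp, hJp, hd⟩ := Ideal.exists_le_prime_disjoint (Submodule.comap (LinearMap.mulRight R x) J) S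
    (Set.disjoint_left.2 fun m hm hmS => hc m hmS hm)
  have h1 := h ⟨p, hp⟩ hd (Ideal.mem_map_of_mem _ hx)
  obtain ⟨m, hm, hmx⟩ :=
    (IsLocalization.algebraMap_mem_map_algebraMap_iff p.primeCompl _ J x).1 h1
  exact hm (hJp hmx)

theorem map_eq_map_of_forall_prime {I J : Ideal R}
    (h : ∀ p : PrimeSpectrum R, Disjoint (p.asIdeal : Set R) S →
      I.map (algebraMap R (Localization p.asIdeal.primeCompl))
        = J.map (algebraMap R (Localization p.asIdeal.primeCompl))) :
    I.map (algebraMap R (Localization S)) = J.map (algebraMap R (Localization S)) :=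
  le_antisymm (map_le_map_of_forall_prime S fun p hp => (h p hp).le)
    (map_le_map_of_forall_prime S fun p hp => (h p hp).ge)

end Localization

end PerfDet

/-! ### The image of the natural map at a prime. -/

namespace PerfDet

open ExteriorAlgebra

variable {R : Type u} [CommRing R] {P K : CochainComplex (ModuleCat.{u} R) ℤ} {p : PrimeSpectrum R}
  {a b : ℤ} {f : P ⟶ K} {β : ℤ → PrimeSpectrum R → ℕ} {l : PrimeSpectrum R → ℕ}

theorem finite_cycles [IsNoetherianRing R] (hP : IsStrictlyPerfect a b P) (i : ℤ) :
    Module.Finite R (P.cycles i) := by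
  have := hP.finite i
  exact Module.Finite.of_injective (P.iCycles i).hom (iCycles_injective P i)

theorem finite_homology [IsNoetherianRing R] (f : P ⟶ K) [QuasiIso f] (hP : IsStrictlyPerfect a b P)
    (i : ℤ) : Module.Finite R (K.homology i) := by
  have := finite_cycles hP i
  exact Module.Finite.of_surjective (cocycleClass f i) (cocycleClass_surjective f i)

/-- At a prime where the coboundaries are free, the image of the natural map is the Fitting ideal of
`Ext¹(H¹, R)`. -/
theorem IsScalar.map_range_eq [QuasiIso f] [IsNoetherianRing R]
    {γ : ∀ i, topPow R (P.X i) ≃ₗ[R] R} {ψ : extPow R l (K.homology 1) →ₗ[R] R}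
    (hψ : IsScalar f a b β γ ψ) (hP : IsStrictlyPerfect a b P) (ha : a ≤ 1) (hb : 1 ≤ b)
    (h : RankCond P β l) (hE : ExactOffOne P p)
    (h0 : Module.Free (Localization p.asIdeal.primeCompl) (LinearMap.range (dLoc P p 0 1))) :
    Ideal.map (algebraMap R (Localization p.asIdeal.primeCompl)) (LinearMap.range ψ)
      = (fitting R (E 1 (K.homology 1))).map (algebraMap R (Localization p.asIdeal.primeCompl)) := by
  have hl := h.isLocallyConstant_degree hP ha hb
  have := finite_homology f hP 1
  obtain ⟨ζ, c, κ, hκ⟩ := hψ.local_formula hP ha hb h hE h0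
  have := Module.Projective.of_basis ζ
  rw [map_fitting_ext p.asIdeal.primeCompl (K.homology 1) (πLoc f p) (πLoc_surjective f) c,
    span_det_eq_map ζ]
  apply le_antisymm
  · refine Ideal.map_le_iff_le_comap.2 ?_
    rintro _ ⟨z, rfl⟩
    obtain ⟨y, rfl⟩ := exists_extClass_eq f hl z
    rw [Ideal.mem_comap, hκ]
    exact Ideal.mul_mem_left _ _ ⟨_, locMap_mem_of_mem_extPow p hl y.2, rfl⟩
  · rintro _ ⟨x, hx, rfl⟩
    obtain ⟨t, ht, y, hy, hxy⟩ := exists_smul_eq_locMap_extPow p hl hx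
    have h1 := hκ ⟨y, hy⟩
    rw [hxy, mul_smul_comm, LinearMap.map_smul, smul_eq_mul, ← mul_assoc] at h1
    refine (Ideal.unit_mul_mem_iff_mem _ (κ.isUnit.mul (isUnit_algebraMap_of_notMem ht))).1 ?_
    refine (congrArg (· ∈ _) h1).mp ?_
    exact Ideal.mem_map_of_mem _ ⟨_, rfl⟩

end PerfDet

/-! ### Bijectivity where the first cohomology is free. -/

namespace PerfDet

open ExteriorAlgebra

section

variable {R : Type u} [CommRing R]

theorem exists_smul_mkLinearMap_mem_span {H : Type*} [AddCommGroup H] [Module R H] {ι : Type*}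
    [Fintype ι] {p : PrimeSpectrum R} (m : ι → H)
    (hm : ⊤ ≤ Submodule.span (Localization p.asIdeal.primeCompl)
      (Set.range fun i => LocalizedModule.mkLinearMap p.asIdeal.primeCompl H (m i))) (x : H) :
    ∃ t ∉ p.asIdeal, t • x ∈ Submodule.span R (Set.range m) := by
  obtain ⟨c, hc⟩ := (Submodule.mem_span_range_iff_exists_fun _).1
    (hm (Submodule.mem_top (x := LocalizedModule.mkLinearMap p.asIdeal.primeCompl H x)))
  obtain ⟨s, hs⟩ := IsLocalization.exist_integer_multiples_of_finite p.asIdeal.primeCompl c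
  choose r hr using hs
  have h1 : LocalizedModule.mkLinearMap p.asIdeal.primeCompl H (∑ i, r i • m i)
      = LocalizedModule.mkLinearMap p.asIdeal.primeCompl H ((s : R) • x) := by
    rw [map_sum, map_smul, ← hc, Finset.smul_sum]
    refine Finset.sum_congr rfl fun i _ => ?_
    rw [map_smul, ← algebraMap_smul (Localization p.asIdeal.primeCompl) (r i), hr,
      smul_assoc]
  obtain ⟨t, ht⟩ := IsLocalizedModule.exists_of_eq (S := p.asIdeal.primeCompl) h1
  refine ⟨t * s, fun h => (p.2.mem_or_mem h).elim t.2 s.2, ?_⟩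
  have h2 : (t : R) • ∑ i, r i • m i = (t : R) • (s : R) • x := ht
  rw [mul_smul, ← h2]
  exact Submodule.smul_mem _ _ (Submodule.sum_mem _ fun i _ =>
    Submodule.smul_mem _ _ (Submodule.subset_span ⟨i, rfl⟩))

/-- Elements that give a basis of the localization of a module at a prime also give a basis at the
smaller primes. -/
theorem exists_basis_of_le {H : Type*} [AddCommGroup H] [Module R H] {ι : Type*} [Fintype ι]
    {p p' : PrimeSpectrum R} (hp : p' ≤ p) (m : ι → H)
    (B : Module.Basis ι (Localization p.asIdeal.primeCompl)
      (LocalizedModule p.asIdeal.primeCompl H))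
    (hB : ∀ i, B i = LocalizedModule.mkLinearMap _ H (m i)) :
    ∃ B' : Module.Basis ι (Localization p'.asIdeal.primeCompl)
      (LocalizedModule p'.asIdeal.primeCompl H),
      ∀ i, B' i = LocalizedModule.mkLinearMap _ H (m i) := by
  have hB' : (fun i => LocalizedModule.mkLinearMap p.asIdeal.primeCompl H (m i)) = B :=
    funext fun i => (hB i).symm
  have hli : LinearIndependent (Localization p'.asIdeal.primeCompl)
      fun i => LocalizedModule.mkLinearMap p'.asIdeal.primeCompl H (m i) := by
    refine Fintype.linearIndependent_iff.2 fun c hc i => ?_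
    obtain ⟨s, hs⟩ := IsLocalization.exist_integer_multiples_of_finite p'.asIdeal.primeCompl c
    choose r hr using hs
    have h1 : LocalizedModule.mkLinearMap p'.asIdeal.primeCompl H (∑ i, r i • m i) = 0 := by
      rw [map_sum]
      calc _ = ∑ i, (s : R) • (c i • LocalizedModule.mkLinearMap p'.asIdeal.primeCompl H (m i)) := by
            refine Finset.sum_congr rfl fun i _ => ?_
            rw [map_smul, ← algebraMap_smul (Localization p'.asIdeal.primeCompl) (r i), hr,
              smul_assoc]
        _ = 0 := by rw [← Finset.smul_sum, hc, smul_zero]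
    obtain ⟨t, ht⟩ := (IsLocalizedModule.eq_zero_iff p'.asIdeal.primeCompl
      (LocalizedModule.mkLinearMap p'.asIdeal.primeCompl H)).1 h1
    have h2 : (t : R) • ∑ i, r i • m i = 0 := ht
    have h3 := congrArg (LocalizedModule.mkLinearMap p.asIdeal.primeCompl H) h2
    rw [map_smul, map_sum, map_zero, Finset.smul_sum] at h3
    have h4 : ∑ i, algebraMap R (Localization p.asIdeal.primeCompl) (t * r i) • B i = 0 := by
      rw [← h3]
      refine Finset.sum_congr rfl fun i _ => ?_
      rw [hB, map_smul, algebraMap_smul, mul_smul]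
    have h5 := Fintype.linearIndependent_iff.1 B.linearIndependent _ h4 i
    obtain ⟨w, hw⟩ := (IsLocalization.map_eq_zero_iff p.asIdeal.primeCompl _ _).1 h5
    have h6 : algebraMap R (Localization p'.asIdeal.primeCompl) (r i) = 0 := by
      refine (IsLocalization.map_eq_zero_iff p'.asIdeal.primeCompl _ _).2
        ⟨⟨w * t, fun h => (p'.2.mem_or_mem h).elim (fun h' => w.2 (hp h')) t.2⟩, ?_⟩
      rw [mul_assoc]; exact hw
    have h7 : algebraMap R (Localization p'.asIdeal.primeCompl) s * c i = 0 := by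
      rw [← Algebra.smul_def, ← hr i, h6]
    exact (IsUnit.mul_right_eq_zero (isUnit_algebraMap_of_notMem s.2)).1 h7
  have hspan : ⊤ ≤ Submodule.span (Localization p'.asIdeal.primeCompl)
      (Set.range fun i => LocalizedModule.mkLinearMap p'.asIdeal.primeCompl H (m i)) := by
    intro y _
    obtain ⟨⟨x, s⟩, hx⟩ := IsLocalizedModule.surj p'.asIdeal.primeCompl
      (LocalizedModule.mkLinearMap p'.asIdeal.primeCompl H) y
    obtain ⟨t, ht, htx⟩ := exists_smul_mkLinearMap_mem_span (p := p) m
      (by rw [hB', B.span_eq]) x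
    have h1 : (t * s : R) • y = LocalizedModule.mkLinearMap p'.asIdeal.primeCompl H (t • x) := by
      rw [map_smul, ← hx, mul_smul]; rfl
    have h2 : LocalizedModule.mkLinearMap p'.asIdeal.primeCompl H (t • x) ∈
        Submodule.span (Localization p'.asIdeal.primeCompl)
          (Set.range fun i => LocalizedModule.mkLinearMap p'.asIdeal.primeCompl H (m i)) := by
      have h3 : Submodule.span R (Set.range m) ≤ (Submodule.restrictScalars R
          (Submodule.span (Localization p'.asIdeal.primeCompl) (Set.range fun i =>
            LocalizedModule.mkLinearMap p'.asIdeal.primeCompl H (m i)))).comap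
          (LocalizedModule.mkLinearMap p'.asIdeal.primeCompl H) := by
        rw [Submodule.span_le]
        rintro _ ⟨i, rfl⟩
        exact Submodule.subset_span ⟨i, rfl⟩
      exact h3 htx
    rw [← h1, ← algebraMap_smul (Localization p'.asIdeal.primeCompl)] at h2
    exact (Submodule.smul_mem_iff_of_isUnit _ (isUnit_algebraMap_of_notMem
      fun h => (p'.2.mem_or_mem h).elim (fun h' => ht (hp h')) s.2)).1 h2
  exact ⟨Module.Basis.mk hli hspan, fun i => by rw [Module.Basis.mk_apply]⟩

/-- A basis of a localization can be chosen among the images of elements of the module. -/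
theorem exists_basis_mkLinearMap {H : Type*} [AddCommGroup H] [Module R H] {ι : Type*}
    {p : PrimeSpectrum R} (B : Module.Basis ι (Localization p.asIdeal.primeCompl)
      (LocalizedModule p.asIdeal.primeCompl H)) :
    ∃ (m : ι → H) (B' : Module.Basis ι (Localization p.asIdeal.primeCompl)
      (LocalizedModule p.asIdeal.primeCompl H)),
      ∀ i, B' i = LocalizedModule.mkLinearMap _ H (m i) := by
  choose ms hms using fun i => IsLocalizedModule.surj p.asIdeal.primeCompl
    (LocalizedModule.mkLinearMap p.asIdeal.primeCompl H) (B i)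
  have hu : ∀ i, IsUnit (algebraMap R (Localization p.asIdeal.primeCompl) (ms i).2) :=
    fun i => isUnit_algebraMap_of_notMem (ms i).2.2
  refine ⟨fun i => (ms i).1, B.isUnitSMul hu, fun i => ?_⟩
  rw [Module.Basis.isUnitSMul_apply, algebraMap_smul, ← hms]
  rfl

/-- A linear map is bijective after inverting a multiplicative set if it is so at the primes disjoint
from it. -/
theorem bijective_localizedModule_map {M N : Type*} [AddCommGroup M] [Module R M] [AddCommGroup N]
    [Module R N] (S : Submonoid R) (g : M →ₗ[R] N)
    (hinj : ∀ p : PrimeSpectrum R, Disjoint (p.asIdeal : Set R) S →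
      ∀ x, g x = 0 → ∃ t ∉ p.asIdeal, t • x = 0)
    (hsurj : ∀ p : PrimeSpectrum R, Disjoint (p.asIdeal : Set R) S →
      ∀ y, ∃ t ∉ p.asIdeal, ∃ x, g x = t • y) :
    Function.Bijective (LocalizedModule.map S g) := by
  -- An ideal that misses `S` lies in a prime disjoint from `S`, so an ideal contained in no such
  -- prime meets `S`.
  have key : ∀ I : Ideal R, (∀ p : PrimeSpectrum R, Disjoint (p.asIdeal : Set R) S →
      ∃ t ∉ p.asIdeal, t ∈ I) → ∃ s : S, (s : R) ∈ I := by
    intro I hI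
    by_contra! hc
    obtain ⟨p, hp, hIp, hd⟩ := Ideal.exists_le_prime_disjoint I S
      (Set.disjoint_left.2 fun m hm hmS => hc ⟨m, hmS⟩ hm)
    obtain ⟨t, ht, htI⟩ := hI ⟨p, hp⟩ hd
    exact ht (hIp htI)
  constructor
  · refine IsLocalizedModule.injective_of_map_zero S (LocalizedModule.mkLinearMap S M)
      (g := (LocalizedModule.map S g).restrictScalars R) fun x hx => ?_
    have hx' : LocalizedModule.mkLinearMap S N (g x) = 0 :=
      (IsLocalizedModule.map_apply S (LocalizedModule.mkLinearMap S M)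
        (LocalizedModule.mkLinearMap S N) g x).symm.trans hx
    obtain ⟨c, hc⟩ := (IsLocalizedModule.eq_zero_iff S (LocalizedModule.mkLinearMap S N)).1 hx'
    have hc' : g ((c : R) • x) = 0 := by rw [map_smul]; exact hc
    obtain ⟨t, ht⟩ := key (Ideal.torsionOf R M ((c : R) • x)) fun p hp => by
      obtain ⟨t, ht, htx⟩ := hinj p hp _ hc'
      exact ⟨t, ht, (Ideal.mem_torsionOf_iff _ _).2 htx⟩
    refine (IsLocalizedModule.eq_zero_iff S (LocalizedModule.mkLinearMap S M)).2 ⟨t * c, ?_⟩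
    rw [mul_smul]
    exact (Ideal.mem_torsionOf_iff _ _).1 ht
  · intro y
    induction y using LocalizedModule.induction_on with
    | h y s =>
      obtain ⟨t, x, hx⟩ := key ((LinearMap.range g).comap (LinearMap.toSpanSingleton R N y))
        fun p hp => by
          obtain ⟨t, ht, x, hx⟩ := hsurj p hp y
          exact ⟨t, ht, x, hx⟩
      refine ⟨LocalizedModule.mk x (t * s), ?_⟩
      rw [LocalizedModule.map_mk, hx, LinearMap.toSpanSingleton_apply]
      exact LocalizedModule.mk_cancel_common_left t s y

end

variable {R : Type u} [CommRing R] {P K : CochainComplex (ModuleCat.{u} R) ℤ} {p : PrimeSpectrum R}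
  {a b : ℤ} {f : P ⟶ K} {β : ℤ → PrimeSpectrum R → ℕ} {l : PrimeSpectrum R → ℕ}
  {γ : ∀ i, topPow R (P.X i) ≃ₗ[R] R}

/-- A basis of the cohomology at `p` has `l p` elements. -/
theorem exists_basis_homology [QuasiIso f] [IsNoetherianRing R]
    (hP : IsStrictlyPerfect a b P) (ha : a ≤ 1) (hb : 1 ≤ b) (h : RankCond P β l)
    (hE : ∀ p : PrimeSpectrum R, p.asIdeal.height ≤ 1 → ExactOffOne P p)
    (hH : Module.Free (Localization p.asIdeal.primeCompl)
      (LocalizedModule p.asIdeal.primeCompl (K.homology 1))) :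
    ∃ (m : Fin (l p) → K.homology 1) (B : Module.Basis (Fin (l p))
      (Localization p.asIdeal.primeCompl) (LocalizedModule p.asIdeal.primeCompl (K.homology 1))),
      ∀ i, B i = LocalizedModule.mkLinearMap _ _ (m i) := by
  have hl := h.isLocallyConstant_degree hP ha hb
  have := finite_homology f hP 1
  obtain ⟨m, B, hB⟩ := exists_basis_mkLinearMap (Module.finBasis (Localization p.asIdeal.primeCompl)
    (LocalizedModule p.asIdeal.primeCompl (K.homology 1)))
  -- The number of basis elements is identified at a minimal prime below `p`, where the rank is
  -- known to be `l` and the same elements remain a basis.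
  obtain ⟨q, hq, hq0⟩ := exists_minimal_le p
  have hq1 : q.asIdeal.height ≤ 1 := by rw [hq0]; exact zero_le_one
  obtain ⟨B', -⟩ := exists_basis_of_le hq m B hB
  obtain ⟨B''⟩ := finrank_homology f hP ha hb h (hE q hq1)
    (free_range_dLoc_zero_one hP (hE q hq1) hq1)
    (free_homology_of_height_eq_zero f hP (hE q hq1) hq0)
  have h1 : Module.finrank (Localization p.asIdeal.primeCompl)
      (LocalizedModule p.asIdeal.primeCompl (K.homology 1)) = l p := by
    have h2 := Fintype.card_congr (B'.indexEquiv B'')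
    rw [Fintype.card_fin, Fintype.card_fin] at h2
    rw [h2, hl.eq_of_le hq]
  rw [← h1]
  exact ⟨m, B, hB⟩

/-- The element is the wedge of a local basis, cut down by an idempotent. If its image lay in `p`, a
minimal prime over that image inside `p` would have height at most one by Krull's theorem. The basis
persists at this smaller prime, where the local formula makes the image a unit. This carries control
in codimension one to a prime of any height. -/
theorem IsScalar.exists_notMem_of_free [QuasiIso f] [IsNoetherianRing R]
    {ψ : extPow R l (K.homology 1) →ₗ[R] R} (hψ : IsScalar f a b β γ ψ)
    (hP : IsStrictlyPerfect a b P) (ha : a ≤ 1) (hb : 1 ≤ b) (h : RankCond P β l)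
    (hE : ∀ p : PrimeSpectrum R, p.asIdeal.height ≤ 1 → ExactOffOne P p)
    (hH : Module.Free (Localization p.asIdeal.primeCompl)
      (LocalizedModule p.asIdeal.primeCompl (K.homology 1))) :
    ∃ z, ψ z ∉ p.asIdeal := by
  have hl := h.isLocallyConstant_degree hP ha hb
  obtain ⟨m, B, hB⟩ := exists_basis_homology (f := f) hP ha hb h hE hH
  obtain ⟨e, -, hep, he⟩ := exists_smul_mem_extPow hl p
    (x := ιMulti R (l p) m) (ιMulti_range _ _ ⟨_, rfl⟩)
  refine ⟨⟨_, he⟩, fun hmem => ?_⟩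
  obtain ⟨q, hq, hqp⟩ := Ideal.exists_minimalPrimes_le
    (I := Ideal.span {ψ ⟨_, he⟩}) (J := p.asIdeal) ((Ideal.span_singleton_le_iff_mem _).2 hmem)
  have hqprime := hq.1.1
  have hq1 : q.height ≤ 1 := Ideal.height_le_one_of_isPrincipal_of_mem_minimalPrimes _ q hq
  let p' : PrimeSpectrum R := ⟨q, hqprime⟩
  have hp' : p' ≤ p := hqp
  obtain ⟨B', hB'⟩ := exists_basis_of_le hp' m B hB
  -- The degrees at `p'` and `p` are equal but not definitionally so; a free index `n` allows the
  -- substitution.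
  have key : ∀ (n : ℕ) (hn : l p' = n) (m : Fin n → K.homology 1) (B : Module.Basis (Fin n)
      (Localization p'.asIdeal.primeCompl) (LocalizedModule p'.asIdeal.primeCompl (K.homology 1)))
      (hB : ∀ i, B i = LocalizedModule.mkLinearMap _ _ (m i))
      (he : e • ιMulti R n m ∈ extPow R l (K.homology 1)),
      ψ ⟨_, he⟩ ∉ q := by
    rintro n rfl m B hB he
    obtain ⟨κ, hκ⟩ := hψ.local_formula_of_free hP ha hb h (hE p' hq1)
      (free_range_dLoc_zero_one hP (hE p' hq1) hq1) B
    refine notMem_of_isUnit_algebraMap (p := p') ?_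
    have h2 : (fun i => LocalizedModule.mkLinearMap p'.asIdeal.primeCompl _ (m i)) = B :=
      funext fun i => (hB i).symm
    rw [hκ, ← algebraMap_smul_locMap, locMap_ιMulti, LinearMap.map_smul, detOn_ιMulti, h2,
      Module.Basis.det_self, smul_eq_mul, mul_one]
    exact κ.isUnit.mul (isUnit_algebraMap_of_notMem fun h => hep (hp' h))
  exact key (l p) (hl.eq_of_le hp') m B' hB' he (hq.1.2 (Ideal.mem_span_singleton_self _))

/-- At `p` the exterior power has the single coordinate given by `B`, and a non-zero-divisor of `R`
remains one after localization. -/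
theorem exists_smul_eq_zero_of_mem_torsion (hl : IsLocallyConstant l) {H : Type*} [AddCommGroup H]
    [Module R H] (B : Module.Basis (Fin (l p)) (Localization p.asIdeal.primeCompl)
      (LocalizedModule p.asIdeal.primeCompl H)) {z : extPow R l H}
    (hz : z ∈ Submodule.torsion R (extPow R l H)) : ∃ t ∉ p.asIdeal, t • z = 0 := by
  obtain ⟨r, hr⟩ := (Submodule.mem_torsion_iff _).1 hz
  have h1 := eq_detOn_smul B (locMap_mem_of_mem_extPow p hl z.2)
  have h2 : algebraMap R (Localization p.asIdeal.primeCompl) r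
      * detOn B (locMap p.asIdeal.primeCompl H (z : ExteriorAlgebra R H)) = 0 := by
    rw [← smul_eq_mul, ← LinearMap.map_smul, algebraMap_smul_locMap]
    have h3 : (r : R) • (z : ExteriorAlgebra R H) = 0 := congrArg Subtype.val hr
    rw [h3, map_zero, map_zero]
  have h3 : detOn B (locMap p.asIdeal.primeCompl H (z : ExteriorAlgebra R H)) = 0 := by
    have h4 := IsLocalization.map_nonZeroDivisors_le p.asIdeal.primeCompl
      (Localization p.asIdeal.primeCompl) ⟨r, r.2, rfl⟩
    exact (mem_nonZeroDivisors_iff.1 h4).1 _ h2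
  rw [h3, zero_smul] at h1
  obtain ⟨s, hs, hsz⟩ := exists_smul_eq_zero_of_locMap_eq_zero _ h1
  exact ⟨s, hs, Subtype.ext hsz⟩

/-- The natural map is bijective after inverting `S` if the cohomology is free at the primes disjoint
from `S`. -/
theorem IsScalar.bijective [QuasiIso f] [IsNoetherianRing R] (hR : SerreSTwo R)
    {ψ : extPow R l (K.homology 1) →ₗ[R] R} (hψ : IsScalar f a b β γ ψ)
    (hP : IsStrictlyPerfect a b P) (ha : a ≤ 1) (hb : 1 ≤ b) (h : RankCond P β l)
    (hE : ∀ p : PrimeSpectrum R, p.asIdeal.height ≤ 1 → ExactOffOne P p) (S : Submonoid R)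
    (hH : ∀ p : PrimeSpectrum R, Disjoint (p.asIdeal : Set R) S →
      Module.Free (Localization p.asIdeal.primeCompl)
        (LocalizedModule p.asIdeal.primeCompl (K.homology 1)))
    {N : Type*} [AddCommGroup N] [Module R N] (e : N ≃ₗ[R] R) :
    Function.Bijective (LocalizedModule.map S (e.symm.toLinearMap ∘ₗ ψ)) := by
  have hl := h.isLocallyConstant_degree hP ha hb
  refine bijective_localizedModule_map S _ (fun p hp z hz => ?_) fun p hp y => ?_
  · obtain ⟨m, B, -⟩ := exists_basis_homology (f := f) hP ha hb h hE (hH p hp)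
    refine exists_smul_eq_zero_of_mem_torsion hl B ?_
    rw [← hψ.ker_eq_torsion hR hP ha hb h hE, LinearMap.mem_ker]
    exact (LinearEquiv.map_eq_zero_iff e.symm).1 hz
  · obtain ⟨z, hz⟩ := hψ.exists_notMem_of_free hP ha hb h hE (hH p hp)
    refine ⟨ψ z, hz, e y • z, ?_⟩
    rw [LinearMap.comp_apply, map_smul, smul_eq_mul, mul_comm, ← smul_eq_mul, map_smul]
    exact congrArg (ψ z • ·) (e.symm_apply_apply y)

end PerfDet

/-! ### Projective dimension of the cohomology of complexes of small amplitude. -/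

namespace PerfDet

section

variable {A : Type u} [CommRing A]

theorem hasProjectiveDimensionLE_iff_ker {F M : Type u} [AddCommGroup F] [Module A F]
    [AddCommGroup M] [Module A M] [Module.Projective A F] {π : F →ₗ[A] M}
    (hπ : Function.Surjective π) (n : ℕ) :
    HasProjectiveDimensionLE (ModuleCat.of A M) (n + 1)
      ↔ HasProjectiveDimensionLE (ModuleCat.of A (LinearMap.ker π)) n := by
  have h1 := LinearMap.shortExact_shortComplexKer hπ
  have h2 : Projective (ModuleCat.of A F) := (IsProjective.iff_projective F).1 inferInstance
  exact h1.hasProjectiveDimensionLT_X₃_iff n h2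

theorem projective_iff_hasProjectiveDimensionLE (M : Type u) [AddCommGroup M] [Module A M] :
    Module.Projective A M ↔ HasProjectiveDimensionLE (ModuleCat.of A M) 0 := by
  rw [IsProjective.iff_projective M]
  exact projective_iff_hasProjectiveDimensionLT_one

theorem hasProjectiveDimensionLE_equiv {M N : Type u} [AddCommGroup M] [Module A M]
    [AddCommGroup N] [Module A N] (e : M ≃ₗ[A] N) {n : ℕ}
    (h : HasProjectiveDimensionLE (ModuleCat.of A M) n) :
    HasProjectiveDimensionLE (ModuleCat.of A N) n :=
  hasProjectiveDimensionLT_of_iso e.toModuleIso (n + 1)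

theorem hasProjectiveDimensionLE_one_of_exact {N F M : Type u} [AddCommGroup N] [Module A N]
    [AddCommGroup F] [Module A F] [AddCommGroup M] [Module A M] [Module.Projective A N]
    [Module.Projective A F] {i : N →ₗ[A] F} {π : F →ₗ[A] M} (hi : Function.Injective i)
    (h : Function.Exact i π) (hπ : Function.Surjective π) :
    HasProjectiveDimensionLE (ModuleCat.of A M) 1 := by
  refine (hasProjectiveDimensionLE_iff_ker hπ 0).2 ((projective_iff_hasProjectiveDimensionLE _).1 ?_)
  exact Module.Projective.of_equiv ((LinearEquiv.ofInjective _ hi).trans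
    (LinearEquiv.ofEq _ _ (LinearMap.exact_iff.1 h).symm))

/-- A module of projective dimension at most one keeps this property under flat base change. -/
theorem hasProjectiveDimensionLE_baseChange (B : Type u) [CommRing B] [Algebra A B]
    [Module.Flat A B] {M : Type u} [AddCommGroup M] [Module A M]
    (h : HasProjectiveDimensionLE (ModuleCat.of A M) 1) :
    HasProjectiveDimensionLE (ModuleCat.of B (B ⊗[A] M)) 1 := by
  obtain ⟨F, _, _, _, π, hπ⟩ : ∃ (F : Type u) (_ : AddCommGroup F) (_ : Module A F)
      (_ : Module.Projective A F) (π : F →ₗ[A] M), Function.Surjective π :=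
    ⟨M →₀ A, inferInstance, inferInstance, inferInstance, Finsupp.linearCombination A id,
      Finsupp.linearCombination_id_surjective A M⟩
  have h1 : Module.Projective A (LinearMap.ker π) :=
    (projective_iff_hasProjectiveDimensionLE _).2 ((hasProjectiveDimensionLE_iff_ker hπ 0).1 h)
  have h4 : Function.Exact (LinearMap.lTensor B (LinearMap.ker π).subtype) (LinearMap.lTensor B π) :=
    lTensor_exact B (LinearMap.exact_subtype_ker_map π) hπ
  exact hasProjectiveDimensionLE_one_of_exact (i := (LinearMap.ker π).subtype.baseChange B)
    (π := π.baseChange B)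
    (Module.Flat.lTensor_preserves_injective_linearMap _ (Submodule.subtype_injective _)) h4
    (LinearMap.lTensor_surjective B hπ)

variable {L K : CochainComplex (ModuleCat.{u} A) ℤ} (g : L ⟶ K)

theorem subsingleton_homology_of_subsingleton {i : ℤ} [QuasiIso g] (h : Subsingleton (L.X i)) :
    Subsingleton (K.homology i) := by
  have := (iCycles_injective L i).subsingleton
  exact (cocycleClass_surjective g i).subsingleton

/-- The cocycles in the last degree of a strictly perfect complex are projective. -/
theorem projective_cycles {a b : ℤ} (hL : IsStrictlyPerfect a b L) {i j : ℤ} (hij : i + 1 = j)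
    (h : b < j) : Module.Projective A (L.cycles i) := by
  have := hL.projective i
  have := hL.zero_outside j (Or.inr h)
  refine Module.Projective.of_equiv (LinearEquiv.ofBijective (L.iCycles i).hom
    ⟨iCycles_injective L i, fun x => ?_⟩).symm
  exact (exact_iCycles_d L hij x).1 (Subsingleton.elim _ _)

theorem cocycleClass_injective [QuasiIso g] {i j : ℤ} (hij : i + 1 = j) (h : Subsingleton (L.X i)) :
    Function.Injective (cocycleClass g j) := by
  rw [injective_iff_map_eq_zero]
  intro x hx
  obtain ⟨y, rfl⟩ := (exact_toCycles_cocycleClass g hij x).1 hx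
  rw [Subsingleton.elim y 0, map_zero]

theorem ker_toCycles {i j : ℤ} (hij : i + 1 = j) :
    LinearMap.ker (L.toCycles i j).hom = LinearMap.range (L.iCycles i).hom := by
  rw [← LinearMap.exact_iff.1 (exact_iCycles_d L hij)]
  ext x
  rw [LinearMap.mem_ker, LinearMap.mem_ker]
  have h1 := LinearMap.congr_fun (iCycles_comp_toCycles L i j) x
  rw [← h1]
  exact (map_eq_zero_iff _ (iCycles_injective L j)).symm

/-- The first cohomology of a perfect complex of amplitude `[0, 1]` without zeroth cohomology has
projective dimension at most one. -/
theorem hasProjectiveDimensionLE_homology_one (h : InPerf 0 1 K) (h0 : Subsingleton (K.homology 0)) :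
    HasProjectiveDimensionLE (ModuleCat.of A (K.homology 1)) 1 := by
  obtain ⟨L, g, hL, hg⟩ := h
  have := projective_cycles hL (i := 1) (j := 2) rfl (by norm_num)
  have := hL.projective 0
  -- With `H⁰ = 0` and no term in degree -1, the term of degree 0 injects into the cocycles of
  -- degree 1, and the two form a projective resolution of `H¹` of length one.
  have h1 : Function.Injective (L.toCycles 0 1).hom := by
    rw [← LinearMap.ker_eq_bot, ker_toCycles (zero_add 1), LinearMap.range_eq_bot]
    have h2 := (cocycleClass_injective g (i := -1) (j := 0) rfl
      (hL.zero_outside _ (Or.inl (by norm_num)))).subsingleton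
    exact LinearMap.ext fun x => by rw [Subsingleton.elim x 0, map_zero, map_zero]
  exact hasProjectiveDimensionLE_one_of_exact h1
    (exact_toCycles_cocycleClass g (zero_add (1 : ℤ))) (cocycleClass_surjective g 1)

theorem subsingleton_homology_of_inPerf {a b : ℤ} (h : InPerf a b K) {i : ℤ} (hi : i < a ∨ b < i) :
    Subsingleton (K.homology i) := by
  obtain ⟨L, g, hL, hg⟩ := h
  exact subsingleton_homology_of_subsingleton g (hL.zero_outside i hi)

/-- The first cohomology of a perfect complex of amplitude `[1, 2]` is projective if the second one
has projective dimension at most two. -/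
theorem projective_homology_one (h : InPerf 1 2 K)
    (h2 : HasProjectiveDimensionLE (ModuleCat.of A (K.homology 2)) 2) :
    Module.Projective A (K.homology 1) := by
  obtain ⟨L, g, hL, hg⟩ := h
  have := projective_cycles hL (i := 2) (j := 3) rfl (by norm_num)
  have := hL.projective 1
  -- Dimension shifting twice: `H²` is the projective module of 2-cocycles modulo coboundaries, and
  -- the coboundaries are `L¹` modulo the 1-cocycles. The latter are `H¹`, since there is no term in
  -- degree 0.
  have h3 := (hasProjectiveDimensionLE_iff_ker (cocycleClass_surjective g 2) 1).1 h2
  let e := LinearEquiv.ofEq _ _ (LinearMap.exact_iff.1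
    (exact_toCycles_cocycleClass g (i := 1) (j := 2) rfl))
  have h4 := (hasProjectiveDimensionLE_iff_ker (L.toCycles 1 2).hom.surjective_rangeRestrict 0).1
    (hasProjectiveDimensionLE_equiv e h3)
  have h5 := (projective_iff_hasProjectiveDimensionLE _).2 h4
  rw [LinearMap.ker_rangeRestrict, ker_toCycles (i := 1) (j := 2) rfl] at h5
  have e1 := LinearEquiv.ofInjective _ (iCycles_injective L 1)
  have e2 := LinearEquiv.ofBijective (cocycleClass g 1) ⟨cocycleClass_injective g (i := 0) rfl
    (hL.zero_outside _ (Or.inl (by norm_num))), cocycleClass_surjective g 1⟩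
  exact Module.Projective.of_equiv (e1.symm.trans e2)

end

end PerfDet

/-! ### Base change of cohomology and of the local hypotheses. -/

namespace PerfDet

section

variable {R : Type u} [CommRing R] (A : Type u) [CommRing A] [Algebra R A]

open ChangeOfRings in
/-- The functor of extension of scalars along an algebra map, compared with the tensor product. -/
noncomputable def extendScalarsEquiv (M : ModuleCat.{u} R) :
    A ⊗[R] M ≃ₗ[A] (ModuleCat.extendScalars.{u} (algebraMap R A)).obj M := by
  let i : A ≃ₗ[R] (ModuleCat.restrictScalars (algebraMap R A)).obj (ModuleCat.of A A) :=
    { AddEquiv.refl A with map_smul' := fun r x => Algebra.smul_def r x }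
  let T : A ⊗[R] M ≃+ (ModuleCat.extendScalars.{u} (algebraMap R A)).obj M :=
    (TensorProduct.congr i (LinearEquiv.refl R M)).toAddEquiv
  exact
    { T with
      map_smul' := fun s x => by
        change T (s • x) = s • T x
        induction x using TensorProduct.induction_on with
        | zero => rw [smul_zero, map_zero, smul_zero]
        | tmul a m => rfl
        | add x y hx hy => rw [smul_add, map_add, map_add, smul_add, hx, hy] }

/-- Cohomology commutes with flat base change. -/
theorem exists_homology_extendScalars_equiv [Module.Flat R A]
    (P : CochainComplex (ModuleCat.{u} R) ℤ) (i : ℤ) :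
    Nonempty ((((ModuleCat.extendScalars.{u} (algebraMap R A)).mapHomologicalComplex
      (ComplexShape.up ℤ)).obj P).homology i ≃ₗ[A] A ⊗[R] P.homology i) := by
  have h1 : (algebraMap R A).Flat := RingHom.flat_algebraMap_iff.2 inferInstance
  have := ModuleCat.preservesFiniteLimits_extendScalars_of_flat h1
  have h2 : Limits.PreservesFiniteColimits (ModuleCat.extendScalars.{u} (algebraMap R A)) :=
    inferInstance
  let F := ModuleCat.extendScalars.{u} (algebraMap R A)
  have : F.PreservesHomology := inferInstance
  let e : (((F.mapHomologicalComplex (ComplexShape.up ℤ)).obj P).sc i).homology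
    ≅ F.obj (P.sc i).homology := (P.sc i).mapHomologyIso F
  exact ⟨e.toLinearEquiv.trans (extendScalarsEquiv A (P.homology i)).symm⟩

end

section

variable {R : Type u} [CommRing R] (S : Submonoid R) {p : PrimeSpectrum R}

/-- The localization at a prime is a flat algebra over a smaller localization. -/
theorem exists_algebra_localization (hp : Disjoint (p.asIdeal : Set R) S) :
    ∃ _ : Algebra (Localization S) (Localization p.asIdeal.primeCompl),
      IsScalarTower R (Localization S) (Localization p.asIdeal.primeCompl) ∧
      Module.Flat (Localization S) (Localization p.asIdeal.primeCompl) := by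
  have hle : S ≤ p.asIdeal.primeCompl := fun s hs hsp => Set.disjoint_left.1 hp hsp hs
  let alg := IsLocalization.localizationAlgebraOfSubmonoidLe (Localization S)
    (Localization p.asIdeal.primeCompl) S p.asIdeal.primeCompl hle
  have h1 : IsScalarTower R (Localization S) (Localization p.asIdeal.primeCompl) :=
    IsLocalization.localization_isScalarTower_of_submonoid_le _ _ S p.asIdeal.primeCompl hle
  have h2 := IsLocalization.isLocalization_of_submonoid_le (Localization S)
    (Localization p.asIdeal.primeCompl) S p.asIdeal.primeCompl hle
  exact ⟨alg, h1, IsLocalization.flat _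
    (p.asIdeal.primeCompl.map (algebraMap R (Localization S)))⟩

/-- Localization at `p` factors through inverting `S`, and the second step is again a flat base
change. -/
theorem hasProjectiveDimensionLE_localization (hp : Disjoint (p.asIdeal : Set R) S) {M : Type u}
    [AddCommGroup M] [Module R M]
    (h : HasProjectiveDimensionLE (ModuleCat.of (Localization S) (Localization S ⊗[R] M)) 1) :
    HasProjectiveDimensionLE (ModuleCat.of (Localization p.asIdeal.primeCompl)
      (LocalizedModule p.asIdeal.primeCompl M)) 1 := by
  obtain ⟨_, _, _⟩ := exists_algebra_localization S hp
  have h1 := hasProjectiveDimensionLE_baseChange (Localization p.asIdeal.primeCompl) h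
  exact hasProjectiveDimensionLE_equiv ((TensorProduct.AlgebraTensorModule.cancelBaseChange R
    (Localization S) (Localization p.asIdeal.primeCompl) (Localization p.asIdeal.primeCompl) M).trans
      (LocalizedModule.equivTensorProduct p.asIdeal.primeCompl M).symm) h1

theorem free_localization (hp : Disjoint (p.asIdeal : Set R) S) {M : Type u}
    [AddCommGroup M] [Module R M] [Module.Finite R M]
    (h : Module.Projective (Localization S) (Localization S ⊗[R] M)) :
    Module.Free (Localization p.asIdeal.primeCompl) (LocalizedModule p.asIdeal.primeCompl M) := by
  obtain ⟨_, _, _⟩ := exists_algebra_localization S hp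
  have h1 : Module.Projective (Localization p.asIdeal.primeCompl)
      (LocalizedModule p.asIdeal.primeCompl M) :=
    Module.Projective.of_equiv ((TensorProduct.AlgebraTensorModule.cancelBaseChange R
      (Localization S) (Localization p.asIdeal.primeCompl) (Localization p.asIdeal.primeCompl)
      M).trans (LocalizedModule.equivTensorProduct p.asIdeal.primeCompl M).symm)
  exact Module.free_of_flat_of_isLocalRing

theorem subsingleton_localization (hp : Disjoint (p.asIdeal : Set R) S) {M : Type*}
    [AddCommGroup M] [Module R M] (h : Subsingleton (LocalizedModule S M)) :
    Subsingleton (LocalizedModule p.asIdeal.primeCompl M) := by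
  rw [LocalizedModule.subsingleton_iff] at h ⊢
  intro m
  obtain ⟨r, hr, h1⟩ := h m
  exact ⟨r, fun hrp => Set.disjoint_left.1 hp hrp hr, h1⟩

/-- The localization of a cyclic module. -/
theorem exists_localizedModule_equiv_quotient {Q : Type*} [AddCommGroup Q] [Module R Q] (x : Q)
    (hx : ∀ y, ∃ r : R, r • x = y) {I : Ideal R} (hI : ∀ r : R, r • x = 0 ↔ r ∈ I) :
    Nonempty (LocalizedModule S Q ≃ₗ[Localization S]
      (Localization S ⧸ I.map (algebraMap R (Localization S)))) := by
  let g : Localization S →ₗ[Localization S] LocalizedModule S Q :=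
    LinearMap.toSpanSingleton _ _ (LocalizedModule.mkLinearMap S Q x)
  have hg : ∀ r : R, g (algebraMap R _ r) = LocalizedModule.mkLinearMap S Q (r • x) := fun r => by
    rw [LinearMap.toSpanSingleton_apply, algebraMap_smul, map_smul]
  have hmk : ∀ (r : R) (s : S), algebraMap R (Localization S) s * IsLocalization.mk' _ r s
      = algebraMap R (Localization S) r := fun r s => by
    rw [mul_comm]; exact IsLocalization.mk'_spec _ r s
  have hsurj : Function.Surjective g := by
    intro y
    obtain ⟨⟨z, s⟩, hz⟩ := IsLocalizedModule.surj S (LocalizedModule.mkLinearMap S Q) y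
    obtain ⟨r, rfl⟩ := hx z
    refine ⟨IsLocalization.mk' _ r s, ?_⟩
    have h1 : IsUnit (algebraMap R (Localization S) s) := IsLocalization.map_units _ s
    refine h1.smul_left_cancel.1 ?_
    rw [← map_smul, smul_eq_mul, hmk, hg, ← hz, algebraMap_smul]
    rfl
  have hker : LinearMap.ker g = I.map (algebraMap R (Localization S)) := by
    ext y
    obtain ⟨⟨r, s⟩, rfl⟩ := IsLocalization.mk'_surjective S y
    have h1 : IsUnit (algebraMap R (Localization S) s) := IsLocalization.map_units _ s
    have h3 : ∀ J : Ideal (Localization S), IsLocalization.mk' (Localization S) r s ∈ J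
        ↔ algebraMap R (Localization S) r ∈ J := fun J => by
      rw [← Ideal.unit_mul_mem_iff_mem _ h1, hmk]
    refine (h3 (LinearMap.ker g)).trans (Iff.trans ?_ (h3 _).symm)
    rw [LinearMap.mem_ker, hg, IsLocalization.algebraMap_mem_map_algebraMap_iff S,
      IsLocalizedModule.eq_zero_iff S]
    constructor
    · rintro ⟨t, ht⟩
      exact ⟨t, t.2, (hI _).1 (by rw [mul_smul]; exact ht)⟩
    · rintro ⟨t, ht, h2⟩
      exact ⟨⟨t, ht⟩, by rw [← hI, mul_smul] at h2; exact h2⟩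
  exact ⟨(g.quotKerEquivOfSurjective hsurj).symm.trans (Submodule.quotEquivOfEq _ _ hker)⟩

/-- The Fitting ideal of a finite module over a noetherian ring commutes with localization. -/
theorem fitting_localizedModule [IsNoetherianRing R] (M : Type*) [AddCommGroup M] [Module R M]
    [Module.Finite R M] :
    fitting (Localization S) (LocalizedModule S M)
      = (fitting R M).map (algebraMap R (Localization S)) := by
  have : IsNoetherianRing (Localization S) := IsLocalization.isNoetherianRing S _ inferInstance
  obtain ⟨k, g, hg⟩ := Submodule.fg_iff_exists_fin_generating_family.1
    (Module.Finite.fg_top (R := R) (M := M))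
  rw [fitting_eq_relDet g hg, relDet_localized]
  refine fitting_eq_relDet _ ?_
  rw [Set.range_comp' _ g]
  exact span_eq_top_of_isLocalizedModule (Localization S) S (LocalizedModule.mkLinearMap S M) hg

end

variable {R : Type u} [CommRing R] {P K : CochainComplex (ModuleCat.{u} R) ℤ} {p : PrimeSpectrum R}
  {a b : ℤ} (f : P ⟶ K)

theorem exactOffOne_of_subsingleton [QuasiIso f] (h : ∀ i : ℤ, i ≠ 1 →
    Subsingleton (LocalizedModule p.asIdeal.primeCompl (K.homology i))) : ExactOffOne P p := by
  intro i j k hij hjk hj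
  have := h j hj
  have h1 : Subsingleton (LocalizedModule p.asIdeal.primeCompl (P.homology j)) :=
    (LocalizedModule.injective_map p.asIdeal.primeCompl (homologyMap_bijective f j).1).subsingleton
  exact exact_dLoc_of_subsingleton hij hjk

/-- The coboundaries of degree one are free at a prime where the cohomology is concentrated in degree
one and of projective dimension at most one. -/
theorem free_range_dLoc_of_hasProjectiveDimensionLE [QuasiIso f] [IsNoetherianRing R]
    (hP : IsStrictlyPerfect a b P) (hE : ExactOffOne P p)
    (h : HasProjectiveDimensionLE (ModuleCat.of (Localization p.asIdeal.primeCompl)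
      (LocalizedModule p.asIdeal.primeCompl (K.homology 1))) 1) :
    Module.Free (Localization p.asIdeal.primeCompl) (LinearMap.range (dLoc P p 0 1)) := by
  have := finite_cycles hP 1
  have : IsNoetherianRing (Localization p.asIdeal.primeCompl) :=
    IsLocalization.isNoetherianRing p.asIdeal.primeCompl _ inferInstance
  -- The cocycles are free at every prime where the complex is exact off degree 1, without a
  -- condition on the height. The bound on the projective dimension then makes the kernel of
  -- cocycles to cohomology projective, hence free.
  have h2 := (free_cycles hP (free_range_dLoc_of_one_le hP hE rfl le_rfl)).1
  have := Module.Projective.of_free (R := Localization p.asIdeal.primeCompl)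
    (P := LocalizedModule p.asIdeal.primeCompl (P.cycles 1))
  have h1 := (projective_iff_hasProjectiveDimensionLE _).2
    ((hasProjectiveDimensionLE_iff_ker (πLoc_surjective f (p := p)) 0).1 h)
  have : Module.Free (Localization p.asIdeal.primeCompl) (LinearMap.ker (πLoc f p)) :=
    Module.free_of_flat_of_isLocalRing
  exact Module.Free.of_equiv (kerEquivRange f)

end PerfDet

/-! ### Cokernel, and assembly of the proof. -/

namespace PerfDet

variable {R : Type u} [CommRing R] {P K : CochainComplex (ModuleCat.{u} R) ℤ}
  {a b : ℤ} {f : P ⟶ K} {β : ℤ → PrimeSpectrum R → ℕ} {l : PrimeSpectrum R → ℕ}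
  {γ : ∀ i, topPow R (P.X i) ≃ₗ[R] R}

/-- Two ideals are compared at all maximal ideals. The amplitude and `H⁰ = 0` give exactness off
degree 1 at each of them, and projective dimension at most one makes the degree-one coboundaries
free there. -/
theorem IsScalar.range_eq_fitting [QuasiIso f] [IsNoetherianRing R]
    {ψ : extPow R l (K.homology 1) →ₗ[R] R} (hψ : IsScalar f a b β γ ψ)
    (hP : IsStrictlyPerfect a b P) (ha : a ≤ 1) (hb : 1 ≤ b) (h : RankCond P β l)
    (hK : InPerf 0 1 K) (h0 : Subsingleton (K.homology 0)) :
    LinearMap.range ψ = fitting R (E 1 (K.homology 1)) := by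
  refine Ideal.eq_of_localization_maximal fun m hm => ?_
  let p : PrimeSpectrum R := ⟨m, hm.isPrime⟩
  have hE : ExactOffOne P p := exactOffOne_of_subsingleton f fun i hi => by
    have : Subsingleton (K.homology i) := by
      by_cases hi0 : i = 0
      · subst hi0; exact h0
      · exact subsingleton_homology_of_inPerf hK (by omega)
    exact LocalizedModule.subsingleton_iff.2 fun m => ⟨1, one_mem _, Subsingleton.elim _ _⟩
  have : Module.Flat R (Localization p.asIdeal.primeCompl) :=
    IsLocalization.flat _ p.asIdeal.primeCompl
  exact hψ.map_range_eq (p := p) hP ha hb h hE (free_range_dLoc_of_hasProjectiveDimensionLE f hP hE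
    (hasProjectiveDimensionLE_equiv (LocalizedModule.equivTensorProduct p.asIdeal.primeCompl
      (K.homology 1)).symm (hasProjectiveDimensionLE_baseChange _
        (hasProjectiveDimensionLE_homology_one hK h0))))

/-- The cohomology of the base change of a complex `P` in terms of a quasi-isomorphic one. -/
theorem exists_homology_localization_equiv (f : P ⟶ K) [QuasiIso f] (S : Submonoid R) (i : ℤ) :
    Nonempty ((((ModuleCat.extendScalars.{u} (algebraMap R (Localization S))).mapHomologicalComplex
      (ComplexShape.up ℤ)).obj P).homology i ≃ₗ[Localization S]
        Localization S ⊗[R] K.homology i) := by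
  have : Module.Flat R (Localization S) := IsLocalization.flat _ S
  obtain ⟨e⟩ := exists_homology_extendScalars_equiv (Localization S) P i
  exact ⟨e.trans (LinearEquiv.baseChange R (Localization S) _ _
    (LinearEquiv.ofBijective _ (homologyMap_bijective f i)))⟩

/-- The comparison runs over the primes disjoint from `S`. Amplitude and vanishing are known only
after inverting `S` and are carried from there to each such prime. -/
theorem IsScalar.map_range_eq_fitting [QuasiIso f] [IsNoetherianRing R]
    {ψ : extPow R l (K.homology 1) →ₗ[R] R} (hψ : IsScalar f a b β γ ψ)
    (hP : IsStrictlyPerfect a b P) (ha : a ≤ 1) (hb : 1 ≤ b) (h : RankCond P β l) (S : Submonoid R)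
    (hS : InPerf 0 1 (((ModuleCat.extendScalars.{u} (algebraMap R
      (Localization S))).mapHomologicalComplex (ComplexShape.up ℤ)).obj P))
    (h0 : Subsingleton (LocalizedModule S (K.homology 0))) :
    Ideal.map (algebraMap R (Localization S)) (LinearMap.range ψ)
      = fitting (Localization S) (LocalizedModule S (E 1 (K.homology 1))) := by
  have := finite_homology f hP 1
  have : Module.Finite R (E 1 (K.homology 1)) :=
    ModuleCat.finite_ext R (K.homology 1) (ModuleCat.of R R) 1
  rw [fitting_localizedModule]
  have e := fun i => (exists_homology_localization_equiv f S i).some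
  have hs : ∀ i : ℤ, i ≠ 1 → Subsingleton (LocalizedModule S (K.homology i)) := by
    intro i hi
    by_cases hi0 : i = 0
    · subst hi0; exact h0
    · have := subsingleton_homology_of_inPerf hS (i := i) (by omega)
      exact ((LocalizedModule.equivTensorProduct S (K.homology i)).trans
        (e i).symm).toEquiv.subsingleton
  refine map_eq_map_of_forall_prime S fun p hp => ?_
  have hE : ExactOffOne P p :=
    exactOffOne_of_subsingleton f fun i hi => subsingleton_localization S hp (hs i hi)
  refine hψ.map_range_eq hP ha hb h hE (free_range_dLoc_of_hasProjectiveDimensionLE f hP hE ?_)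
  refine hasProjectiveDimensionLE_localization S hp (hasProjectiveDimensionLE_equiv (e 1) ?_)
  refine hasProjectiveDimensionLE_homology_one hS ?_
  exact ((e 0).trans (LocalizedModule.equivTensorProduct S
    (K.homology 0)).symm).toEquiv.subsingleton

theorem free_homology_of_inPerf [QuasiIso f] [IsNoetherianRing R] (hP : IsStrictlyPerfect a b P)
    (S : Submonoid R)
    (hS : InPerf 1 2 (((ModuleCat.extendScalars.{u} (algebraMap R
      (Localization S))).mapHomologicalComplex (ComplexShape.up ℤ)).obj P))
    (h2 : HasProjectiveDimensionLE
      (ModuleCat.of (Localization S) (LocalizedModule S (K.homology 2))) 2)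
    {p : PrimeSpectrum R} (hp : Disjoint (p.asIdeal : Set R) S) :
    Module.Free (Localization p.asIdeal.primeCompl)
      (LocalizedModule p.asIdeal.primeCompl (K.homology 1)) := by
  have := finite_homology f hP 1
  have e := fun i => (exists_homology_localization_equiv f S i).some
  have h3 := projective_homology_one hS (hasProjectiveDimensionLE_equiv
    ((LocalizedModule.equivTensorProduct S (K.homology 2)).trans (e 2).symm) h2)
  exact free_localization S hp (Module.Projective.of_equiv (e 1))

theorem exactOffOne_of_isPseudoNull (f : P ⟶ K) [QuasiIso f]
    (hK : ∀ i : ℤ, i ≠ 1 → IsPseudoNull R (K.homology i)) (p : PrimeSpectrum R)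
    (hp : p.asIdeal.height ≤ 1) : ExactOffOne P p :=
  exactOffOne_of_subsingleton f fun i hi => hK i hi p hp

theorem exists_topPow_equiv_family [Finite (MaximalSpectrum R)] (hP : IsStrictlyPerfect a b P) :
    Nonempty (∀ i, topPow R (P.X i) ≃ₗ[R] R) :=
  ⟨fun i => by
    have := hP.finite i
    have := hP.projective i
    exact exists_topPow_equiv.some⟩

section

variable {M N : Type*} [AddCommGroup M] [Module R M] [AddCommGroup N] [Module R N]

theorem exists_range_equiv (ψ : M →ₗ[R] R) (e : N ≃ₗ[R] R) :
    Nonempty ((N ⧸ LinearMap.range (e.symm.toLinearMap ∘ₗ ψ)) ≃ₗ[R] (R ⧸ LinearMap.range ψ)) := by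
  refine ⟨Submodule.Quotient.equiv _ _ e ?_⟩
  rw [LinearMap.range_comp]
  exact (Submodule.map_equiv_eq_comap_symm e _).trans
    (Submodule.comap_map_eq_of_injective e.symm.injective _)

/-- The cokernel is cyclic, generated by the class of `e.symm 1`, with annihilator the range of `ψ`.
-/
theorem exists_localizedModule_range_equiv (S : Submonoid R) (ψ : M →ₗ[R] R) (e : N ≃ₗ[R] R) :
    Nonempty (LocalizedModule S (N ⧸ LinearMap.range (e.symm.toLinearMap ∘ₗ ψ))
      ≃ₗ[Localization S]
        (Localization S ⧸ Ideal.map (algebraMap R (Localization S)) (LinearMap.range ψ))) := by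
  refine exists_localizedModule_equiv_quotient S (Submodule.Quotient.mk (e.symm 1)) (fun y => ?_)
    fun r => ?_
  · obtain ⟨y, rfl⟩ := Submodule.Quotient.mk_surjective _ y
    refine ⟨e y, ?_⟩
    rw [← Submodule.Quotient.mk_smul, ← map_smul, smul_eq_mul, mul_one, e.symm_apply_apply]
  · rw [← Submodule.Quotient.mk_smul, ← map_smul, smul_eq_mul, mul_one,
      Submodule.Quotient.mk_eq_zero]
    exact exists_congr fun z => e.symm.injective.eq_iff

end

end PerfDet

set_option maxHeartbeats 1000000 in
theorem proposition2p2 {Λ : Type v} [CommRing Λ] [IsRegularLocalRing Λ]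
    {R : Type u} [CommRing R] [Algebra Λ R]
    (hΛR : Function.Injective (algebraMap Λ R)) [Module.Free Λ R] [Module.Finite Λ R]
    (hR : ∃ e : R ≃ₗ[Λ] (R →ₗ[Λ] Λ), ∀ r x y : R, e (r * x) y = e x (r * y))
    -- a perfect complex `K`, quasi-isomorphic through `f` to the strictly perfect complex `P`
    (K P : CochainComplex (ModuleCat.{u} R) ℤ) (a b : ℤ) (ha : a ≤ 1) (hb : 1 ≤ b)
    (hP : PerfDet.IsStrictlyPerfect a b P) (f : P ⟶ K) (hf : QuasiIso f)
    (hK : ∀ i : ℤ, i ≠ 1 → PerfDet.IsPseudoNull R (K.homology i)) :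
    -- the Euler characteristic `l` is nonnegative
    ∃ l : PrimeSpectrum R → ℕ, (∀ p, (l p : ℤ) = PerfDet.eulerChar a b P p) ∧
    -- the natural map `Ψ`
    ∃ Ψ : PerfDet.extPow R l (K.homology 1) →ₗ[R] PerfDet.DetInv a b P,
      PerfDet.IsNaturalMap a b f l Ψ ∧
      (∀ Ψ' : PerfDet.extPow R l (K.homology 1) →ₗ[R] PerfDet.DetInv a b P,
        PerfDet.IsNaturalMap a b f l Ψ' → Ψ' = Ψ) ∧
      -- it does not depend on the strictly perfect complex that represents `K`
      (∀ (P' : CochainComplex (ModuleCat.{u} R) ℤ) (a' b' : ℤ), a' ≤ 1 → 1 ≤ b' →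
        PerfDet.IsStrictlyPerfect a' b' P' → ∀ f' : P' ⟶ K, QuasiIso f' →
        ∀ Ψ' : PerfDet.extPow R l (K.homology 1) →ₗ[R] PerfDet.DetInv a' b' P',
          PerfDet.IsNaturalMap a' b' f' l Ψ' →
          ∃ θ : PerfDet.DetInv a b P ≃ₗ[R] PerfDet.DetInv a' b' P',
            Ψ' = θ.toLinearMap ∘ₗ Ψ) ∧
      -- the kernel is the torsion part
      LinearMap.ker Ψ = Submodule.torsion R (PerfDet.extPow R l (K.homology 1)) ∧
      -- the cokernel, without localization
      (PerfDet.InPerf 0 1 K → Subsingleton (K.homology 0) →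
        Nonempty ((PerfDet.DetInv a b P ⧸ LinearMap.range Ψ) ≃ₗ[R]
          (R ⧸ PerfDet.fitting R (PerfDet.E 1 (K.homology 1))))) ∧
      -- the cokernel, localized at `q`
      (∀ (q : Ideal Λ) [q.IsPrime],
        PerfDet.InPerf 0 1 (PerfDet.locComplex q P) →
        Subsingleton (PerfDet.LocMod R q (K.homology 0)) →
        Nonempty (PerfDet.LocMod R q (PerfDet.DetInv a b P ⧸ LinearMap.range Ψ)
          ≃ₗ[PerfDet.LocRing R q]
          (PerfDet.LocRing R q ⧸ PerfDet.fitting (PerfDet.LocRing R q)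
            (PerfDet.LocMod R q (PerfDet.E 1 (K.homology 1)))))) ∧
      -- bijectivity at `q`
      (∀ (q : Ideal Λ) [q.IsPrime],
        PerfDet.InPerf 1 2 (PerfDet.locComplex q P) →
        HasProjectiveDimensionLE
          (ModuleCat.of (PerfDet.LocRing R q) (PerfDet.LocMod R q (K.homology 2))) 2 →
        Function.Bijective (LocalizedModule.map (PerfDet.mulSet R q) Ψ)) := by
  have hnoeth : IsNoetherianRing R := IsNoetherianRing.of_finite Λ R
  have hmax : Finite (MaximalSpectrum R) := Algebra.finite_maximalSpectrum Λ R
  have hS2 : SerreSTwo R := SerreSTwo.of_finite_free Λ R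
  have hE := PerfDet.exactOffOne_of_isPseudoNull f hK
  refine (PerfDet.exists_topPow_equiv_family hP).elim fun γ => ?_
  refine (PerfDet.exists_rankCond hP hE).elim fun β hβ => hβ.elim fun l h => ?_
  refine (PerfDet.exists_isScalar f hS2 hP ha hb h γ hE).elim fun ψ hψ => ?_
  -- The natural map is `ψ` followed by the inverse of this trivialization; every assertion is
  -- transported along `e`.
  let e := PerfDet.detInvEquiv a b γ
  have heψ : ∀ z, e ((e.symm.toLinearMap ∘ₗ ψ) z) = ψ z := fun z => e.apply_symm_apply _
  refine ⟨l, h.eq_eulerChar hP ha hb, e.symm.toLinearMap ∘ₗ ψ, ?_, ?_, ?_, ?_, ?_, ?_, ?_⟩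
  · rw [PerfDet.isNaturalMap_iff hP ha hb h γ]
    exact (funext heψ : (fun z => e ((e.symm.toLinearMap ∘ₗ ψ) z)) = ψ) ▸ hψ
  · intro Ψ' hΨ'
    rw [PerfDet.isNaturalMap_iff hP ha hb h γ] at hΨ'
    have h1 := hψ.unique hS2 hP ha hb h hE hΨ'
    refine LinearMap.ext fun z => e.injective ?_
    rw [heψ, h1]
  · intro P' a' b' ha' hb' hP' f' hf' Ψ' hΨ'
    have hE' := PerfDet.exactOffOne_of_isPseudoNull f' hK
    refine (PerfDet.exists_topPow_equiv_family hP').elim fun γ' => ?_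
    refine (PerfDet.exists_rankCond hP' hE').elim fun β' hβ' => hβ'.elim fun l' h' => ?_
    obtain rfl := PerfDet.RankCond.degree_unique (f := f) (f' := f') hP ha hb h hP' ha' hb' h'
      hE hE'
    let e' := PerfDet.detInvEquiv a' b' γ'
    rw [PerfDet.isNaturalMap_iff hP' ha' hb' h' γ'] at hΨ'
    obtain ⟨r, hr⟩ := PerfDet.IsScalar.exists_unit hS2 hP ha hb h hP' ha' hb' h' hψ
      (ψ' := e'.toLinearMap ∘ₗ Ψ') hΨ' hE hE'
    -- The isomorphism of determinants is multiplication by the unit `r` between the two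
    -- trivializations.
    refine ⟨(e.trans (LinearEquiv.smulOfUnit r)).trans e'.symm, LinearMap.ext fun z => ?_⟩
    refine e'.injective ((hr z).trans ?_)
    exact (e'.apply_symm_apply _).symm.trans
      (congrArg (fun y => e' (e'.symm ((r : R) * y))) (heψ z).symm)
  · rw [← hψ.ker_eq_torsion hS2 hP ha hb h hE]
    exact LinearEquiv.ker_comp e.symm ψ
  · intro h1 h2
    rw [← hψ.range_eq_fitting hP ha hb h h1 h2]
    exact PerfDet.exists_range_equiv ψ e
  · intro q _ h1 h2
    have h3 := hψ.map_range_eq_fitting hP ha hb h (PerfDet.mulSet R q) h1 h2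
    rw [← h3]
    exact PerfDet.exists_localizedModule_range_equiv _ ψ e
  · intro q _ h1 h2
    exact hψ.bijective hS2 hP ha hb h hE (PerfDet.mulSet R q)
      (fun p hp => PerfDet.free_homology_of_inPerf (f := f) hP _ h1 h2 hp) e
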